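/- Let $m,n\ge 1$ be integers, let $\mathcal M$ be a connected closed (compact, without boundary) smooth Riemannian manifold of dimension $m+n$, let $\mathcal K$ be a smooth triangulation of $\mathcal M$, and let $k\in\{0,\dots,m+n-1\}$. Here a smooth triangulation is a finite simplicial complex $\mathcal K$ in some $\mathbb R^N$ with a homeomorphism $t:|\mathcal K|\to\mathcal M$ whose restriction to each closed simplex is smooth with injective differential at every point; simplices of the triangulation are $t$-images of simplices of $\mathcal K$. For $C_0,\delta>0$ put $$V_\delta(\mathcal K^k)=\bigcup_{i=0}^{k}\ \bigcup_{\sigma\ \text{an } i\text{-simplex}}\{p\in\mathcal M:\operatorname{dist}(p,\sigma)<C_0^{-i}\delta\}.$$ For $0<\delta'<\delta$, a smoothed neighborhood $U_\delta(\mathcal K^k)$ is a set $U\subset\mathcal M$ such that: $V_{\delta'}(\mathcal K^k)\subset U\subset V_\delta(\mathcal K^k)$; the boundary $\partial U$ is smooth; $\mathcal M\setminus U$ is a deformation retract of $\mathcal M\setminus V_{\delta'}(\mathcal K^k)$; and $\partial U$ has a smooth tubular neighborhood in $\mathcal M$ containing $\partial V_{\delta'}(\mathcal K^k)$. Let $\mathcal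 K_*^{m+n-k-1}$ be the $(m+n-k-1)$-skeleton of the dual cell complex of $\mathcal K$, that is, the family of all simplices of the barycentric subdivision of $\mathcal K$ spanned by the barycenters of a nonempty chain $\sigma_0\subsetneq\dots\subsetneq\sigma_r$ of simplices of $\mathcal K$ with $\dim\sigma_0\ge k+1$. Then $\mathcal K_*^{m+n-k-1}$ is a simplicial complex of dimension exactly $m+n-k-1$. Moreover, there is a constant $C_1$ such that for every $C_0\ge C_1$ there is $\bar\delta>0$ such that for all $0<\delta'<\delta<\bar\delta$ and every smoothed neighborhood $U_\delta(\mathcal K^k)$ with these parameters, the complement $\mathcal M\setminus U_\delta(\mathcal K^k)$ is homotopy equivalent to $|\mathcal K_*^{m+n-k-1}|$. -/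

import Mathlib

open Set Topology Bundle
open scoped Manifold ContDiff Bundle

/-- A smooth triangulation of the `d`-dimensional manifold `M`: a finite geometric simplicial
complex in some `ℝ^N`, with a homeomorphism from its underlying space onto `M` whose restriction
to every closed simplex is smooth, with injective differential at every point of the simplex. -/
structure SmoothTriangulation (d N : ℕ) (M : Type*) [TopologicalSpace M]
    [ChartedSpace (EuclideanSpace ℝ (Fin d)) M] where
  /-- the simplicial complex -/
  complex : Geometry.SimplicialComplex ℝ (EuclideanSpace ℝ (Fin N))
  finite_faces : complex.faces.Finite
  /-- the triangulating map; only its values on the space of the complex matter -/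
  toFun : EuclideanSpace ℝ (Fin N) → M
  isHomeomorph : IsHomeomorph (fun x : complex.space => toFun x)
  contMDiffOn : ∀ s ∈ complex.faces,
    ContMDiffOn 𝓘(ℝ, EuclideanSpace ℝ (Fin N)) (𝓡 d) ∞ toFun (convexHull ℝ (s : Set _))
  /-- The differential of the restriction to a simplex lives on the direction space of the affine
  span of the simplex, on which the derivative within the simplex is unique. -/
  injective_mfderiv : ∀ s ∈ complex.faces, ∀ x ∈ convexHull ℝ (s : Set (EuclideanSpace ℝ (Fin N))),
    ∀ v ∈ vectorSpan ℝ (s : Set (EuclideanSpace ℝ (Fin N))),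
      mfderivWithin 𝓘(ℝ, EuclideanSpace ℝ (Fin N)) (𝓡 d) toFun (convexHull ℝ (s : Set _)) x v = 0 →
        v = 0

namespace SmoothTriangulation

variable {d N : ℕ} {M : Type*}

/-- The simplex of the triangulation, a subset of `M`, that corresponds to the face `s`. -/
def simplex [TopologicalSpace M] [ChartedSpace (EuclideanSpace ℝ (Fin d)) M]
    (K : SmoothTriangulation d N M) (s : Finset (EuclideanSpace ℝ (Fin N))) : Set M :=
  K.toFun '' convexHull ℝ (s : Set (EuclideanSpace ℝ (Fin N)))

/-- The neighborhood `V_δ` of the `j`-skeleton: the union, over all `i ≤ j` and all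
`i`-dimensional simplices `σ`, of the open metric neighborhoods of `σ` of radius `C₀ ^ (-i) * δ`. -/
def V [PseudoEMetricSpace M] [ChartedSpace (EuclideanSpace ℝ (Fin d)) M]
    (K : SmoothTriangulation d N M) (C₀ : ℝ) (j : ℕ) (δ : ℝ) : Set M :=
  ⋃ i ≤ j, ⋃ s ∈ {s ∈ K.complex.faces | s.card = i + 1},
    Metric.thickening ((C₀ ^ i)⁻¹ * δ) (K.simplex s)

end SmoothTriangulation

/-- `A` is a deformation retract of `X`: there is a retraction of `X` onto `A` which, as a map into
`X`, is homotopic to the identity. The homotopy is not required to fix `A`. -/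
def IsDeformationRetract {Y : Type*} [TopologicalSpace Y] (A X : Set Y) : Prop :=
  A ⊆ X ∧ ∃ r : C(X, X), (∀ x, (r x : Y) ∈ A) ∧ (∀ x : X, (x : Y) ∈ A → r x = x) ∧
    (ContinuousMap.id X).Homotopic r

section Smooth

variable (d : ℕ) {M : Type*} [TopologicalSpace M] [ChartedSpace (EuclideanSpace ℝ (Fin d)) M]

/-- The boundary of `U` is smooth: near each of its points, it is the zero set of a smooth function
with nonzero differential there, negative exactly in the interior of `U`. -/
def HasSmoothBoundary (U : Set M) : Prop :=
  ∀ p ∈ frontier U, ∃ W : Set M, IsOpen W ∧ p ∈ W ∧ ∃ f : M → ℝ,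
    ContMDiffOn (𝓡 d) 𝓘(ℝ, ℝ) ∞ f W ∧ mfderiv (𝓡 d) 𝓘(ℝ, ℝ) f p ≠ 0 ∧
      ∀ q ∈ W, (q ∈ interior U ↔ f q < 0) ∧ (q ∈ frontier U ↔ f q = 0)

/-- `C` is a smooth tubular neighborhood of the (two-sided, smooth) hypersurface `S`: the open set
`C` is identified with `S × (-1, 1)` by a diffeomorphism `p ↦ (ρ p, h p)` that sends `p ∈ S`
to `(p, 0)`. A smooth bijection onto `S × (-1, 1)` with injective differentials is a
diffeomorphism, the dimensions being equal. -/
def IsTubularNeighborhood (S C : Set M) : Prop :=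
  IsOpen C ∧ S ⊆ C ∧ ∃ (ρ : M → M) (h : M → ℝ),
    ContMDiffOn (𝓡 d) (𝓡 d) ∞ ρ C ∧ ContMDiffOn (𝓡 d) 𝓘(ℝ, ℝ) ∞ h C ∧
    BijOn (fun p => (ρ p, h p)) C (S ×ˢ Ioo (-1 : ℝ) 1) ∧
    (∀ p ∈ S, ρ p = p ∧ h p = 0) ∧
    ∀ p ∈ C, ∀ v : TangentSpace (𝓡 d) p,
      mfderiv (𝓡 d) (𝓡 d) ρ p v = 0 → mfderiv (𝓡 d) 𝓘(ℝ, ℝ) h p v = 0 → v = 0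

end Smooth

/-- `U` is a smoothed neighborhood `U_δ` of the `j`-skeleton, for the parameters `C₀` and
`δ' < δ`. -/
structure IsSmoothedNeighborhood {d N : ℕ} {M : Type*} [PseudoEMetricSpace M]
    [ChartedSpace (EuclideanSpace ℝ (Fin d)) M] (K : SmoothTriangulation d N M)
    (C₀ : ℝ) (j : ℕ) (δ' δ : ℝ) (U : Set M) : Prop where
  subset_V : U ⊆ K.V C₀ j δ
  V_subset : K.V C₀ j δ' ⊆ U
  smoothBoundary : HasSmoothBoundary d U
  deformationRetract : IsDeformationRetract Uᶜ (K.V C₀ j δ')ᶜ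
  tubular : ∃ C : Set M, IsTubularNeighborhood d (frontier U) C ∧ frontier (K.V C₀ j δ') ⊆ C

namespace Geometry.SimplicialComplex

variable {E : Type*} [AddCommGroup E] [Module ℝ E]

/-- The complex has dimension exactly `p`. -/
def HasDimension (L : SimplicialComplex ℝ E) (p : ℕ) : Prop :=
  (∀ s ∈ L.faces, s.card ≤ p + 1) ∧ ∃ s ∈ L.faces, s.card = p + 1

/-- The simplices of the dual cell of the face `s`: those simplices of the barycentric subdivision
of `K`, each spanned by the barycenters of a nonempty chain of faces of `K`, for which all faces
in the chain contain `s`. -/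
noncomputable def dualCell (K : SimplicialComplex ℝ E) (s : Finset E) : Set (Finset E) :=
  {u | ∃ c : Set (Finset E), c.Nonempty ∧ c ⊆ K.faces ∧ IsChain (· ⊆ ·) c ∧ (∀ t ∈ c, s ⊆ t) ∧
    (u : Set E) = (fun t : Finset E => t.centroid ℝ id) '' c}

/-- The simplices of the `p`-skeleton of the dual cell complex of `K`, where `K` triangulates a
`d`-manifold: those of the dual cells, of dimension `d - dim s ≤ p`, of the faces `s`
(with `dim s = s.card - 1`). -/
noncomputable def dualSkeleton (K : SimplicialComplex ℝ E) (d p : ℕ) : Set (Finset E) :=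
  ⋃ s ∈ {s ∈ K.faces | d + 1 ≤ p + s.card}, K.dualCell s

end Geometry.SimplicialComplex

/-! By assumption the complement of `U` is a deformation retract of the complement of `V` for the
parameter `δ'`, so it suffices to compare the complement of `V` with the dual skeleton. Both are
compared with the complement of the `k`-skeleton, in barycentric coordinates.

A point lies off the `k`-skeleton when at least `k + 2` of its coordinates are positive, and in the
dual skeleton when `k + 2` of them are equal and maximal. Cutting all coordinates at the level of
the `k + 2`-nd largest and renormalising is a retraction, homotopic to the identity along segments
inside simplices (`isDeformationRetract_dualRealization`). The barycentric description of the dual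
skeleton is `space_dualComplex`.

To compare the complement of `V` with that of the skeleton, points are pushed radially away from the
simplices `σ` of dimension at most `k`, in order of increasing dimension, until the weight outside
each of them is bounded below (`exists_homotopyWith_preservesFar`). For small `δ` the final map
takes values off `V`; what has to be shown is that no stage of the homotopy leads from outside `V`
into `V` (`exists_le_distSimplex_push`). When `σ` is treated, the points that still move are close
to `σ` and far from its proper faces. They stay far from every simplex that does not contain `σ`.
For `ρ ⊇ σ`, the push is undone by a homothety with centre `a` in `σ` and ratio `μ ≤ 1`, and near
`a` such a homothety does not increase the distance to `ρ` (`exists_infEDist_homothety_le`).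

This last fact is the Riemannian core. An almost shortest curve to `ρ` stays near `a`, hence in
simplices containing `a`, and its image under the homothety again ends in `ρ`. Inside one simplex,
the pulled-back metric changes by a factor at most `1 + C * (1 - μ) * ‖u - a‖` between a point `u`
and its image, while vectors shrink by `μ`. If `‖u - a‖ ≤ C⁻¹` the total factor is at most `μ * (2 -
μ) ≤ 1`, so the image curve is not longer. -/

/-! ### Lipschitz dependence of the pulled-back metric on the base point -/

/-- A `C^1` function on a compact convex set with nonempty interior is Lipschitz. -/
theorem ContDiffOn.exists_abs_sub_le_mul_norm {V : Type*} [NormedAddCommGroup V] [NormedSpace ℝ V]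
    {S : Set V} {f : V → ℝ} (hf : ContDiffOn ℝ 1 f S) (hS : IsCompact S) (hc : Convex ℝ S)
    (hi : (interior S).Nonempty) :
    ∃ K : ℝ, 0 < K ∧ ∀ x ∈ S, ∀ y ∈ S, |f x - f y| ≤ K * ‖x - y‖ := by
  have hu := uniqueDiffOn_convex hc hi
  obtain ⟨K, hK⟩ := hS.exists_bound_of_continuousOn (hf.continuousOn_fderivWithin hu le_rfl)
  refine ⟨max K 1, by positivity, fun x hx y hy => ?_⟩
  refine (hc.norm_image_sub_le_of_norm_fderivWithin_le (hf.differentiableOn one_ne_zero)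
    hK hy hx).trans ?_
  gcongr
  exact le_max_left _ _

section Riemannian

variable {d : ℕ} {M : Type*} [MetricSpace M] [ChartedSpace (EuclideanSpace ℝ (Fin d)) M]
  [RiemannianBundle (fun x : M => TangentSpace (𝓡 d) x)]
  {V : Type*} [NormedAddCommGroup V] [NormedSpace ℝ V] {D : Set V} {T : V → M}

variable (d) in
/-- The length of the vector `w` at the point `u` for the metric pulled back by `T` from `M`. -/
noncomputable def pullbackNorm (T : V → M) (D : Set V) (u w : V) : ℝ :=
  ‖mfderivWithin 𝓘(ℝ, V) (𝓡 d) T D u w‖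

theorem pullbackNorm_nonneg (u w : V) : 0 ≤ pullbackNorm d T D u w := norm_nonneg _

theorem pullbackNorm_smul (u w : V) (c : ℝ) :
    pullbackNorm d T D u (c • w) = |c| * pullbackNorm d T D u w :=
  (congrArg norm ((mfderivWithin 𝓘(ℝ, V) (𝓡 d) T D u).map_smul c w)).trans (norm_smul _ _)

theorem pullbackNorm_zero (u : V) : pullbackNorm d T D u 0 = 0 :=
  (congrArg norm (mfderivWithin 𝓘(ℝ, V) (𝓡 d) T D u).map_zero).trans norm_zero

variable [IsManifold (𝓡 d) ∞ M]
  [IsContMDiffRiemannianBundle (𝓡 d) ∞ (EuclideanSpace ℝ (Fin d))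
    (fun x : M => TangentSpace (𝓡 d) x)]

/-- The square is used because the norm itself is not differentiable at the zero vector. It is the
Riemannian inner product of the tangent map with itself, so it loses just the one derivative spent
on the tangent map. -/
theorem contDiffOn_sq_pullbackNorm {j l : ℕ∞} (hT : ContMDiffOn 𝓘(ℝ, V) (𝓡 d) l T D)
    (hD : UniqueDiffOn ℝ D) (hjl : (j : WithTop ℕ∞) + 1 ≤ l) :
    ContDiffOn ℝ j (fun p : V × V => pullbackNorm d T D p.1 p.2 ^ 2)
      (D ×ˢ univ) := by
  have : IsManifold (𝓡 d) (l : WithTop ℕ∞) M :=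
    IsManifold.of_le (n := ∞) (by exact_mod_cast le_top)
  have : IsManifold (𝓡 d) 1 M := IsManifold.of_le (n := ∞) (by exact_mod_cast le_top)
  have : IsContMDiffRiemannianBundle (𝓡 d) j (EuclideanSpace ℝ (Fin d))
    (fun x : M => TangentSpace (𝓡 d) x) := .of_le (n := ∞) (by exact_mod_cast le_top)
  have h1 := hT.contMDiffOn_tangentMapWithin hjl hD.uniqueMDiffOn
  have h2 : ContMDiff (𝓘(ℝ, V × V)) (𝓘(ℝ, V).tangent) j
      (fun p : V × V => (⟨p.1, p.2⟩ : TangentBundle 𝓘(ℝ, V) V)) := by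
    intro p
    rw [contMDiffAt_totalSpace]
    refine ⟨contDiff_fst.contMDiff.contMDiffAt, ?_⟩
    have h : ContMDiffAt (𝓘(ℝ, V × V)) 𝓘(ℝ, V) j (fun p : V × V => p.2) p :=
      contDiff_snd.contMDiff.contMDiffAt
    refine h.congr_of_eventuallyEq (Filter.Eventually.of_forall fun q => ?_)
    simp
  have h3 := h1.comp (s := D ×ˢ univ) h2.contMDiffOn (fun p hp => hp.1)
  have h4 := ContMDiffOn.inner_bundle (b := fun p : V × V => T p.1)
    (v := fun p : V × V => mfderivWithin 𝓘(ℝ, V) (𝓡 d) T D p.1 p.2)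
    (w := fun p : V × V => mfderivWithin 𝓘(ℝ, V) (𝓡 d) T D p.1 p.2) h3 h3
  refine h4.contDiffOn.congr fun p _ => ?_
  rw [real_inner_self_eq_norm_sq]
  rfl

theorem continuousOn_pullbackNorm {l : ℕ∞} (hT : ContMDiffOn 𝓘(ℝ, V) (𝓡 d) l T D)
    (hD : UniqueDiffOn ℝ D) (hl : 1 ≤ l) :
    ContinuousOn (fun p : V × V => pullbackNorm d T D p.1 p.2) (D ×ˢ univ) := by
  have h := (contDiffOn_sq_pullbackNorm (j := 0) hT hD (by simpa using hl)).continuousOn.sqrt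
  simpa [Real.sqrt_sq (pullbackNorm_nonneg _ _)] using h

/-- The Riemannian metric, pulled back to a convex body by an immersion, is a Lipschitz function
of the base point, uniformly in the tangent vector. -/
theorem exists_pullbackNorm_le [FiniteDimensional ℝ V]
    (hT : ContMDiffOn 𝓘(ℝ, V) (𝓡 d) ∞ T D) (hDc : IsCompact D) (hD : Convex ℝ D)
    (hDi : (interior D).Nonempty)
    (hinj : ∀ u ∈ D, ∀ w : V, pullbackNorm d T D u w = 0 → w = 0) :
    ∃ C : ℝ, 0 < C ∧ ∀ u ∈ D, ∀ u' ∈ D, ∀ w : V,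
      pullbackNorm d T D u w ≤ (1 + C * ‖u - u'‖) * pullbackNorm d T D u' w := by
  set N : V → V → ℝ := pullbackNorm d T D with hN
  have hu := uniqueDiffOn_convex hD hDi
  have hC1 := contDiffOn_sq_pullbackNorm (j := 1) (l := ⊤) hT hu (mod_cast le_top)
  -- The closed ball, not the sphere, is the range of the tangent vectors here: the Lipschitz bound
  -- needs a convex domain with nonempty interior.
  obtain ⟨K, hK0, hK⟩ := (hC1.mono (prod_mono_right (subset_univ
      (Metric.closedBall (0 : V) 1)))).exists_abs_sub_le_mul_norm
    (hDc.prod (isCompact_closedBall _ _)) (hD.prod (convex_closedBall _ _))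
    (by rw [interior_prod_eq]
        exact hDi.prod ⟨0, Metric.ball_subset_interior_closedBall (by simp)⟩)
  obtain ⟨c, hc0, hc⟩ := (hDc.prod (isCompact_sphere (0 : V) 1)).exists_forall_le' (a := 0)
    (hC1.continuousOn.mono (prod_mono_right (subset_univ _))) (by
      rintro ⟨u, w⟩ ⟨hu, hw⟩
      have h0 : pullbackNorm d T D u w ≠ 0 := fun h => by
        rw [hinj u hu w h] at hw
        simp at hw
      positivity)
  -- On unit vectors the squares differ by at most `K * ‖u - u'‖`, which is at most `K / c * ‖u -
  -- u'‖` times the square at `u'`; then `1 + x ≤ (1 + x) ^ 2` permits taking roots.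
  refine ⟨K / c, by positivity, fun u hu u' hu' w => ?_⟩
  rcases eq_or_ne w 0 with rfl | hw
  · simp [hN, pullbackNorm_zero]
  set e : V := ‖w‖⁻¹ • w with he
  have hw' : w = ‖w‖ • e := by rw [he, smul_inv_smul₀ (norm_ne_zero_iff.2 hw)]
  have hen : ‖e‖ = 1 := by rw [he, norm_smul]; simp [hw]
  have hs : ∀ x, N x w = ‖w‖ * N x e := fun x => by
    conv_lhs => rw [hw']
    rw [hN, pullbackNorm_smul, abs_norm]
  have h1 := hK (u, e) ⟨hu, by simp [hen]⟩ (u', e) ⟨hu', by simp [hen]⟩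
  have h2 := hc (u', e) ⟨hu', by simp [hen]⟩
  have h3 : ‖(u, e) - (u', e)‖ = ‖u - u'‖ := by simp [Prod.norm_def]
  rw [h3] at h1
  have h1' : N u e ^ 2 - N u' e ^ 2 ≤ K * ‖u - u'‖ := (le_abs_self _).trans h1
  have h2' : c ≤ N u' e ^ 2 := h2
  have h4 : N u e ≤ (1 + K / c * ‖u - u'‖) * N u' e := by
    refine (pow_le_pow_iff_left₀ (pullbackNorm_nonneg _ _) (by have := pullbackNorm_nonneg (d := d) (T := T) (D := D) u' e; positivity) two_ne_zero).1 ?_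
    have h5 : K * ‖u - u'‖ ≤ (K / c * ‖u - u'‖) * N u' e ^ 2 := by
      calc K * ‖u - u'‖ = (K / c * ‖u - u'‖) * c := by field_simp
        _ ≤ _ := by gcongr
    have h6 : 0 ≤ (K / c * ‖u - u'‖) * N u' e ^ 2 := by positivity
    have h7 : 0 ≤ (K / c * ‖u - u'‖) ^ 2 * N u' e ^ 2 := by positivity
    nlinarith
  rw [hs, hs]
  calc ‖w‖ * N u e ≤ ‖w‖ * ((1 + K / c * ‖u - u'‖) * N u' e) := by gcongr
    _ = _ := by ring

end Riemannian

/-! ### Speed of a curve read through an immersion -/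

section Velocity

variable {d : ℕ} {M : Type*} [MetricSpace M] [ChartedSpace (EuclideanSpace ℝ (Fin d)) M]
  [RiemannianBundle (fun x : M => TangentSpace (𝓡 d) x)]
  {V : Type*} [NormedAddCommGroup V] [NormedSpace ℝ V] {D : Set V} {T : V → M}

variable (d) in
/-- The Riemannian norm at `p` of a vector of the model space. -/
noncomputable def tangentNorm (p : M) (e : EuclideanSpace ℝ (Fin d)) : ℝ :=
  ‖(show TangentSpace (𝓡 d) p from e)‖

theorem tangentNorm_add_le (p : M) (e e' : EuclideanSpace ℝ (Fin d)) :
    tangentNorm d p (e + e') ≤ tangentNorm d p e + tangentNorm d p e' :=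
  norm_add_le (show TangentSpace (𝓡 d) p from e) (show TangentSpace (𝓡 d) p from e')

theorem tangentNorm_smul (p : M) (c : ℝ) (e : EuclideanSpace ℝ (Fin d)) :
    tangentNorm d p (c • e) = |c| * tangentNorm d p e :=
  norm_smul c (show TangentSpace (𝓡 d) p from e)

/-- The fibre carries the Riemannian norm but the topology of the model space, so the identity is a
bounded operator. -/
theorem exists_tangentNorm_le (p : M) :
    ∃ C : ℝ, 0 < C ∧ ∀ e : EuclideanSpace ℝ (Fin d), tangentNorm d p e ≤ C * ‖e‖ := by
  let F : EuclideanSpace ℝ (Fin d) →L[ℝ] TangentSpace (𝓡 d) p :=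
    ContinuousLinearMap.id ℝ (EuclideanSpace ℝ (Fin d))
  refine ⟨‖F‖ + 1, by positivity, fun e => (F.le_opNorm e).trans ?_⟩
  gcongr
  linarith

theorem continuous_pullbackNorm (u : V) : Continuous (pullbackNorm d T D u) :=
  continuous_norm.comp (mfderivWithin 𝓘(ℝ, V) (𝓡 d) T D u).continuous

theorem exists_norm_le_mul_pullbackNorm [FiniteDimensional ℝ V] {u : V}
    (hinj : ∀ w : V, pullbackNorm d T D u w = 0 → w = 0) :
    ∃ K : ℝ, 0 < K ∧ ∀ w, ‖w‖ ≤ K * pullbackNorm d T D u w := by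
  obtain ⟨c, hc0, hc⟩ := (isCompact_sphere (0 : V) 1).exists_forall_le' (a := 0)
    (continuous_pullbackNorm (T := T) (D := D) (d := d) u).continuousOn (by
      intro w hw
      refine lt_of_le_of_ne (pullbackNorm_nonneg _ _) fun h => ?_
      rw [hinj w h.symm] at hw
      simp at hw)
  refine ⟨c⁻¹, by positivity, fun w => ?_⟩
  rcases eq_or_ne w 0 with rfl | hw
  · simp [pullbackNorm_zero]
  have h := hc (‖w‖⁻¹ • w) (by simp [norm_smul, hw])
  rw [pullbackNorm_smul, abs_inv, abs_norm] at h
  have : 0 < ‖w‖ := norm_pos_iff.2 hw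
  field_simp at h ⊢
  linarith

/-- The manifold derivative at `u` is by definition the derivative read in the preferred chart at `T
u`. Hence two maps with the same value at a point can be compared to first order in a single chart.
-/
theorem hasFDerivWithinAt_extChartAt_comp {u : V}
    (hT : MDifferentiableWithinAt 𝓘(ℝ, V) (𝓡 d) T D u) :
    HasFDerivWithinAt (fun x => extChartAt (𝓡 d) (T u) (T x))
      (mfderivWithin 𝓘(ℝ, V) (𝓡 d) T D u : V →L[ℝ] EuclideanSpace ℝ (Fin d)) D u := by
  have h := hT.hasMFDerivWithinAt.2
  have e : (extChartAt 𝓘(ℝ, V) u).symm ⁻¹' D ∩ range 𝓘(ℝ, V) = D := by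
    simp only [mfld_simps]
    rfl
  rw [e] at h
  exact h

/-- If a curve `γ` in `M` coincides on `S` with the image by the immersion `T` of the curve `u`,
then the increments of `u` are controlled by the speed of `γ`. -/
theorem eventually_pullbackNorm_sub_le [FiniteDimensional ℝ V] {γ : ℝ → M} {J S : Set ℝ} {s : ℝ}
    (hγ : MDifferentiableWithinAt 𝓘(ℝ, ℝ) (𝓡 d) γ J s) (hSJ : S ⊆ J) (hs : s ∈ S) {u : ℝ → V}
    (hT : MDifferentiableWithinAt 𝓘(ℝ, V) (𝓡 d) T D (u s))
    (hinj : ∀ w : V, pullbackNorm d T D (u s) w = 0 → w = 0)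
    (huS : MapsTo u S D) (hu : ContinuousWithinAt u S s) (hTu : ∀ x ∈ S, T (u x) = γ x)
    {ε : ℝ} (hε : 0 < ε) :
    ∀ᶠ x in 𝓝[S] s, pullbackNorm d T D (u s) (u x - u s) ≤
      (pullbackNorm d γ J s 1 + ε) * |x - s| := by
  obtain ⟨C, hC0, hC⟩ := exists_tangentNorm_le (d := d) (T (u s))
  obtain ⟨K, hK0, hK⟩ := exists_norm_le_mul_pullbackNorm hinj
  set b := pullbackNorm d γ J s 1 with hb
  have hb0 : 0 ≤ b := pullbackNorm_nonneg _ _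
  -- Chosen so that `b + C * η = (1 - C * η * K) * (b + ε)`: the first-order error of `γ` and that
  -- of `T`, the latter proportional to the increment of `u` itself, are absorbed together.
  set η := ε / (C * (1 + (b + ε) * K)) with hη
  have hη0 : 0 < η := by positivity
  have h1 := (hasFDerivWithinAt_extChartAt_comp hT).isLittleO.def hη0
  have h1' := (hu.tendsto_nhdsWithin huS).eventually h1
  have h2 := (hasFDerivWithinAt_extChartAt_comp hγ).isLittleO.def hη0
  have h2' := nhdsWithin_mono s hSJ h2
  set A : V →L[ℝ] EuclideanSpace ℝ (Fin d) := mfderivWithin 𝓘(ℝ, V) (𝓡 d) T D (u s) with hA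
  set B : ℝ →L[ℝ] EuclideanSpace ℝ (Fin d) := mfderivWithin 𝓘(ℝ, ℝ) (𝓡 d) γ J s with hB
  have hbB : b = tangentNorm d (T (u s)) (B 1) := by rw [hTu s hs]; rfl
  filter_upwards [h1', h2', self_mem_nhdsWithin] with x hx1 hx2 hxS
  rw [← hTu s hs, ← hTu x hxS] at hx2
  set X := pullbackNorm d T D (u s) (u x - u s) with hX
  set r := extChartAt (𝓡 d) (T (u s)) (T (u x)) - extChartAt (𝓡 d) (T (u s)) (T (u s)) with hr
  have hdec : A (u x - u s) = (x - s) • B 1 + (r - B (x - s)) + (-1 : ℝ) • (r - A (u x - u s)) := by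
    have : B (x - s) = (x - s) • B 1 := by rw [← map_smul]; simp
    rw [this]; simp
  have hXe : X = tangentNorm d (T (u s)) (A (u x - u s)) := rfl
  have h3 : X ≤ |x - s| * b + C * (η * |x - s|) + C * (η * ‖u x - u s‖) := by
    rw [hXe, hdec, hbB]
    refine (tangentNorm_add_le _ _ _).trans (add_le_add ((tangentNorm_add_le _ _ _).trans
      (add_le_add ?_ ?_)) ?_)
    · rw [tangentNorm_smul]
    · exact (hC _).trans (by gcongr; exact hx2)
    · rw [tangentNorm_smul, abs_neg, abs_one, one_mul]
      exact (hC _).trans (by gcongr)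
  have h4 := hK (u x - u s)
  rw [← hX] at h4
  have h5 : C * (η * ‖u x - u s‖) ≤ C * η * K * X := by
    calc C * (η * ‖u x - u s‖) ≤ C * (η * (K * X)) := by gcongr
      _ = _ := by ring
  have h6 : C * η * (1 + (b + ε) * K) = ε := by rw [hη]; field_simp
  have h7 : C * η * K < 1 := by
    by_contra h
    push Not at h
    nlinarith [mul_pos hC0 hη0, mul_nonneg hb0 (sub_nonneg.2 h)]
  have h8 : (1 - C * η * K) * X ≤ (1 - C * η * K) * ((b + ε) * |x - s|) := by
    have : (1 - C * η * K) * ((b + ε) * |x - s|) = |x - s| * (b + C * η) := by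
      linear_combination (-|x - s|) * h6
    rw [this]
    nlinarith
  exact le_of_mul_le_mul_left h8 (by linarith)

end Velocity

/-! ### Distances and lengths of curves -/

section Distance

variable {d : ℕ} {M : Type*} [MetricSpace M] [ChartedSpace (EuclideanSpace ℝ (Fin d)) M]
  [RiemannianBundle (fun x : M => TangentSpace (𝓡 d) x)]
  {V : Type*} [NormedAddCommGroup V] [NormedSpace ℝ V] {D : Set V} {T : V → M}

theorem pathELength_eq_lintegral_pullbackNorm (γ : ℝ → M) :
    Manifold.pathELength (𝓡 d) γ 0 1 =
      ∫⁻ s in Icc (0 : ℝ) 1, ENNReal.ofReal (pullbackNorm d γ (Icc 0 1) s 1) := by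
  rw [Manifold.pathELength_eq_lintegral_mfderivWithin_Icc]
  simp only [pullbackNorm, ofReal_norm]
  rfl

section

variable [IsRiemannianManifold (𝓡 d) M]

/-- The distance between the images of two points of a convex set is at most the length of the
image of the segment between them. -/
theorem edist_le_of_pullbackNorm_le (hT : ContMDiffOn 𝓘(ℝ, V) (𝓡 d) 1 T D) (hD : Convex ℝ D)
    {u u' : V} (hu : u ∈ D) (hu' : u' ∈ D) {B : ℝ}
    (hB : ∀ x ∈ segment ℝ u u', pullbackNorm d T D x (u' - u) ≤ B) :
    edist (T u) (T u') ≤ ENNReal.ofReal B := by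
  let η : ℝ → V := AffineMap.lineMap u u'
  have hη : ContDiff ℝ 1 η := by
    have : η = fun t => t • (u' - u) + u := by ext t; simp [η, AffineMap.lineMap_apply]
    rw [this]
    fun_prop
  have hseg : ∀ t ∈ Icc (0 : ℝ) 1, η t ∈ segment ℝ u u' := fun t ht => by
    rw [segment_eq_image_lineMap]; exact ⟨t, ht, rfl⟩
  have hmap : MapsTo η (Icc 0 1) D := fun t ht => hD.segment_subset hu hu' (hseg t ht)
  have hγ : ContMDiffOn 𝓘(ℝ, ℝ) (𝓡 d) 1 (T ∘ η) (Icc 0 1) :=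
    hT.comp hη.contMDiff.contMDiffOn hmap
  rw [IsRiemannianManifold.out (I := 𝓡 d) (T u) (T u')]
  refine (Manifold.riemannianEDist_le_pathELength hγ (by simp [η]) (by simp [η])
    zero_le_one).trans ?_
  rw [pathELength_eq_lintegral_pullbackNorm]
  calc ∫⁻ s in Icc (0 : ℝ) 1, ENNReal.ofReal (pullbackNorm d (T ∘ η) (Icc 0 1) s 1)
      ≤ ∫⁻ s in Icc (0 : ℝ) 1, ENNReal.ofReal B := by
        refine MeasureTheory.setLIntegral_mono' measurableSet_Icc fun s hs => ?_
        refine ENNReal.ofReal_le_ofReal (le_trans (le_of_eq ?_) (hB _ (hseg s hs)))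
        have hηd : MDifferentiableWithinAt 𝓘(ℝ, ℝ) 𝓘(ℝ, V) η (Icc 0 1) s :=
          (hη.contMDiff.contMDiffOn.mdifferentiableOn one_ne_zero) s hs
        have h1 : mfderivWithin 𝓘(ℝ, ℝ) (𝓡 d) (T ∘ η) (Icc 0 1) s =
            (mfderivWithin 𝓘(ℝ, V) (𝓡 d) T D (η s)).comp
              (mfderivWithin 𝓘(ℝ, ℝ) 𝓘(ℝ, V) η (Icc 0 1) s) :=
          mfderivWithin_comp s (hT.mdifferentiableOn one_ne_zero _ (hmap hs)) hηd hmap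
            ((uniqueDiffOn_Icc zero_lt_one).uniqueMDiffOn s hs)
        have h2 : (mfderivWithin 𝓘(ℝ, ℝ) 𝓘(ℝ, V) η (Icc 0 1) s : ℝ →L[ℝ] V) 1 = u' - u := by
          rw [mfderivWithin_eq_fderivWithin]
          have h3 : HasDerivAt η (u' - u) s := by
            simpa [η] using (AffineMap.hasDerivAt_lineMap (a := u) (b := u') (x := s))
          rw [h3.hasFDerivAt.hasFDerivWithinAt.fderivWithin (uniqueDiffOn_Icc zero_lt_one s hs)]
          exact one_smul ℝ (u' - u)
        have h5 := congrArg norm (congrArg (fun F => F (1 : ℝ)) h1)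
        refine h5.trans ?_
        conv_rhs => rw [← h2]
        rfl
    _ = ENNReal.ofReal B := by simp

/-- Along the segment from `u` to `u'` the metric differs from the one frozen at `u` by a factor at
most `1 + C * ‖u' - u‖`. -/
theorem dist_le_of_pullbackNorm_le (hT : ContMDiffOn 𝓘(ℝ, V) (𝓡 d) 1 T D) (hD : Convex ℝ D)
    {C : ℝ} (hC0 : 0 ≤ C) (hC : ∀ u ∈ D, ∀ u' ∈ D, ∀ w : V,
      pullbackNorm d T D u w ≤ (1 + C * ‖u - u'‖) * pullbackNorm d T D u' w)
    {u u' : V} (hu : u ∈ D) (hu' : u' ∈ D) :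
    dist (T u) (T u') ≤ (1 + C * ‖u' - u‖) * pullbackNorm d T D u (u' - u) := by
  have h0 := pullbackNorm_nonneg (d := d) (T := T) (D := D) u (u' - u)
  rw [← ENNReal.ofReal_le_ofReal_iff (by positivity), ← edist_dist]
  refine edist_le_of_pullbackNorm_le hT hD hu hu' fun x hx => ?_
  refine (hC x (hD.segment_subset hu hu' hx) u hu _).trans ?_
  gcongr
  obtain ⟨t, ht, rfl⟩ := (segment_eq_image_lineMap ℝ u u').subset hx
  rw [AffineMap.lineMap_apply_module', add_sub_cancel_right, norm_smul, Real.norm_eq_abs,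
    abs_of_nonneg ht.1]
  exact mul_le_of_le_one_left (norm_nonneg _) ht.2

end

variable [IsManifold (𝓡 d) ∞ M]
  [IsContMDiffRiemannianBundle (𝓡 d) ∞ (EuclideanSpace ℝ (Fin d))
    (fun x : M => TangentSpace (𝓡 d) x)]

/-- A curve whose increments are controlled by the speed of a `C^1` curve `γ` joins points whose
distance is at most the length of `γ`. -/
theorem edist_le_pathELength_of_speed_le {γ : ℝ → M}
    (hγ : ContMDiffOn 𝓘(ℝ, ℝ) (𝓡 d) 1 γ (Icc 0 1)) {P : ℝ → M} (hP : ContinuousOn P (Icc 0 1))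
    (h : ∀ s ∈ Ico (0 : ℝ) 1, ∀ r > pullbackNorm d γ (Icc 0 1) s 1,
      ∀ᶠ x in 𝓝[>] s, dist (P s) (P x) ≤ r * (x - s)) :
    edist (P 0) (P 1) ≤ Manifold.pathELength (𝓡 d) γ 0 1 := by
  set l : ℝ → ℝ := fun s => pullbackNorm d γ (Icc 0 1) s 1 with hl
  have hlc : ContinuousOn l (Icc 0 1) :=
    (continuousOn_pullbackNorm (l := 1) hγ (uniqueDiffOn_Icc zero_lt_one) le_rfl).comp
      (f := fun s : ℝ => (s, (1 : ℝ))) (by fun_prop) (fun s hs => ⟨hs, mem_univ _⟩)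
  -- Extending the speed by constants beyond the interval makes its primitive differentiable at the
  -- endpoints as well.
  set l' : ℝ → ℝ := IccExtend zero_le_one ((Icc 0 1).domRestrict l) with hl'
  have hl'c : Continuous l' := hlc.domRestrict.Icc_extend'
  have hll : ∀ s ∈ Icc (0 : ℝ) 1, l' s = l s := fun s hs => by
    rw [hl', IccExtend_of_mem _ _ hs]; rfl
  have hint : Manifold.pathELength (𝓡 d) γ 0 1 = ENNReal.ofReal (∫ s in (0 : ℝ)..1, l' s) := by
    rw [pathELength_eq_lintegral_pullbackNorm, intervalIntegral.integral_of_le zero_le_one,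
      ← MeasureTheory.integral_Icc_eq_integral_Ioc,
      MeasureTheory.ofReal_integral_eq_lintegral_ofReal]
    · refine MeasureTheory.setLIntegral_congr_fun measurableSet_Icc fun s hs => ?_
      rw [hll s hs]
    · exact hl'c.continuousOn.integrableOn_Icc
    · refine (MeasureTheory.ae_restrict_iff' measurableSet_Icc).2 (Filter.Eventually.of_forall ?_)
      intro s hs
      rw [hll s hs]
      exact pullbackNorm_nonneg _ _
  rw [hint, edist_dist]
  apply ENNReal.ofReal_le_ofReal
  -- Mean value inequality for lower right slopes: no differentiability of `P` is available, or
  -- needed.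
  refine image_le_of_liminf_slope_right_le_deriv_boundary (f := fun s => dist (P 0) (P s))
    (a := 0) (b := 1) (B := fun x => ∫ s in (0 : ℝ)..x, l' s) (B' := l')
    ((continuous_const.dist continuous_id).comp_continuousOn hP) (by simp) ?_ ?_ ?_ (right_mem_Icc.2 zero_le_one)
  · exact fun x _ => ((hl'c.integral_hasStrictDerivAt 0 x).hasDerivAt.continuousAt).continuousWithinAt
  · exact fun x _ => (hl'c.integral_hasStrictDerivAt 0 x).hasDerivAt.hasDerivWithinAt
  · intro x hx r hr
    rw [hll x (Ico_subset_Icc_self hx)] at hr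
    obtain ⟨r', hr1, hr2⟩ := exists_between hr
    refine Filter.Eventually.frequently ?_
    filter_upwards [h x hx r' hr1, self_mem_nhdsWithin] with z hz hzx
    have hzx' : 0 < z - x := sub_pos.2 hzx
    rw [slope_def_field, div_lt_iff₀ hzx']
    have := dist_triangle (P 0) (P x) (P z)
    nlinarith

end Distance

/-! ### A simplex as a convex body in the direction space of its affine span -/

section Body

variable {E : Type*} [NormedAddCommGroup E] [InnerProductSpace ℝ E]

/-- The convex hull of `s`, viewed as a body in the subspace `V` by means of the base point `p`. -/
def simplexBody (V : Submodule ℝ E) (s : Set E) (p : E) : Set V :=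
  {u | (u : E) + p ∈ convexHull ℝ s}

theorem sub_mem_vectorSpan_of_mem_convexHull {s : Set E} {x y : E} (hx : x ∈ convexHull ℝ s)
    (hy : y ∈ convexHull ℝ s) : x - y ∈ vectorSpan ℝ s := by
  rw [← direction_affineSpan, ← vsub_eq_sub]
  exact AffineSubspace.vsub_mem_direction (convexHull_subset_affineSpan s hx)
    (convexHull_subset_affineSpan s hy)

theorem convex_simplexBody (V : Submodule ℝ E) (s : Set E) (p : E) :
    Convex ℝ (simplexBody V s p) :=
  ((convex_convexHull ℝ s).translate_preimage_left p).linear_preimage V.subtype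

variable [FiniteDimensional ℝ E] {V : Submodule ℝ E}

/-- The parameter in the subspace `V` of the point `x`, for the base point `p`. -/
noncomputable def simplexParam (V : Submodule ℝ E) (p x : E) : V :=
  V.orthogonalProjectionOnto (x - p)

theorem continuous_simplexParam (V : Submodule ℝ E) (p : E) : Continuous (simplexParam V p) :=
  (ContinuousLinearMap.continuous _).comp (continuous_id.sub continuous_const)

theorem simplexParam_add {s : Set E} (hV : V = vectorSpan ℝ s) {p x : E} (hp : p ∈ s)
    (hx : x ∈ convexHull ℝ s) : (simplexParam V p x : E) + p = x := by
  have h : x - p ∈ V :=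
    hV ▸ sub_mem_vectorSpan_of_mem_convexHull hx (subset_convexHull ℝ s hp)
  have h' := V.orthogonalProjectionOnto_mem_subspace_eq_self ⟨x - p, h⟩
  rw [simplexParam]
  simp only at h'
  rw [h', sub_add_cancel]

theorem simplexParam_mem {s : Set E} (hV : V = vectorSpan ℝ s) {p x : E} (hp : p ∈ s)
    (hx : x ∈ convexHull ℝ s) : simplexParam V p x ∈ simplexBody V s p := by
  rw [simplexBody, mem_ofPred_eq, simplexParam_add hV hp hx]
  exact hx

theorem isCompact_simplexBody (V : Submodule ℝ E) {s : Set E} (hs : s.Finite) (p : E) :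
    IsCompact (simplexBody V s p) := by
  have hV : IsClosed (V : Set E) := Submodule.closed_of_finiteDimensional _
  have h : Topology.IsClosedEmbedding fun u : V => (u : E) + p :=
    (Homeomorph.addRight p).isClosedEmbedding.comp hV.isClosedEmbedding_subtypeVal
  exact h.isCompact_preimage (hs.isCompact_convexHull (𝕜 := ℝ))

/-- The relative interior of a nonempty convex set is nonempty, and translation by `p` identifies
`V` with the affine span. This makes derivatives within the body unique. -/
theorem interior_simplexBody_nonempty {s : Set E} (hV : V = vectorSpan ℝ s) {p : E} (hp : p ∈ s) :
    (interior (simplexBody V s p)).Nonempty := by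
  subst hV
  have hps := subset_convexHull ℝ s hp
  obtain ⟨-, ⟨y, hy, -⟩⟩ := Set.Nonempty.intrinsicInterior (convex_convexHull ℝ s) ⟨p, hps⟩
  have hmem : ∀ u : vectorSpan ℝ s, (u : E) + p ∈ affineSpan ℝ (convexHull ℝ s) := fun u => by
    rw [affineSpan_convexHull]
    exact AffineSubspace.vadd_mem_of_mem_direction
      ((direction_affineSpan ℝ s).symm ▸ u.2) (subset_affineSpan ℝ s hp)
  have hθ : Continuous fun u : vectorSpan ℝ s =>
      (⟨(u : E) + p, hmem u⟩ : affineSpan ℝ (convexHull ℝ s)) :=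
    Continuous.subtype_mk (by fun_prop) _
  have hy' : (y : E) - p ∈ vectorSpan ℝ s := by
    rw [← direction_affineSpan, ← affineSpan_convexHull, ← vsub_eq_sub]
    exact AffineSubspace.vsub_mem_direction y.2 (subset_affineSpan ℝ _ hps)
  have hmem' : (⟨y - p, hy'⟩ : vectorSpan ℝ s) ∈ (fun u : vectorSpan ℝ s =>
      (⟨(u : E) + p, hmem u⟩ : affineSpan ℝ (convexHull ℝ s))) ⁻¹' interior
        ((↑) ⁻¹' convexHull ℝ s) := by
    simpa using hy
  exact ⟨_, preimage_interior_subset_interior_preimage hθ hmem'⟩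

end Body

/-! ### Homotheties inside a single simplex -/

namespace SmoothTriangulation

variable {d N : ℕ} {M : Type*} [MetricSpace M] [ChartedSpace (EuclideanSpace ℝ (Fin d)) M]

variable {V : Submodule ℝ (EuclideanSpace ℝ (Fin N))}

/-- The restriction of a triangulation to a simplex, on the parametrizing body. -/
noncomputable def bodyMap (K : SmoothTriangulation d N M)
    (V : Submodule ℝ (EuclideanSpace ℝ (Fin N))) (p : EuclideanSpace ℝ (Fin N)) (u : V) : M :=
  K.toFun (u + p)

theorem contMDiffOn_bodyMap (K : SmoothTriangulation d N M)
    {s : Finset (EuclideanSpace ℝ (Fin N))} (hs : s ∈ K.complex.faces)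
    (p : EuclideanSpace ℝ (Fin N)) :
    ContMDiffOn 𝓘(ℝ, V) (𝓡 d) ∞ (K.bodyMap V p) (simplexBody V s p) := by
  have h : ContDiff ℝ ∞ fun u : V => (u : EuclideanSpace ℝ (Fin N)) + p :=
    V.subtypeL.contDiff.add contDiff_const
  exact (K.contMDiffOn s hs).comp h.contMDiff.contMDiffOn fun _ hu => hu

variable [RiemannianBundle (fun x : M => TangentSpace (𝓡 d) x)]

theorem pullbackNorm_bodyMap_eq_zero (K : SmoothTriangulation d N M)
    {s : Finset (EuclideanSpace ℝ (Fin N))} (hs : s ∈ K.complex.faces)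
    (hV : V = vectorSpan ℝ (s : Set (EuclideanSpace ℝ (Fin N))))
    {p : EuclideanSpace ℝ (Fin N)} (hp : p ∈ s) {u : V} (hu : u ∈ simplexBody V s p)
    (w : V) (hw : pullbackNorm d (K.bodyMap V p) (simplexBody V s p) u w = 0) : w = 0 := by
  have hψ : HasFDerivWithinAt (fun u : V => (u : EuclideanSpace ℝ (Fin N)) + p) V.subtypeL
      (simplexBody V s p) u := (V.subtypeL.hasFDerivAt.add_const p).hasFDerivWithinAt
  have hu' := uniqueDiffOn_convex (convex_simplexBody V s p)
    (interior_simplexBody_nonempty hV hp) u hu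
  have h1 : mfderivWithin 𝓘(ℝ, V) (𝓡 d) (K.bodyMap V p) (simplexBody V s p) u =
      (mfderivWithin 𝓘(ℝ, EuclideanSpace ℝ (Fin N)) (𝓡 d) K.toFun
        (convexHull ℝ (s : Set _)) (u + p)).comp (mfderivWithin 𝓘(ℝ, V)
          𝓘(ℝ, EuclideanSpace ℝ (Fin N)) (fun u : V => (u : EuclideanSpace ℝ (Fin N)) + p)
          (simplexBody V s p) u) :=
    mfderivWithin_comp u ((K.contMDiffOn s hs).mdifferentiableOn (by simp) _ hu)
      hψ.differentiableWithinAt.mdifferentiableWithinAt (fun _ h => h)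
      hu'.uniqueMDiffWithinAt
  have h2 : mfderivWithin 𝓘(ℝ, V)
          𝓘(ℝ, EuclideanSpace ℝ (Fin N)) (fun u : V => (u : EuclideanSpace ℝ (Fin N)) + p)
          (simplexBody V s p) u = V.subtypeL := by
    rw [mfderivWithin_eq_fderivWithin]
    exact hψ.fderivWithin hu'
  rw [h2] at h1
  have h3 : (mfderivWithin 𝓘(ℝ, V) (𝓡 d) (K.bodyMap V p) (simplexBody V s p) u) w = 0 :=
    norm_eq_zero.1 hw
  rw [h1] at h3
  exact Subtype.ext (K.injective_mfderiv s hs _ hu w (hV ▸ w.2) h3)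

variable [IsManifold (𝓡 d) ∞ M]
  [IsContMDiffRiemannianBundle (𝓡 d) ∞ (EuclideanSpace ℝ (Fin d))
    (fun x : M => TangentSpace (𝓡 d) x)] [IsRiemannianManifold (𝓡 d) M]

/-- Near `a`, the homothety with centre `a` and ratio `μ ≤ 1` does not increase the speed of
curves in the simplex `s`. -/
theorem eventually_dist_homothety_le (K : SmoothTriangulation d N M)
    {s : Finset (EuclideanSpace ℝ (Fin N))} (hs : s ∈ K.complex.faces) :
    ∃ ε₀ : ℝ, 0 < ε₀ ∧ ∀ a ∈ convexHull ℝ (s : Set (EuclideanSpace ℝ (Fin N))),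
      ∀ μ ∈ Icc (0 : ℝ) 1, ∀ (γ : ℝ → M) (S J : Set ℝ) (g : ℝ → EuclideanSpace ℝ (Fin N)) (t : ℝ),
      MDifferentiableWithinAt 𝓘(ℝ, ℝ) (𝓡 d) γ J t → S ⊆ J → t ∈ S →
      MapsTo g S (convexHull ℝ (s : Set (EuclideanSpace ℝ (Fin N)))) → ContinuousWithinAt g S t →
      (∀ x ∈ S, K.toFun (g x) = γ x) → ‖g t - a‖ ≤ ε₀ →
      ∀ r > pullbackNorm d γ J t 1, ∀ᶠ x in 𝓝[S] t,
        dist (K.toFun (a + μ • (g t - a))) (K.toFun (a + μ • (g x - a))) ≤ r * |x - t| := by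
  obtain ⟨p, hp⟩ := K.complex.nonempty_of_mem_faces hs
  obtain ⟨V, hV⟩ : ∃ V, V = vectorSpan ℝ (s : Set (EuclideanSpace ℝ (Fin N))) := ⟨_, rfl⟩
  set D := simplexBody V (s : Set (EuclideanSpace ℝ (Fin N))) p with hD
  set T := K.bodyMap V p with hTdef
  have hT : ContMDiffOn 𝓘(ℝ, V) (𝓡 d) ∞ T D := K.contMDiffOn_bodyMap hs p
  have hT1 : ContMDiffOn 𝓘(ℝ, V) (𝓡 d) 1 T D := hT.of_le (by exact_mod_cast le_top)
  have hDc : Convex ℝ D := convex_simplexBody V _ p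
  have hDi : (interior D).Nonempty := interior_simplexBody_nonempty hV hp
  have hDu := uniqueDiffOn_convex hDc hDi
  have hinj : ∀ u ∈ D, ∀ w : V, pullbackNorm d T D u w = 0 → w = 0 :=
    fun u hu w hw => K.pullbackNorm_bodyMap_eq_zero hs hV hp hu w hw
  obtain ⟨C, hC0, hC⟩ := exists_pullbackNorm_le hT (isCompact_simplexBody V s.finite_toSet p) hDc
    hDi hinj
  -- Within distance `C⁻¹` of the centre, moving `u` to its image costs a factor at most `1 + (1 -
  -- μ)` in the metric. The vector shrinks by `μ`, and `μ * (2 - μ) ≤ 1`.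
  refine ⟨C⁻¹, by positivity, fun a ha μ hμ γ S J g t hγ hSJ htS hgS hg hKg hga r hr => ?_⟩
  set q := simplexParam V p with hq
  have hps : p ∈ (s : Set (EuclideanSpace ℝ (Fin N))) := hp
  have hqc : Continuous q := continuous_simplexParam V p
  set α := q a with hα
  have hαD : α ∈ D := simplexParam_mem hV hps ha
  set u : ℝ → V := fun x => q (g x) with hu
  have huD : MapsTo u S D := fun x hx => simplexParam_mem hV hps (hgS hx)
  have huc : ContinuousWithinAt u S t := hqc.continuousAt.comp_continuousWithinAt hg
  have hTu : ∀ x ∈ S, T (u x) = γ x := fun x hx => by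
    rw [← hKg x hx]
    exact congrArg K.toFun (simplexParam_add hV hps (hgS hx))
  have hΨD : ∀ x ∈ S, α + μ • (u x - α) ∈ D := fun x hx => by
    exact hDc.add_smul_sub_mem hαD (huD hx) hμ
  have hTΨ : ∀ x ∈ S, T (α + μ • (u x - α)) = K.toFun (a + μ • (g x - a)) := fun x hx => by
    refine congrArg K.toFun ?_
    have e1 := simplexParam_add hV hps (hgS hx)
    have e2 := simplexParam_add hV hps ha
    change ((α + μ • (u x - α) : V) : EuclideanSpace ℝ (Fin N)) + p = _
    have e1' : (u x : EuclideanSpace ℝ (Fin N)) = g x - p := eq_sub_of_add_eq e1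
    have e2' : (α : EuclideanSpace ℝ (Fin N)) = a - p := eq_sub_of_add_eq e2
    push_cast
    rw [e1', e2']
    module
  obtain ⟨r', hr1, hr2⟩ := exists_between hr
  set b := pullbackNorm d γ J t 1 with hb
  have hb0 : 0 ≤ b := pullbackNorm_nonneg _ _
  have hvel := eventually_pullbackNorm_sub_le (ε := r' - b) hγ hSJ htS
    (hT1.mdifferentiableOn one_ne_zero _ (huD htS)) (hinj _ (huD htS)) huD huc hTu
    (sub_pos.2 hr1)
  -- The remaining distortion along the small segment tends to `1` and is absorbed in the gap
  -- between `r'` and `r`.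
  have hlim : Filter.Tendsto (fun x => (1 + C * ‖u x - u t‖) * r') (𝓝[S] t)
      (𝓝 ((1 + C * ‖u t - u t‖) * r')) :=
    ((tendsto_const_nhds.mul (huc.sub tendsto_const_nhds).norm).const_add 1).mul_const r'
  have hlim' := hlim.eventually_lt_const (u := r) (by simpa using hr2)
  filter_upwards [hvel, hlim', self_mem_nhdsWithin] with x hx1 hx2 hxS
  rw [← hTΨ t htS, ← hTΨ x hxS]
  set X := pullbackNorm d T D (u t) (u x - u t) with hX
  have hX0 : 0 ≤ X := pullbackNorm_nonneg _ _
  have hsub : (α + μ • (u x - α)) - (α + μ • (u t - α)) = μ • (u x - u t) := by module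
  have h1 := dist_le_of_pullbackNorm_le hT1 hDc hC0.le hC (hΨD t htS) (hΨD x hxS)
  rw [hsub, pullbackNorm_smul, norm_smul, Real.norm_eq_abs, abs_of_nonneg hμ.1] at h1
  have h2 := hC _ (hΨD t htS) _ (huD htS) (u x - u t)
  have h3 : ‖α + μ • (u t - α) - u t‖ ≤ (1 - μ) * C⁻¹ := by
    have : α + μ • (u t - α) - u t = (μ - 1) • (u t - α) := by module
    rw [this, norm_smul, Real.norm_eq_abs, abs_sub_comm, abs_of_nonneg (sub_nonneg.2 hμ.2)]
    have hn : ‖u t - α‖ = ‖g t - a‖ := by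
      have e1 := simplexParam_add hV hps (hgS htS)
      have e2 := simplexParam_add hV hps ha
      rw [← e1, ← e2, add_sub_add_right_eq_sub]
      rfl
    rw [hn]
    exact mul_le_mul_of_nonneg_left hga (sub_nonneg.2 hμ.2)
  have h4 : C * ‖α + μ • (u t - α) - u t‖ ≤ 1 - μ := by
    calc C * ‖α + μ • (u t - α) - u t‖ ≤ C * ((1 - μ) * C⁻¹) := by gcongr
      _ = 1 - μ := by field_simp
  have h5 : μ * pullbackNorm d T D (α + μ • (u t - α)) (u x - u t) ≤ X := by
    calc μ * pullbackNorm d T D (α + μ • (u t - α)) (u x - u t)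
        ≤ μ * ((1 + (1 - μ)) * X) := by
          refine mul_le_mul_of_nonneg_left (h2.trans ?_) hμ.1
          gcongr
      _ = (μ * (2 - μ)) * X := by ring
      _ ≤ 1 * X := by
          gcongr
          nlinarith [sq_nonneg (1 - μ)]
      _ = X := one_mul X
  have hμu : μ * ‖u x - u t‖ ≤ ‖u x - u t‖ := mul_le_of_le_one_left (norm_nonneg _) hμ.2
  calc dist (T (α + μ • (u t - α))) (T (α + μ • (u x - α)))
      ≤ (1 + C * (μ * ‖u x - u t‖)) *
          (μ * pullbackNorm d T D (α + μ • (u t - α)) (u x - u t)) := h1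
    _ ≤ (1 + C * ‖u x - u t‖) * X := by
        gcongr
        exact mul_nonneg hμ.1 (pullbackNorm_nonneg _ _)
    _ ≤ (1 + C * ‖u x - u t‖) * (r' * |x - t|) := by
        gcongr
        rw [add_sub_cancel] at hx1
        exact hx1
    _ = (1 + C * ‖u x - u t‖) * r' * |x - t| := by ring
    _ ≤ r * |x - t| := by gcongr

end SmoothTriangulation

/-! ### Homotheties across several simplices -/

namespace SmoothTriangulation

section Topological

variable {d N : ℕ} {M : Type*} [TopologicalSpace M]
  [ChartedSpace (EuclideanSpace ℝ (Fin d)) M] (K : SmoothTriangulation d N M)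

/-- The triangulating homeomorphism. -/
noncomputable def homeo : K.complex.space ≃ₜ M := K.isHomeomorph.homeomorph

/-- The inverse of the triangulating map, with values in the ambient space of the complex. -/
noncomputable def inv (p : M) : EuclideanSpace ℝ (Fin N) := K.homeo.symm p

theorem inv_mem (p : M) : K.inv p ∈ K.complex.space := (K.homeo.symm p).2

theorem toFun_inv (p : M) : K.toFun (K.inv p) = p := K.homeo.apply_symm_apply p

theorem inv_toFun {x : EuclideanSpace ℝ (Fin N)} (hx : x ∈ K.complex.space) :
    K.inv (K.toFun x) = x :=
  congrArg Subtype.val (K.homeo.symm_apply_apply ⟨x, hx⟩)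

theorem continuous_inv : Continuous K.inv :=
  continuous_subtype_val.comp K.homeo.symm.continuous

theorem continuousOn_toFun : ContinuousOn K.toFun K.complex.space :=
  continuousOn_iff_continuous_domRestrict.2 K.isHomeomorph.continuous

theorem isCompact_space : IsCompact K.complex.space :=
  K.finite_faces.isCompact_biUnion fun s _ => s.finite_toSet.isCompact_convexHull (𝕜 := ℝ)

end Topological

variable {d N : ℕ} {M : Type*} [MetricSpace M] [ChartedSpace (EuclideanSpace ℝ (Fin d)) M]
  [RiemannianBundle (fun x : M => TangentSpace (𝓡 d) x)] [IsManifold (𝓡 d) ∞ M]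
  [IsContMDiffRiemannianBundle (𝓡 d) ∞ (EuclideanSpace ℝ (Fin d))
    (fun x : M => TangentSpace (𝓡 d) x)] [IsRiemannianManifold (𝓡 d) M]

/-- A curve may change simplices infinitely often, so it is not cut into pieces. Instead the
increments of its image are bounded at each time by the speed of `γ`, one simplex at a time, and the
mean value inequality sums them up. The last hypothesis keeps the image curve inside the complex. -/
theorem edist_homothety_le_pathELength (K : SmoothTriangulation d N M) :
    ∃ ε₀ : ℝ, 0 < ε₀ ∧ ∀ a : EuclideanSpace ℝ (Fin N), ∀ μ ∈ Icc (0 : ℝ) 1, ∀ γ : ℝ → M,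
      ContMDiffOn 𝓘(ℝ, ℝ) (𝓡 d) 1 γ (Icc 0 1) →
      (∀ s ∈ Icc (0 : ℝ) 1, ‖K.inv (γ s) - a‖ ≤ ε₀) →
      (∀ s ∈ Icc (0 : ℝ) 1, ∀ τ ∈ K.complex.faces,
        K.inv (γ s) ∈ convexHull ℝ (τ : Set (EuclideanSpace ℝ (Fin N))) →
          a ∈ convexHull ℝ (τ : Set (EuclideanSpace ℝ (Fin N)))) →
      edist (K.toFun (a + μ • (K.inv (γ 0) - a))) (K.toFun (a + μ • (K.inv (γ 1) - a))) ≤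
        Manifold.pathELength (𝓡 d) γ 0 1 := by
  have hall : ∀ᶠ ε : ℝ in 𝓝[>] 0, ∀ s ∈ K.complex.faces,
      ∀ a ∈ convexHull ℝ (s : Set (EuclideanSpace ℝ (Fin N))),
      ∀ μ ∈ Icc (0 : ℝ) 1, ∀ (γ : ℝ → M) (S J : Set ℝ) (g : ℝ → EuclideanSpace ℝ (Fin N)) (t : ℝ),
      MDifferentiableWithinAt 𝓘(ℝ, ℝ) (𝓡 d) γ J t → S ⊆ J → t ∈ S →
      MapsTo g S (convexHull ℝ (s : Set (EuclideanSpace ℝ (Fin N)))) → ContinuousWithinAt g S t →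
      (∀ x ∈ S, K.toFun (g x) = γ x) → ‖g t - a‖ ≤ ε →
      ∀ r > pullbackNorm d γ J t 1, ∀ᶠ x in 𝓝[S] t,
        dist (K.toFun (a + μ • (g t - a))) (K.toFun (a + μ • (g x - a))) ≤ r * |x - t| := by
    refine (Filter.eventually_all_finite K.finite_faces).2 fun s hs => ?_
    obtain ⟨ε₀, hε₀, h⟩ := K.eventually_dist_homothety_le hs
    filter_upwards [Ioo_mem_nhdsGT hε₀] with ε hε a ha μ hμ γ S J g t h1 h2 h3 h4 h5 h6 h7
    exact h a ha μ hμ γ S J g t h1 h2 h3 h4 h5 h6 (h7.trans hε.2.le)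
  obtain ⟨ε₀, hε, hε₀⟩ := (hall.and self_mem_nhdsWithin).exists
  refine ⟨ε₀, hε₀, fun a μ hμ γ hγ hclose hface => ?_⟩
  have hgc : ContinuousOn (fun s => K.inv (γ s)) (Icc 0 1) :=
    K.continuous_inv.comp_continuousOn hγ.continuousOn
  refine edist_le_pathELength_of_speed_le (P := fun s => K.toFun (a + μ • (K.inv (γ s) - a)))
    hγ ?_ ?_
  · refine K.continuousOn_toFun.comp
      (continuousOn_const.add ((hgc.sub continuousOn_const).const_smul μ)) fun s hs => ?_
    obtain ⟨τ, hτ, hsτ⟩ := K.complex.mem_space_iff.1 (K.inv_mem (γ s))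
    exact K.complex.convexHull_subset_space hτ
      ((convex_convexHull ℝ _).add_smul_sub_mem (hface s hs τ hτ hsτ) hsτ hμ)
  · intro s hs r hr
    have hsI := Ico_subset_Icc_self hs
    -- Only simplices through `K.inv (γ s)` matter: the others are closed and finite in number, so
    -- they are not met near time `s`.
    have key : ∀ᶠ x in 𝓝[Icc 0 1] s, ∀ τ ∈ K.complex.faces,
        K.inv (γ x) ∈ convexHull ℝ (τ : Set (EuclideanSpace ℝ (Fin N))) →
        dist (K.toFun (a + μ • (K.inv (γ s) - a))) (K.toFun (a + μ • (K.inv (γ x) - a))) ≤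
          r * |x - s| := by
      refine (Filter.eventually_all_finite K.finite_faces).2 fun τ hτ => ?_
      by_cases hsτ : K.inv (γ s) ∈ convexHull ℝ (τ : Set (EuclideanSpace ℝ (Fin N)))
      · have h := hε τ hτ a (hface s hsI τ hτ hsτ) μ hμ γ
          (Icc 0 1 ∩ {x | K.inv (γ x) ∈ convexHull ℝ (τ : Set (EuclideanSpace ℝ (Fin N)))})
          (Icc 0 1) (fun x => K.inv (γ x)) s (hγ.mdifferentiableOn one_ne_zero s hsI)
          inter_subset_left ⟨hsI, hsτ⟩ (fun x hx => hx.2) ((hgc s hsI).mono inter_subset_left)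
          (fun x _ => K.toFun_inv _) (hclose s hsI) r hr
        rw [nhdsWithin_inter', Filter.eventually_inf_principal] at h
        exact h
      · have hcl : IsClosed (convexHull ℝ (τ : Set (EuclideanSpace ℝ (Fin N)))) :=
          (τ.finite_toSet.isCompact_convexHull (𝕜 := ℝ)).isClosed
        filter_upwards [(hgc s hsI).eventually (hcl.isOpen_compl.mem_nhds hsτ)] with x hx hx'
        exact absurd hx' hx
    have hle : 𝓝[>] s ≤ 𝓝[Icc 0 1] s := nhdsWithin_le_of_mem (Icc_mem_nhdsGT_of_mem hs)
    filter_upwards [hle key, self_mem_nhdsWithin] with x hx hxs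
    obtain ⟨τ, hτ, hxτ⟩ := K.complex.mem_space_iff.1 (K.inv_mem (γ x))
    have h := hx τ hτ hxτ
    rwa [abs_of_pos (sub_pos.2 hxs)] at h

/-- Contracting towards a point `a` in the relative interior of the simplex `σ` does not increase
the distance to the simplices that contain `σ`, near `a`. -/
theorem exists_infEDist_homothety_le [CompactSpace M] (K : SmoothTriangulation d N M)
    {σ : Finset (EuclideanSpace ℝ (Fin N))} {A : Set (EuclideanSpace ℝ (Fin N))}
    (hA : IsCompact A) (hAσ : A ⊆ convexHull ℝ (σ : Set (EuclideanSpace ℝ (Fin N))))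
    (hσ : σ ∈ K.complex.faces) (hAτ : ∀ a ∈ A, ∀ τ ∈ K.complex.faces,
      a ∈ convexHull ℝ (τ : Set (EuclideanSpace ℝ (Fin N))) → σ ⊆ τ) :
    ∃ R : ℝ, 0 < R ∧ ∀ a ∈ A, ∀ x ∈ K.complex.space, ‖x - a‖ < R → ∀ μ ∈ Icc (0 : ℝ) 1,
      ∀ ρ ∈ K.complex.faces, σ ⊆ ρ →
        Metric.infEDist (K.toFun (a + μ • (x - a))) (K.simplex ρ) ≤
          Metric.infEDist (K.toFun x) (K.simplex ρ) := by
  obtain ⟨ε₀, hε₀, hpath⟩ := K.edist_homothety_le_pathELength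
  -- The compact set `A` has positive distance from every simplex that does not contain `σ`; hence a
  -- curve close to `a` meets only simplices containing `σ`.
  have hall : ∀ᶠ ε : ℝ in 𝓝[>] 0, ∀ τ ∈ K.complex.faces, ¬ σ ⊆ τ → ∀ a ∈ A,
      ∀ y ∈ convexHull ℝ (τ : Set (EuclideanSpace ℝ (Fin N))), ε < dist a y := by
    refine (Filter.eventually_all_finite K.finite_faces).2 fun τ hτ => ?_
    by_cases hστ : σ ⊆ τ
    · exact Filter.Eventually.of_forall fun _ h => absurd hστ h
    obtain ⟨r, hr0, hr⟩ := Metric.exists_pos_forall_lt_edist hA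
      ((τ.finite_toSet.isCompact_convexHull (𝕜 := ℝ)).isClosed)
      (Set.disjoint_left.2 fun a ha haτ => hστ (hAτ a ha τ hτ haτ))
    filter_upwards [Ioo_mem_nhdsGT (show (0 : ℝ) < r from hr0)] with ε hε _ a ha y hy
    have h := hr a ha y hy
    rw [edist_nndist, ENNReal.coe_lt_coe, ← NNReal.coe_lt_coe, coe_nndist] at h
    exact hε.2.trans h
  obtain ⟨ε, ⟨hε1, hε2⟩, hε3⟩ :=
    ((hall.and (Ioo_mem_nhdsGT hε₀)).and self_mem_nhdsWithin).exists
  obtain ⟨R₁, hR₁, hinv⟩ := Metric.uniformContinuous_iff.1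
    (CompactSpace.uniformContinuous_of_continuous K.continuous_inv) ε hε3
  -- Half of `R₁` is for the distance from the start to the centre, the other half for the length of
  -- the curve.
  obtain ⟨R, hR, htoFun⟩ := Metric.uniformContinuousOn_iff.1
    (K.isCompact_space.uniformContinuousOn_of_continuous K.continuousOn_toFun) (R₁ / 2)
    (by positivity)
  refine ⟨R, hR, fun a ha x hx hxa μ hμ ρ hρ hσρ => ?_⟩
  have haK : a ∈ K.complex.space := K.complex.convexHull_subset_space hσ (hAσ ha)
  have hmono : convexHull ℝ (σ : Set (EuclideanSpace ℝ (Fin N))) ⊆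
      convexHull ℝ (ρ : Set (EuclideanSpace ℝ (Fin N))) := convexHull_mono (by exact_mod_cast hσρ)
  have hdx : dist (K.toFun x) (K.toFun a) < R₁ / 2 :=
    htoFun x hx a haK (by rwa [dist_eq_norm])
  have hlt : Metric.infEDist (K.toFun x) (K.simplex ρ) < ENNReal.ofReal (R₁ / 2) := by
    have hmem : K.toFun a ∈ K.simplex ρ := ⟨a, hmono (hAσ ha), rfl⟩
    refine (Metric.infEDist_le_edist_of_mem hmem).trans_lt ?_
    rwa [edist_lt_ofReal]
  refine le_of_forall_gt fun r hr => ?_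
  -- The minimum with `R₁ / 2` forces the almost shortest curve to be short enough to remain near
  -- `a`.
  obtain ⟨-, ⟨y, hy, rfl⟩, hyr⟩ := Metric.infEDist_lt_iff.1 (lt_min hr hlt)
  have hyK : y ∈ K.complex.space := K.complex.convexHull_subset_space hρ hy
  rw [IsRiemannianManifold.out (I := 𝓡 d)] at hyr
  obtain ⟨γ, hγ0, hγ1, hγ, hlen⟩ := Manifold.exists_lt_of_riemannianEDist_lt hyr
  have hnear : ∀ s ∈ Icc (0 : ℝ) 1, dist (K.inv (γ s)) a < ε := fun s hs => by
    have h1 : edist (K.toFun x) (γ s) < ENNReal.ofReal (R₁ / 2) := by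
      rw [IsRiemannianManifold.out (I := 𝓡 d)]
      refine (Manifold.riemannianEDist_le_pathELength
        (hγ.mono (Icc_subset_Icc_right hs.2)) hγ0 rfl hs.1).trans_lt ?_
      exact (Manifold.pathELength_mono le_rfl hs.2).trans_lt (hlen.trans_le (min_le_right _ _))
    rw [edist_lt_ofReal] at h1
    have h2 : dist (γ s) (K.toFun a) < R₁ := by
      have := dist_triangle_left (γ s) (K.toFun a) (K.toFun x)
      linarith
    have h3 := hinv h2
    rwa [K.inv_toFun haK] at h3
  have h := hpath a μ hμ γ hγ (fun s hs => by
      rw [← dist_eq_norm]; exact (hnear s hs).le.trans hε2.2.le) (fun s hs τ hτ hsτ => by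
      by_contra haτ
      have hστ : ¬ σ ⊆ τ := fun hστ => haτ (convexHull_mono (by exact_mod_cast hστ) (hAσ ha))
      have := hε1 τ hτ hστ a ha _ hsτ
      rw [dist_comm] at this
      exact lt_asymm this (hnear s hs))
  rw [hγ0, hγ1, K.inv_toFun hx, K.inv_toFun hyK] at h
  have hmem : K.toFun (a + μ • (y - a)) ∈ K.simplex ρ :=
    ⟨_, (convex_convexHull ℝ _).add_smul_sub_mem (hmono (hAσ ha)) hy hμ, rfl⟩
  exact (Metric.infEDist_le_edist_of_mem hmem).trans_lt
    (h.trans_lt (hlen.trans_le (min_le_left _ _)))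

end SmoothTriangulation

/-! ### Homotopy equivalences obtained from deformations -/

theorem IsDeformationRetract.nonempty_homotopyEquiv {Y : Type*} [TopologicalSpace Y] {A X : Set Y}
    (h : IsDeformationRetract A X) : Nonempty (ContinuousMap.HomotopyEquiv A X) := by
  obtain ⟨hAX, r, hr, hrA, hH⟩ := h
  refine ⟨⟨⟨inclusion hAX, continuous_inclusion hAX⟩,
    ⟨fun x => ⟨r x, hr x⟩, (continuous_subtype_val.comp r.continuous).subtype_mk _⟩, ?_, ?_⟩⟩
  · convert ContinuousMap.Homotopic.refl _
    ext x
    simpa using (congrArg Subtype.val (hrA (inclusion hAX x) x.2)).symm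
  · convert hH.symm
    ext x
    rfl

/-- If the identity of `B` is homotopic to a map with values in `A`, by a homotopy that preserves
`A`, then `A` and `B` are homotopy equivalent. -/
theorem nonempty_homotopyEquiv_of_homotopy {Y : Type*} [TopologicalSpace Y] {A B : Set Y}
    (hAB : A ⊆ B) {f : C(B, B)} (H : (ContinuousMap.id B).Homotopy f) (hf : ∀ x, (f x : Y) ∈ A)
    (hH : ∀ t (x : B), (x : Y) ∈ A → (H (t, x) : Y) ∈ A) :
    Nonempty (ContinuousMap.HomotopyEquiv A B) := by
  refine ⟨⟨⟨inclusion hAB, continuous_inclusion hAB⟩,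
    ⟨fun x => ⟨f x, hf x⟩, (continuous_subtype_val.comp f.continuous).subtype_mk _⟩, ?_, ?_⟩⟩
  · refine ContinuousMap.Homotopic.symm ⟨⟨⟨fun p => ⟨H (p.1, inclusion hAB p.2), hH _ _ p.2.2⟩, ?_⟩,
      fun x => ?_, fun x => ?_⟩⟩
    · refine (continuous_subtype_val.comp (H.continuous.comp ?_)).subtype_mk _
      exact continuous_fst.prodMk ((continuous_inclusion hAB).comp continuous_snd)
    · ext; simp
    · ext; simp
  · refine ContinuousMap.Homotopic.symm ⟨?_⟩
    convert H
    ext x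
    rfl

/-! ### Geometric realization in barycentric coordinates -/

namespace PreAbstractSimplicialComplex

variable {ι : Type*} (K : PreAbstractSimplicialComplex ι)

/-- The geometric realization of an abstract simplicial complex, in barycentric coordinates. -/
def realization : Set (ι → ℝ) :=
  {w | (∀ v, 0 ≤ w v) ∧ ∃ s ∈ K.faces, (∀ v ∉ s, w v = 0) ∧ ∑ v ∈ s, w v = 1}

/-- The total weight outside of the simplex `σ`. -/
def offMass (σ : Finset ι) (w : ι → ℝ) : ℝ := 1 - ∑ v ∈ σ, w v

variable {K} {w : ι → ℝ} {σ ρ : Finset ι}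

theorem continuous_offMass (σ : Finset ι) : Continuous (offMass σ) := by
  unfold offMass
  fun_prop

theorem sum_eq_one_of_mem_realization (hw : w ∈ K.realization) (hσ : ∀ v ∉ σ, w v = 0) :
    ∑ v ∈ σ, w v = 1 := by
  classical
  obtain ⟨-, s, -, hs, hs1⟩ := hw
  rw [← hs1, Finset.sum_subset (Finset.subset_union_left (s₁ := σ) (s₂ := s)) fun v _ hv => hσ v hv,
    Finset.sum_subset (Finset.subset_union_right (s₁ := σ) (s₂ := s)) fun v _ hv => hs v hv]

theorem sum_le_one_of_mem_realization (hw : w ∈ K.realization) (σ : Finset ι) :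
    ∑ v ∈ σ, w v ≤ 1 := by
  classical
  obtain ⟨h0, s, -, hs, -⟩ := id hw
  rw [← sum_eq_one_of_mem_realization hw (σ := σ ∪ s) fun v hv => hs v fun h =>
    hv (Finset.mem_union_right _ h)]
  exact Finset.sum_le_sum_of_subset_of_nonneg Finset.subset_union_left fun v _ _ => h0 v

theorem offMass_nonneg (hw : w ∈ K.realization) (σ : Finset ι) : 0 ≤ offMass σ w :=
  sub_nonneg.2 (sum_le_one_of_mem_realization hw σ)

theorem offMass_pos_iff (hw : w ∈ K.realization) : 0 < offMass ρ w ↔ ∃ v ∉ ρ, 0 < w v := by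
  classical
  constructor
  · intro h
    by_contra! hcon
    have : ∑ v ∈ ρ, w v = 1 := sum_eq_one_of_mem_realization hw fun v hv =>
      le_antisymm (hcon v hv) (hw.1 v)
    rw [offMass, this] at h
    simp at h
  · rintro ⟨v, hv, hwv⟩
    have h := sum_le_one_of_mem_realization hw (insert v ρ)
    rw [Finset.sum_insert hv] at h
    rw [offMass]
    linarith

theorem offMass_sub_le_sum_sdiff [DecidableEq ι] (hw : w ∈ K.realization) (σ ρ : Finset ι) :
    offMass ρ w - offMass σ w ≤ ∑ v ∈ σ \ ρ, w v := by
  have h1 : ∑ v ∈ σ \ ρ, w v + ∑ v ∈ σ ∩ ρ, w v = ∑ v ∈ σ, w v :=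
    (add_comm _ _).trans (Finset.sum_inter_add_sum_sdiff ..)
  have h2 : ∑ v ∈ σ ∩ ρ, w v ≤ ∑ v ∈ ρ, w v :=
    Finset.sum_le_sum_of_subset_of_nonneg Finset.inter_subset_right fun v _ _ => hw.1 v
  rw [offMass, offMass]
  linarith

theorem sum_sdiff_le_offMass [DecidableEq ι] (hw : w ∈ K.realization) (σ ρ : Finset ι) :
    ∑ v ∈ σ \ ρ, w v ≤ offMass ρ w := by
  have h := sum_le_one_of_mem_realization hw ((σ \ ρ) ∪ ρ)
  rw [Finset.sum_union Finset.sdiff_disjoint] at h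
  rw [offMass]
  linarith

end PreAbstractSimplicialComplex

/-! ### Retraction of the complement of the skeleton onto the dual skeleton -/

namespace PreAbstractSimplicialComplex

variable {ι : Type*} (K : PreAbstractSimplicialComplex ι) (k : ℕ)

/-- The complement of the `k`-skeleton in the realization. -/
def skeletonCompl : Set (ι → ℝ) :=
  {w ∈ K.realization | ∀ ρ ∈ K.faces, ρ.card ≤ k + 1 → 0 < offMass ρ w}

/-- The points of the realization with `k + 2` barycentric coordinates that are equal and
maximal. -/
def dualRealization : Set (ι → ℝ) :=
  {w ∈ K.realization | ∃ t : Finset ι, t.card = k + 2 ∧ ∀ v ∈ t, ∀ u, w u ≤ w v}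

/-- The `k + 2`-nd largest of the coordinates in `vs`. -/
noncomputable def level (vs : Finset ι) (w : ι → ℝ) : ENNReal :=
  (vs.powersetCard (k + 2)).sup fun t => t.inf fun v => ENNReal.ofReal (w v)

/-- Cutting off the barycentric coordinates at the level of the `k + 2`-nd largest one. -/
noncomputable def clip (vs : Finset ι) (w : ι → ℝ) (v : ι) : ℝ :=
  min (w v) (level k vs w).toReal / ∑ u ∈ vs, min (w u) (level k vs w).toReal

variable {K k} {w : ι → ℝ} {vs : Finset ι}

/-- The support of `w` is a face carrying all the weight, so it cannot have only `k + 1` vertices.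
-/
theorem exists_card_eq_of_mem_skeletonCompl (hw : w ∈ K.skeletonCompl k) :
    ∃ t : Finset ι, t.card = k + 2 ∧ ∀ v ∈ t, 0 < w v := by
  classical
  obtain ⟨hw, hpos⟩ := hw
  obtain ⟨h0, s, hs, hs0, hs1⟩ := id hw
  have hne : (s.filter fun v => 0 < w v).Nonempty := by
    by_contra hne
    rw [Finset.not_nonempty_iff_eq_empty, Finset.filter_eq_empty_iff] at hne
    rw [Finset.sum_eq_zero fun v hv => le_antisymm (not_lt.1 (hne hv)) (h0 v)] at hs1
    exact zero_ne_one hs1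
  have hface := (K.isRelLowerSet_faces hs).2 (Finset.filter_subset (fun v => 0 < w v) s) hne
  have hcard : k + 2 ≤ (s.filter fun v => 0 < w v).card := by
    by_contra hlt
    obtain ⟨v, hv, hwv⟩ := (offMass_pos_iff hw).1 (hpos _ hface (by omega))
    refine hv (Finset.mem_filter.2 ⟨?_, hwv⟩)
    by_contra hvs
    exact hwv.ne' (hs0 v hvs)
  obtain ⟨t, ht, htc⟩ := Finset.exists_subset_card_eq hcard
  exact ⟨t, htc, fun v hv => (Finset.mem_filter.1 (ht hv)).2⟩

theorem mem_skeletonCompl_of_exists (hw : w ∈ K.realization)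
    (h : ∃ t : Finset ι, t.card = k + 2 ∧ ∀ v ∈ t, 0 < w v) : w ∈ K.skeletonCompl k := by
  obtain ⟨t, ht, htpos⟩ := h
  refine ⟨hw, fun ρ _ hρ => ?_⟩
  obtain ⟨v, hv, hvρ⟩ := Finset.exists_mem_notMem_of_card_lt_card (s := ρ) (t := t) (by omega)
  exact (offMass_pos_iff hw).2 ⟨v, hvρ, htpos v hv⟩

theorem dualRealization_subset : K.dualRealization k ⊆ K.skeletonCompl k := by
  rintro w ⟨hw, t, ht, hmax⟩
  refine mem_skeletonCompl_of_exists hw ⟨t, ht, fun v hv => ?_⟩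
  obtain ⟨h0, s, hs, hs0, hs1⟩ := hw
  by_contra hneg
  rw [Finset.sum_eq_zero fun u _ => le_antisymm ((hmax v hv u).trans (not_lt.1 hneg)) (h0 u)] at hs1
  exact zero_ne_one hs1

theorem mem_of_pos (hvs : ∀ s ∈ K.faces, s ⊆ vs) (hw : w ∈ K.realization) {v : ι}
    (hv : 0 < w v) : v ∈ vs := by
  obtain ⟨-, s, hs, hs0, -⟩ := hw
  by_contra h
  exact hv.ne' (hs0 v fun hvs' => h (hvs s hs hvs'))

theorem le_level {t : Finset ι} (htvs : t ⊆ vs) (ht : t.card = k + 2) {r : ℝ}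
    (h : ∀ v ∈ t, r ≤ w v) : ENNReal.ofReal r ≤ level k vs w :=
  (Finset.le_inf fun v hv => ENNReal.ofReal_le_ofReal (h v hv)).trans
    (Finset.le_sup (f := fun t : Finset ι => t.inf fun v => ENNReal.ofReal (w v))
      (Finset.mem_powersetCard.2 ⟨htvs, ht⟩))

theorem level_lt_top : level k vs w < ⊤ := by
  refine (Finset.sup_lt_iff (by simp)).2 fun t ht => ?_
  have hne : t.Nonempty := Finset.card_pos.1 (by rw [(Finset.mem_powersetCard.1 ht).2]; omega)
  obtain ⟨v, hv⟩ := hne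
  exact (Finset.inf_le hv).trans_lt ENNReal.ofReal_lt_top

theorem continuous_toReal_level : Continuous fun w : ι → ℝ => (level k vs w).toReal := by
  have h : Continuous fun w : ι → ℝ => level k vs w :=
    Continuous.finset_sup_apply fun t _ => Continuous.finset_inf_apply fun v _ =>
      ENNReal.continuous_ofReal.comp (continuous_apply v)
  exact continuous_iff_continuousAt.2 fun w =>
    (ENNReal.tendsto_toReal level_lt_top.ne).comp h.continuousAt

theorem exists_card_eq_level_le (hpos : 0 < level k vs w) :
    ∃ t : Finset ι, t.card = k + 2 ∧ ∀ v ∈ t, (level k vs w).toReal ≤ w v := by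
  obtain ⟨t, ht, hle⟩ := (Finset.le_sup_iff hpos).1 (le_refl (level k vs w))
  refine ⟨t, (Finset.mem_powersetCard.1 ht).2, fun v hv => ?_⟩
  have h := hle.trans (Finset.inf_le hv)
  have hv0 : 0 < w v := ENNReal.ofReal_pos.1 (hpos.trans_le h)
  exact ENNReal.toReal_le_of_le_ofReal hv0.le h

theorem level_pos (hvs : ∀ s ∈ K.faces, s ⊆ vs) (hw : w ∈ K.skeletonCompl k) :
    0 < level k vs w := by
  obtain ⟨t, ht, hpos⟩ := exists_card_eq_of_mem_skeletonCompl hw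
  have hne : t.Nonempty := Finset.card_pos.1 (by omega)
  obtain ⟨v₀, hv₀, hmin⟩ := t.exists_min_image w hne
  exact (ENNReal.ofReal_pos.2 (hpos v₀ hv₀)).trans_le
    (le_level (fun v hv => mem_of_pos hvs hw.1 (hpos v hv)) ht hmin)

theorem sum_min_level_pos (hvs : ∀ s ∈ K.faces, s ⊆ vs) (hw : w ∈ K.skeletonCompl k) :
    0 < ∑ u ∈ vs, min (w u) (level k vs w).toReal := by
  have hl := ENNReal.toReal_pos (level_pos hvs hw).ne' level_lt_top.ne
  obtain ⟨t, ht, hpos⟩ := exists_card_eq_of_mem_skeletonCompl hw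
  have hne : t.Nonempty := Finset.card_pos.1 (by omega)
  obtain ⟨v₀, hv₀⟩ := hne
  exact Finset.sum_pos' (fun u _ => le_min (hw.1.1 u) hl.le)
    ⟨v₀, mem_of_pos hvs hw.1 (hpos v₀ hv₀), lt_min (hpos v₀ hv₀) hl⟩

theorem clip_pos_iff (hvs : ∀ s ∈ K.faces, s ⊆ vs) (hw : w ∈ K.skeletonCompl k) (v : ι) :
    0 < clip k vs w v ↔ 0 < w v := by
  have hl := ENNReal.toReal_pos (level_pos hvs hw).ne' level_lt_top.ne
  rw [clip, div_pos_iff_of_pos_right (sum_min_level_pos hvs hw), lt_min_iff, and_iff_left hl]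

theorem clip_nonneg (hw : w ∈ K.realization) (v : ι) : 0 ≤ clip k vs w v :=
  div_nonneg (le_min (hw.1 v) ENNReal.toReal_nonneg)
    (Finset.sum_nonneg fun u _ => le_min (hw.1 u) ENNReal.toReal_nonneg)

theorem clip_mem_realization (hvs : ∀ s ∈ K.faces, s ⊆ vs) (hw : w ∈ K.skeletonCompl k) :
    clip k vs w ∈ K.realization := by
  obtain ⟨h0, s, hs, hs0, hs1⟩ := hw.1
  have hl := ENNReal.toReal_pos (level_pos hvs hw).ne' level_lt_top.ne
  refine ⟨clip_nonneg hw.1, s, hs, fun v hv => ?_, ?_⟩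
  · rw [clip, hs0 v hv, min_eq_left hl.le, zero_div]
  · simp only [clip]
    rw [← Finset.sum_div, div_eq_one_iff_eq (sum_min_level_pos hvs hw).ne']
    refine Finset.sum_subset (hvs s hs) fun v _ hv => ?_
    rw [hs0 v hv, min_eq_left hl.le]

/-- The `k + 2` coordinates that reach the level are all cut to the same value, which no other
coordinate exceeds. -/
theorem clip_mem_dualRealization (hvs : ∀ s ∈ K.faces, s ⊆ vs) (hw : w ∈ K.skeletonCompl k) :
    clip k vs w ∈ K.dualRealization k := by
  obtain ⟨t, ht, hle⟩ := exists_card_eq_level_le (level_pos hvs hw)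
  refine ⟨clip_mem_realization hvs hw, t, ht, fun v hv u => ?_⟩
  have := sum_min_level_pos hvs hw
  simp only [clip]
  refine div_le_div_of_nonneg_right ?_ this.le
  rw [min_eq_right (hle v hv)]
  exact min_le_right _ _

theorem clip_eq_self (hvs : ∀ s ∈ K.faces, s ⊆ vs) (hw : w ∈ K.dualRealization k) :
    clip k vs w = w := by
  have hw' := dualRealization_subset hw
  obtain ⟨hwr, t, ht, hmax⟩ := hw
  obtain ⟨h0, s, hs, hs0, hs1⟩ := id hwr
  have htvs : t ⊆ vs := by
    intro v hv
    refine mem_of_pos hvs hwr ?_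
    by_contra hneg
    rw [Finset.sum_eq_zero fun u _ =>
      le_antisymm ((hmax v hv u).trans (not_lt.1 hneg)) (h0 u)] at hs1
    exact zero_ne_one hs1
  have hle : ∀ u, w u ≤ (level k vs w).toReal := fun u =>
    (ENNReal.ofReal_le_iff_le_toReal level_lt_top.ne).1
      (le_level htvs ht fun v hv => hmax v hv u)
  ext v
  simp only [clip, min_eq_left (hle _)]
  rw [sum_eq_one_of_mem_realization hwr fun v hv => hs0 v fun h => hv (hvs s hs h), div_one]

/-- A segment in a common simplex, between points with the same support, stays in the complement of
the skeleton. -/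
theorem lineMap_mem_skeletonCompl {w' : ι → ℝ} (hw : w ∈ K.skeletonCompl k)
    (hw' : w' ∈ K.realization) (hpos : ∀ v, 0 < w' v ↔ 0 < w v) {t : ℝ} (ht : t ∈ Icc (0 : ℝ) 1) :
    (fun v => (1 - t) * w v + t * w' v) ∈ K.skeletonCompl k := by
  have h1t := sub_nonneg.2 ht.2
  obtain ⟨T, hT, hTpos⟩ := exists_card_eq_of_mem_skeletonCompl hw
  obtain ⟨h0, s, hs, hs0, hs1⟩ := hw.1
  have hs0' : ∀ v ∉ s, w' v = 0 := fun v hv => le_antisymm (by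
    by_contra h
    exact ((hpos v).1 (not_le.1 h)).ne' (hs0 v hv)) (hw'.1 v)
  refine mem_skeletonCompl_of_exists ⟨fun v => ?_, s, hs, fun v hv => ?_, ?_⟩ ⟨T, hT, fun v hv => ?_⟩
  · exact add_nonneg (mul_nonneg h1t (h0 v)) (mul_nonneg ht.1 (hw'.1 v))
  · simp [hs0 v hv, hs0' v hv]
  · rw [Finset.sum_add_distrib, ← Finset.mul_sum, ← Finset.mul_sum, hs1,
      sum_eq_one_of_mem_realization hw' hs0']
    ring
  · have h1 := hTpos v hv
    have h2 := (hpos v).2 h1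
    rcases ht.1.eq_or_lt with rfl | ht0
    · simpa using h1
    · exact add_pos_of_nonneg_of_pos (mul_nonneg h1t h1.le) (mul_pos ht0 h2)

theorem continuous_clip (hvs : ∀ s ∈ K.faces, s ⊆ vs) :
    Continuous fun w : K.skeletonCompl k => clip k vs (w : ι → ℝ) := by
  have hl : Continuous fun w : K.skeletonCompl k => (level k vs (w : ι → ℝ)).toReal :=
    continuous_toReal_level.comp continuous_subtype_val
  have hc : ∀ v, Continuous fun w : K.skeletonCompl k => (w : ι → ℝ) v := fun v =>
    (continuous_apply v).comp continuous_subtype_val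
  refine continuous_pi fun v => ?_
  exact ((hc v).min hl).div (continuous_finsetSum _ fun u _ => (hc u).min hl)
    fun w => (sum_min_level_pos hvs w.2).ne'

/-- The complement of the `k`-skeleton deformation retracts to the dual skeleton. -/
theorem isDeformationRetract_dualRealization (hK : K.faces.Finite) (k : ℕ) :
    IsDeformationRetract (K.dualRealization k) (K.skeletonCompl k) := by
  classical
  obtain ⟨vs, hvs⟩ : ∃ vs : Finset ι, ∀ s ∈ K.faces, s ⊆ vs :=
    ⟨hK.toFinset.sup id, fun s hs => Finset.le_sup (f := id) (hK.mem_toFinset.2 hs)⟩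
  have hcont := continuous_clip (k := k) hvs
  refine ⟨dualRealization_subset, ⟨fun w => ⟨clip k vs w, dualRealization_subset
    (clip_mem_dualRealization hvs w.2)⟩, hcont.subtype_mk _⟩,
    fun w => clip_mem_dualRealization hvs w.2, fun w hw => Subtype.ext (clip_eq_self hvs hw),
    ⟨⟨⟨fun p => ⟨fun v => (1 - (p.1 : ℝ)) * (p.2 : ι → ℝ) v + p.1 * clip k vs p.2 v,
      lineMap_mem_skeletonCompl p.2.2 (clip_mem_realization hvs p.2.2)
        (clip_pos_iff hvs p.2.2) p.1.2⟩, ?_⟩, fun w => ?_, fun w => ?_⟩⟩⟩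
  · refine Continuous.subtype_mk (continuous_pi fun v => ?_) _
    have h1 : Continuous fun p : unitInterval × K.skeletonCompl k => (p.2 : ι → ℝ) v :=
      (continuous_apply v).comp (continuous_subtype_val.comp continuous_snd)
    have h2 : Continuous fun p : unitInterval × K.skeletonCompl k => clip k vs p.2 v :=
      (continuous_apply v).comp (hcont.comp continuous_snd)
    have h3 : Continuous fun p : unitInterval × K.skeletonCompl k => (p.1 : ℝ) :=
      continuous_subtype_val.comp continuous_fst
    exact ((continuous_const.sub h3).mul h1).add (h3.mul h2)
  · ext v
    simp
  · ext v
    simp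

end PreAbstractSimplicialComplex

/-! ### Pushing away from the skeleton -/

namespace PreAbstractSimplicialComplex

variable {ι : Type*}

open scoped Classical in
/-- Pushing points radially away from the simplex `σ`, at time `t`, until the total weight outside
of `σ` is at least `θ`. -/
noncomputable def push (σ : Finset ι) (θ t : ℝ) (w : ι → ℝ) (v : ι) : ℝ :=
  -- The bound `1 - θ` in the first denominator takes over only where the numerator vanishes; it
  -- keeps the quotient continuous where the weight on `σ` vanishes.
  w v * if v ∈ σ then 1 - t * (max (θ - offMass σ w) 0 / max (1 - offMass σ w) (1 - θ))
    else 1 + t * (max (θ - offMass σ w) 0 / offMass σ w)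

variable {K : PreAbstractSimplicialComplex ι} {k : ℕ} {w : ι → ℝ} {σ ρ : Finset ι} {θ t : ℝ}

theorem push_zero : push σ θ 0 w = w := by
  ext v
  simp [push]

theorem push_of_le (h : θ ≤ offMass σ w) : push σ θ t w = w := by
  ext v
  simp [push, max_eq_right (sub_nonpos.2 h)]

theorem push_of_mem {v : ι} (hv : v ∈ σ) (h : offMass σ w < θ) :
    push σ θ t w v = w v * (1 - t * ((θ - offMass σ w) / (1 - offMass σ w))) := by
  rw [push, if_pos hv, max_eq_left (sub_nonneg.2 h.le), max_eq_left (by linarith)]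

theorem push_of_notMem {v : ι} (hv : v ∉ σ) (h : offMass σ w < θ) :
    push σ θ t w v = w v * (1 + t * ((θ - offMass σ w) / offMass σ w)) := by
  rw [push, if_neg hv, max_eq_left (sub_nonneg.2 h.le)]

theorem push_factor_pos (hθ : θ < 1) (ht : t ∈ Icc (0 : ℝ) 1) (h : offMass σ w < θ) :
    1 - θ ≤ 1 - t * ((θ - offMass σ w) / (1 - offMass σ w)) ∨ offMass σ w < 0 := by
  rcases lt_or_ge (offMass σ w) 0 with h0 | h0
  · exact Or.inr h0
  left
  have h1 : (θ - offMass σ w) / (1 - offMass σ w) ≤ θ := by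
    rw [div_le_iff₀ (by linarith)]
    nlinarith
  have h2 : 0 ≤ (θ - offMass σ w) / (1 - offMass σ w) :=
    div_nonneg (by linarith) (by linarith)
  nlinarith [ht.1, ht.2]

/-- Both factors of the push are positive, so a point keeps its support; in particular it stays off
the `k`-skeleton. -/
theorem push_pos_iff (hw : w ∈ K.realization) (hθ : θ < 1) (ht : t ∈ Icc (0 : ℝ) 1) (v : ι) :
    0 < push σ θ t w v ↔ 0 < w v := by
  rcases le_or_gt θ (offMass σ w) with h | h
  · rw [push_of_le h]
  by_cases hv : v ∈ σ
  · rw [push_of_mem hv h, mul_pos_iff_of_pos_right]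
    have := (push_factor_pos hθ ht h).resolve_right (offMass_nonneg hw σ).not_gt
    linarith
  · rw [push_of_notMem hv h, mul_pos_iff_of_pos_right]
    have := mul_nonneg ht.1 (div_nonneg (sub_nonneg.2 h.le) (offMass_nonneg hw σ))
    linarith

/-- The weight outside `σ` moves linearly in time to its target value `θ`. -/
theorem offMass_push_self (hs : offMass σ w ≠ 1) (h : offMass σ w < θ) :
    offMass σ (push σ θ t w) = offMass σ w + t * (θ - offMass σ w) := by
  have h1 : ∑ v ∈ σ, push σ θ t w v =
      (∑ v ∈ σ, w v) * (1 - t * ((θ - offMass σ w) / (1 - offMass σ w))) := by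
    rw [Finset.sum_mul]
    exact Finset.sum_congr rfl fun v hv => push_of_mem hv h
  have h2 : ∑ v ∈ σ, w v = 1 - offMass σ w := by rw [offMass]; ring
  have h3 : 1 - offMass σ w ≠ 0 := sub_ne_zero.2 hs.symm
  rw [offMass, h1, h2]
  field_simp
  ring

theorem push_mem_realization (hw : w ∈ K.realization) (hθ : θ < 1) (ht : t ∈ Icc (0 : ℝ) 1)
    (hs : 0 < offMass σ w) : push σ θ t w ∈ K.realization := by
  classical
  rcases le_or_gt θ (offMass σ w) with h | h
  · rwa [push_of_le h]
  have hpos := push_pos_iff (σ := σ) hw hθ ht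
  obtain ⟨h0, s, hs', hs0, hs1⟩ := id hw
  have hnn : ∀ v, 0 ≤ push σ θ t w v := fun v => by
    rcases (h0 v).eq_or_lt with h' | h'
    · simp [push, ← h']
    · exact ((hpos v).2 h').le
  refine ⟨hnn, s, hs', fun v hv => by simp [push, hs0 v hv], ?_⟩
  have h3 : ∀ f : ι → ℝ, (∀ v ∉ s, f v = 0) →
      ∑ v ∈ s, f v = ∑ v ∈ s \ σ, f v + ∑ v ∈ σ, f v := fun f hf => by
    rw [← Finset.sum_inter_add_sum_sdiff s σ f, add_comm]
    congr 1
    exact Finset.sum_subset Finset.inter_subset_right fun v hv hvs =>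
      hf v fun hvs' => hvs (Finset.mem_inter.2 ⟨hvs', hv⟩)
  have h4 := h3 w hs0
  rw [h3 _ fun v hv => by simp [push, hs0 v hv]]
  have h5 : ∑ v ∈ σ, push σ θ t w v = 1 - offMass σ (push σ θ t w) := by rw [offMass]; ring
  have h6 : ∑ v ∈ σ, w v = 1 - offMass σ w := by rw [offMass]; ring
  have h7 : ∑ v ∈ s \ σ, w v = offMass σ w := by linarith
  have h8 : ∑ v ∈ s \ σ, push σ θ t w v =
      (∑ v ∈ s \ σ, w v) * (1 + t * ((θ - offMass σ w) / offMass σ w)) := by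
    rw [Finset.sum_mul]
    exact Finset.sum_congr rfl fun v hv => push_of_notMem (Finset.mem_sdiff.1 hv).2 h
  rw [h5, h8, h7, offMass_push_self (by linarith) h]
  field_simp
  ring

theorem push_mem_skeletonCompl (hw : w ∈ K.skeletonCompl k) (hσ : σ ∈ K.faces)
    (hσk : σ.card ≤ k + 1) (hθ : θ < 1) (ht : t ∈ Icc (0 : ℝ) 1) :
    push σ θ t w ∈ K.skeletonCompl k := by
  obtain ⟨T, hT, hpos⟩ := exists_card_eq_of_mem_skeletonCompl hw
  exact mem_skeletonCompl_of_exists (push_mem_realization hw.1 hθ ht (hw.2 σ hσ hσk))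
    ⟨T, hT, fun v hv => (push_pos_iff hw.1 hθ ht v).2 (hpos v hv)⟩

/-- Pushing away from `σ` by a small amount does not move points much closer to the other
simplices. -/
theorem le_offMass_push (hw : w ∈ K.realization) (hθ : θ < 1) (ht : t ∈ Icc (0 : ℝ) 1)
    (hs : 0 < offMass σ w) {c : ℝ} (hθc : θ ≤ c / 4) (hc1 : c ≤ 1) (hρ : c ≤ offMass ρ w) :
    c / 4 ≤ offMass ρ (push σ θ t w) := by
  classical
  rcases le_or_gt θ (offMass σ w) with h | h
  · rw [push_of_le h]
    have := hs
    have := offMass_nonneg hw ρ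
    by_cases hc : 0 ≤ c <;> linarith
  have h1 := sum_sdiff_le_offMass (push_mem_realization (K := K) hw hθ ht hs) σ ρ
  have h2 := offMass_sub_le_sum_sdiff hw σ ρ
  have hf := (push_factor_pos hθ ht h).resolve_right (offMass_nonneg hw σ).not_gt
  have h3 : ∑ v ∈ σ \ ρ, push σ θ t w v =
      (∑ v ∈ σ \ ρ, w v) * (1 - t * ((θ - offMass σ w) / (1 - offMass σ w))) := by
    rw [Finset.sum_mul]
    exact Finset.sum_congr rfl fun v hv => push_of_mem (Finset.mem_sdiff.1 hv).1 h
  rw [h3] at h1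
  -- The weight on `σ \ ρ` is at least `c - θ ≥ 3 * c / 4`, and pushing multiplies it by at least `1
  -- - θ ≥ 3 / 4`; the product exceeds `c / 4`.
  have h4 : 3 * c / 4 ≤ ∑ v ∈ σ \ ρ, w v := by linarith
  have h5 : (3 : ℝ) / 4 ≤ 1 - t * ((θ - offMass σ w) / (1 - offMass σ w)) := by linarith
  nlinarith

theorem continuousOn_push (σ : Finset ι) (hθ : θ < 1) :
    ContinuousOn (fun p : ℝ × (ι → ℝ) => push σ θ p.1 p.2) {p | offMass σ p.2 ≠ 0} := by
  refine continuousOn_pi.2 fun v => ?_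
  have hs : Continuous fun p : ℝ × (ι → ℝ) => offMass σ p.2 :=
    (continuous_offMass σ).comp continuous_snd
  have hv : Continuous fun p : ℝ × (ι → ℝ) => p.2 v :=
    (continuous_apply v).comp continuous_snd
  have hm : Continuous fun p : ℝ × (ι → ℝ) => max (θ - offMass σ p.2) 0 :=
    (continuous_const.sub hs).max continuous_const
  have hM : Continuous fun p : ℝ × (ι → ℝ) => max (1 - offMass σ p.2) (1 - θ) :=
    (continuous_const.sub hs).max continuous_const
  by_cases h : v ∈ σ
  · simp only [push, if_pos h]
    refine (hv.mul (continuous_const.sub (continuous_fst.mul (hm.div hM fun p => ?_)))).continuousOn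
    have := le_max_right (1 - offMass σ p.2) (1 - θ)
    linarith
  · simp only [push, if_neg h]
    exact hv.continuousOn.mul (continuousOn_const.add (continuous_fst.continuousOn.mul
      (hm.continuousOn.div hs.continuousOn fun p hp => hp)))

/-- The maps of the complement of the skeleton that preserve, for `r ≤ r₀`, the points at distance
at least `r` from each simplex. -/
def PreservesFar (K : PreAbstractSimplicialComplex ι) (k : ℕ) (D : Finset ι → (ι → ℝ) → ENNReal)
    (r₀ : ENNReal) (g : C(K.skeletonCompl k, K.skeletonCompl k)) : Prop :=
  ∀ w : K.skeletonCompl k, ∀ ρ ∈ K.faces, ∀ r ≤ r₀, r ≤ D ρ w → r ≤ D ρ (g w)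

/-- If pushing away from each simplex `σ` of dimension at most `k` preserves the points at distance
at least `r` from each simplex, provided that one starts away from the boundary of `σ`, then the
complement of the `k`-skeleton can be pushed away from the skeleton by a homotopy with the same
property. -/
theorem exists_homotopyWith_preservesFar (hK : K.faces.Finite)
    (D : Finset ι → (ι → ℝ) → ENNReal)
    (hD : ∀ σ ∈ K.faces, σ.card ≤ k + 1 → ∀ c : ℝ, 0 < c → ∃ θ : ℝ, 0 < θ ∧ θ ≤ c ∧
      ∃ r₀ : ENNReal, 0 < r₀ ∧ ∀ w ∈ K.realization, (∀ ρ ∈ K.faces, ρ ⊂ σ → c ≤ offMass ρ w) →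
        0 < offMass σ w → offMass σ w < θ → ∀ t ∈ Icc (0 : ℝ) 1, ∀ ρ ∈ K.faces, ∀ r ≤ r₀,
          r ≤ D ρ w → r ≤ D ρ (push σ θ t w)) :
    ∃ c : ℝ, 0 < c ∧ ∃ r₀ : ENNReal, 0 < r₀ ∧ ∃ f : C(K.skeletonCompl k, K.skeletonCompl k),
      Nonempty ((ContinuousMap.id _).HomotopyWith f (PreservesFar K k D r₀)) ∧
        ∀ w, ∀ ρ ∈ K.faces, ρ.card ≤ k + 1 → c ≤ offMass ρ (f w : ι → ℝ) := by
  classical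
  suffices h : ∀ Q : Finset (Finset ι), (∀ σ ∈ Q, σ ∈ K.faces ∧ σ.card ≤ k + 1) →
      (∀ σ ∈ Q, ∀ ρ ∈ K.faces, ρ ⊂ σ → ρ ∈ Q) →
      ∃ c : ℝ, (0 < c ∧ c ≤ 1) ∧ ∃ r₀ : ENNReal, 0 < r₀ ∧
        ∃ f : C(K.skeletonCompl k, K.skeletonCompl k),
        Nonempty ((ContinuousMap.id _).HomotopyWith f (PreservesFar K k D r₀)) ∧
        ∀ w, ∀ ρ ∈ Q, c ≤ offMass ρ (f w : ι → ℝ) by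
    obtain ⟨c, hc, r₀, hr₀, f, hf, hfc⟩ := h (hK.toFinset.filter fun σ => σ.card ≤ k + 1)
      (fun σ hσ => by simpa using hσ) (fun σ hσ ρ hρ hρσ => by
        rw [Finset.mem_filter, hK.mem_toFinset] at hσ ⊢
        exact ⟨hρ, (Finset.card_lt_card hρσ).le.trans hσ.2⟩)
    exact ⟨c, hc.1, r₀, hr₀, f, hf, fun w ρ hρ hρk => hfc w ρ (by
      rw [Finset.mem_filter, hK.mem_toFinset]; exact ⟨hρ, hρk⟩)⟩
  intro Q
  -- Simplices are treated by increasing cardinality, so the proper faces of `σ` have been dealt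
  -- with before `σ`.
  induction Q using Finset.induction_on_max_value (fun σ : Finset ι => σ.card) with
  | empty =>
    exact fun _ _ => ⟨1, by simp, 1, one_pos, ContinuousMap.id _,
      ⟨.refl _ fun w ρ _ r _ h => h⟩, by simp⟩
  | insert σ Q hσQ hmax ih =>
    intro hQ hdown
    obtain ⟨hσ, hσk⟩ := hQ σ (Finset.mem_insert_self _ _)
    obtain ⟨c, ⟨hc0, hc1⟩, r₁, hr₁, f, ⟨F⟩, hfc⟩ := ih
      (fun τ hτ => hQ τ (Finset.mem_insert_of_mem hτ)) fun τ hτ ρ hρ hρτ => by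
        refine Finset.mem_of_mem_insert_of_ne (hdown τ (Finset.mem_insert_of_mem hτ) ρ hρ hρτ) ?_
        rintro rfl
        exact (Finset.card_lt_card hρτ).not_ge (hmax τ hτ)
    obtain ⟨θ, hθ0, hθc, r₂, hr₂, hpush⟩ := hD σ hσ hσk (c / 4) (by positivity)
    have hθ1 : θ < 1 := by linarith
    let G : unitInterval × K.skeletonCompl k → K.skeletonCompl k := fun p =>
      ⟨push σ θ p.1 (f p.2 : ι → ℝ), push_mem_skeletonCompl (f p.2).2 hσ hσk hθ1 p.1.2⟩
    have hG : Continuous G := by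
      refine Continuous.subtype_mk ?_ _
      refine (continuousOn_push σ hθ1).comp_continuous
        (f := fun p : unitInterval × K.skeletonCompl k => ((p.1 : ℝ), (f p.2 : ι → ℝ))) ?_ ?_
      · exact (continuous_subtype_val.comp continuous_fst).prodMk
          (continuous_subtype_val.comp (f.continuous.comp continuous_snd))
      · exact fun p => ((f p.2).2.2 σ hσ hσk).ne'
    let g : C(K.skeletonCompl k, K.skeletonCompl k) :=
      ⟨fun w => G (1, w), hG.comp (by fun_prop)⟩
    have hF : ∀ (h : C(K.skeletonCompl k, K.skeletonCompl k)), PreservesFar K k D r₁ h →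
        PreservesFar K k D (min r₁ r₂) h := fun h hh w ρ hρ r hr =>
      hh w ρ hρ r (hr.trans (min_le_left _ _))
    have hf : PreservesFar K k D r₁ f := by
      have := F.prop 1
      convert this
      ext w
      simp
    let F₁ : (ContinuousMap.id _).HomotopyWith f (PreservesFar K k D (min r₁ r₂)) :=
      ⟨F.toHomotopy, fun t => hF _ (F.prop t)⟩
    let F₂ : f.HomotopyWith g (PreservesFar K k D (min r₁ r₂)) :=
      ⟨⟨⟨G, hG⟩, fun w => Subtype.ext push_zero, fun w => rfl⟩, fun t w ρ hρ r hr hrw => by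
        have h1 := hf w ρ hρ r (hr.trans (min_le_left _ _)) hrw
        change r ≤ D ρ (push σ θ t (f w : ι → ℝ))
        rcases le_or_gt θ (offMass σ (f w : ι → ℝ)) with h | h
        · rwa [push_of_le h]
        · refine hpush _ (f w).2.1 (fun τ hτ hτσ => ?_) ((f w).2.2 σ hσ hσk) h t t.2 ρ hρ r
            (hr.trans (min_le_right _ _)) h1
          have hτQ : τ ∈ Q := Finset.mem_of_mem_insert_of_ne
            (hdown σ (Finset.mem_insert_self _ _) τ hτ hτσ) hτσ.ne
          linarith [hfc w τ hτQ]⟩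
    -- The new lower bound is `θ`: it is reached for `σ` at time `1`, and for earlier simplices `c /
    -- 4 ≥ θ` survives the push.
    refine ⟨θ, ⟨hθ0, hθ1.le⟩, min r₁ r₂, lt_min hr₁ hr₂, g, ⟨F₁.trans F₂⟩, fun w ρ hρ => ?_⟩
    have hw := (f w).2
    change θ ≤ offMass ρ (push σ θ (1 : unitInterval) (f w : ι → ℝ))
    rcases Finset.mem_insert.1 hρ with rfl | hρQ
    · rcases le_or_gt θ (offMass ρ (f w : ι → ℝ)) with h | h
      · rwa [push_of_le h]
      · rw [offMass_push_self (by linarith) h]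
        simp
    · exact hθc.trans (le_offMass_push hw.1 hθ1 (by simp) (hw.2 σ hσ hσk) hθc hc1 (hfc w ρ hρQ))

end PreAbstractSimplicialComplex

/-! ### From barycentric coordinates to the geometric complex -/

/-- A homeomorphism between sets restricts to a homeomorphism between corresponding subsets. -/
def Homeomorph.restrictSubsets {X Y : Type*} [TopologicalSpace X] [TopologicalSpace Y]
    {A A' : Set X} {B B' : Set Y} (e : A ≃ₜ B) (hA : A' ⊆ A) (hB : B' ⊆ B)
    (h : ∀ x : A, (x : X) ∈ A' ↔ (e x : Y) ∈ B') : A' ≃ₜ B' where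
  toFun x := ⟨e (inclusion hA x), (h _).1 x.2⟩
  invFun y := ⟨e.symm (inclusion hB y), (h _).2 (by simp)⟩
  left_inv x := by ext; simp
  right_inv y := by ext; simp
  continuous_toFun := by
    refine Continuous.subtype_mk ?_ _
    exact continuous_subtype_val.comp (e.continuous.comp (continuous_inclusion hA))
  continuous_invFun := by
    refine Continuous.subtype_mk ?_ _
    exact continuous_subtype_val.comp (e.symm.continuous.comp (continuous_inclusion hB))

/-- The coefficients of an affine combination of affinely independent points are unique. -/
theorem AffineIndependent.eq_zero_of_sum_smul_eq_zero {E : Type*} [AddCommGroup E] [Module ℝ E]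
    {s : Finset E} (hs : AffineIndependent ℝ ((↑) : s → E)) {w : E → ℝ} (h0 : ∑ v ∈ s, w v = 0)
    (h : ∑ v ∈ s, w v • v = 0) : ∀ v ∈ s, w v = 0 := by
  intro v hv
  refine (affineIndependent_iff.1 hs) Finset.univ (fun v => w v) ?_ ?_ ⟨v, hv⟩ (Finset.mem_univ _)
  · rw [← h0, ← Finset.sum_coe_sort s]
  · rw [← h, ← Finset.sum_coe_sort s]

namespace PreAbstractSimplicialComplex

theorem isCompact_realization {ι : Type*} {K : PreAbstractSimplicialComplex ι}
    (hK : K.faces.Finite) : IsCompact K.realization := by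
  have h1 : K.realization = ⋃ s ∈ K.faces,
      {w : ι → ℝ | (∀ v, 0 ≤ w v) ∧ (∀ v ∉ s, w v = 0) ∧ ∑ v ∈ s, w v = 1} := by
    ext w
    simp only [realization, mem_ofPred_eq, mem_iUnion, exists_prop]
    tauto
  rw [h1]
  refine hK.isCompact_biUnion fun s hs => ?_
  refine (isCompact_univ_pi fun _ => isCompact_Icc (a := (0 : ℝ)) (b := 1)).of_isClosed_subset ?_ ?_
  · have h2 : {w : ι → ℝ | (∀ v, 0 ≤ w v) ∧ (∀ v ∉ s, w v = 0) ∧ ∑ v ∈ s, w v = 1} =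
        (⋂ v, {w : ι → ℝ | 0 ≤ w v}) ∩ ((⋂ v, ⋂ _ : v ∉ s, {w : ι → ℝ | w v = 0}) ∩
          {w : ι → ℝ | ∑ v ∈ s, w v = 1}) := by
      ext w
      simp
    rw [h2]
    refine (isClosed_iInter fun v => isClosed_le continuous_const (continuous_apply v)).inter
      ((isClosed_iInter fun v => isClosed_iInter fun _ => isClosed_eq (continuous_apply v)
        continuous_const).inter (isClosed_eq (by fun_prop) continuous_const))
  · intro w hw v _
    have hw' : w ∈ K.realization := ⟨hw.1, s, hs, hw.2⟩
    have := sum_le_one_of_mem_realization hw' {v}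
    rw [Finset.sum_singleton] at this
    exact ⟨hw.1 v, this⟩

end PreAbstractSimplicialComplex

namespace Geometry.SimplicialComplex

variable {E : Type*} [AddCommGroup E] [Module ℝ E]

/-- The point with barycentric coordinates `w`, with respect to the vertices `vs`. -/
def toPoint (vs : Finset E) (w : E → ℝ) : E := ∑ v ∈ vs, w v • v

variable {K : SimplicialComplex ℝ E} {vs s t : Finset E} {w w' : E → ℝ}

theorem toPoint_eq_sum (hs : s ⊆ vs) (hw : ∀ v ∉ s, w v = 0) :
    toPoint vs w = ∑ v ∈ s, w v • v :=
  (Finset.sum_subset hs fun v _ hv => by rw [hw v hv, zero_smul]).symm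

theorem toPoint_mem_convexHull (hs : s ⊆ vs) (hw : w ∈ K.realization) (hs0 : ∀ v ∉ s, w v = 0) :
    toPoint vs w ∈ convexHull ℝ (s : Set E) := by
  rw [toPoint_eq_sum hs hs0, Finset.mem_convexHull']
  exact ⟨w, fun v _ => hw.1 v,
    PreAbstractSimplicialComplex.sum_eq_one_of_mem_realization hw hs0, rfl⟩

theorem exists_toPoint_eq (hs : s ⊆ vs) (hsK : s ∈ K.faces) {x : E}
    (hx : x ∈ convexHull ℝ (s : Set E)) :
    ∃ w ∈ K.realization, (∀ v ∉ s, w v = 0) ∧ toPoint vs w = x := by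
  classical
  obtain ⟨u, hu0, hu1, hux⟩ := Finset.mem_convexHull'.1 hx
  have h0 : ∀ v ∉ s, (fun v => if v ∈ s then u v else 0) v = 0 := fun v hv => if_neg hv
  have h1 : ∀ v ∈ s, (fun v => if v ∈ s then u v else 0) v = u v := fun v hv => if_pos hv
  refine ⟨fun v => if v ∈ s then u v else 0, ⟨fun v => ?_, s, hsK, h0, ?_⟩, h0, ?_⟩
  · dsimp only
    split_ifs with h
    exacts [hu0 v h, le_rfl]
  · rw [← hu1]
    exact Finset.sum_congr rfl h1
  · rw [toPoint_eq_sum hs h0, ← hux]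
    exact Finset.sum_congr rfl fun v hv => congrArg (· • v) (h1 v hv)

theorem eq_of_toPoint_eq_of_face (hs : s ⊆ vs) (hsK : s ∈ K.faces) (hw : w ∈ K.realization)
    (hs0 : ∀ v ∉ s, w v = 0) (hw' : w' ∈ K.realization) (hs0' : ∀ v ∉ s, w' v = 0)
    (h : toPoint vs w = toPoint vs w') : w = w' := by
  have h1 := (K.indep hsK).eq_zero_of_sum_smul_eq_zero (w := w - w')
    (by simp [Finset.sum_sub_distrib,
      PreAbstractSimplicialComplex.sum_eq_one_of_mem_realization hw hs0,
      PreAbstractSimplicialComplex.sum_eq_one_of_mem_realization hw' hs0'])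
    (by
      rw [toPoint_eq_sum hs hs0, toPoint_eq_sum hs hs0'] at h
      simp [sub_smul, Finset.sum_sub_distrib, h])
  ext v
  by_cases hv : v ∈ s
  · exact sub_eq_zero.1 (h1 v hv)
  · rw [hs0 v hv, hs0' v hv]

/-- If a point of the face `t` also lies in `s`, it lies in the common face `t ∩ s`; by uniqueness
in `t` its coordinates are those it has there. -/
theorem toPoint_mem_convexHull_iff (hvs : ∀ s ∈ K.faces, s ⊆ vs) (hs : s ∈ K.faces)
    (hw : w ∈ K.realization) :
    toPoint vs w ∈ convexHull ℝ (s : Set E) ↔ ∀ v ∉ s, w v = 0 := by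
  classical
  refine ⟨fun h => ?_, toPoint_mem_convexHull (hvs s hs) hw⟩
  obtain ⟨h0, t, ht, ht0, ht1⟩ := id hw
  have hx := K.inter_subset_convexHull ht hs ⟨toPoint_mem_convexHull (hvs t ht) hw ht0, h⟩
  rw [← Finset.coe_inter] at hx
  have hne : (t ∩ s).Nonempty := by
    have := convexHull_nonempty_iff.1 ⟨_, hx⟩
    exact_mod_cast this
  have htsK := K.down_closed ht Finset.inter_subset_left hne
  obtain ⟨u, hu, hu0, hux⟩ := exists_toPoint_eq (hvs _ htsK) htsK hx
  have := eq_of_toPoint_eq_of_face (hvs t ht) ht hu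
    (fun v hv => hu0 v fun h => hv (Finset.mem_inter.1 h).1) hw ht0 hux
  subst this
  exact fun v hv => hu0 v fun h => hv (Finset.mem_inter.1 h).2

theorem injOn_toPoint (hvs : ∀ s ∈ K.faces, s ⊆ vs) : InjOn (toPoint vs) K.realization := by
  intro w hw w' hw' h
  obtain ⟨h0, t, ht, ht0, ht1⟩ := id hw
  refine eq_of_toPoint_eq_of_face (hvs t ht) ht hw ht0 hw' ?_ h
  rw [← toPoint_mem_convexHull_iff hvs ht hw', ← h]
  exact toPoint_mem_convexHull (hvs t ht) hw ht0

theorem toPoint_mem_convexHull_iff_offMass (hvs : ∀ s ∈ K.faces, s ⊆ vs) (hs : s ∈ K.faces)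
    (hw : w ∈ K.realization) : toPoint vs w ∈ convexHull ℝ (s : Set E) ↔
      PreAbstractSimplicialComplex.offMass s w = 0 := by
  rw [toPoint_mem_convexHull_iff hvs hs hw]
  constructor
  · intro h
    rw [PreAbstractSimplicialComplex.offMass,
      PreAbstractSimplicialComplex.sum_eq_one_of_mem_realization hw h, sub_self]
  · intro h v hv
    by_contra hne
    exact ((PreAbstractSimplicialComplex.offMass_pos_iff hw).2
      ⟨v, hv, lt_of_le_of_ne (hw.1 v) (Ne.symm hne)⟩).ne' h

theorem toPoint_mem_space (hvs : ∀ s ∈ K.faces, s ⊆ vs) (hw : w ∈ K.realization) :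
    toPoint vs w ∈ K.space := by
  obtain ⟨h0, t, ht, ht0, ht1⟩ := id hw
  exact K.convexHull_subset_space ht (toPoint_mem_convexHull (hvs t ht) hw ht0)

theorem image_toPoint_realization (hvs : ∀ s ∈ K.faces, s ⊆ vs) {x : E} (hx : x ∈ K.space) :
    ∃ w ∈ K.realization, toPoint vs w = x := by
  obtain ⟨s, hs, hxs⟩ := K.mem_space_iff.1 hx
  obtain ⟨w, hw, -, h⟩ := exists_toPoint_eq (hvs s hs) hs hxs
  exact ⟨w, hw, h⟩

end Geometry.SimplicialComplex

namespace Geometry.SimplicialComplex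

variable {E : Type*} [NormedAddCommGroup E] [NormedSpace ℝ E] {K : SimplicialComplex ℝ E}
  {vs : Finset E}

theorem continuous_toPoint (vs : Finset E) : Continuous (toPoint vs) := by
  unfold toPoint
  fun_prop

/-- The realization in barycentric coordinates is homeomorphic to the space of the complex. -/
noncomputable def realizationHomeomorph (hK : K.faces.Finite) (hvs : ∀ s ∈ K.faces, s ⊆ vs) :
    K.realization ≃ₜ K.space :=
  haveI : CompactSpace K.realization :=
    isCompact_iff_compactSpace.1 (PreAbstractSimplicialComplex.isCompact_realization hK)
  Continuous.homeoOfEquivCompactToT2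
    (f := Equiv.ofBijective
      (fun w : K.realization => (⟨toPoint vs w, toPoint_mem_space hvs w.2⟩ : K.space))
      ⟨fun w w' h => Subtype.ext (injOn_toPoint hvs w.2 w'.2 (congrArg Subtype.val h)),
        fun x => by
          obtain ⟨w, hw, h⟩ := image_toPoint_realization hvs x.2
          exact ⟨⟨w, hw⟩, Subtype.ext h⟩⟩)
    (((continuous_toPoint vs).comp continuous_subtype_val).subtype_mk _)

theorem realizationHomeomorph_apply (hK : K.faces.Finite) (hvs : ∀ s ∈ K.faces, s ⊆ vs)
    (w : K.realization) : (realizationHomeomorph hK hvs w : E) = toPoint vs w := rfl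

end Geometry.SimplicialComplex

/-! ### Barycentres of chains of simplices -/

section Chain

variable {ι : Type*}

open scoped Classical in
/-- The barycentric coordinates of the barycentre of `σ`. -/
noncomputable def baryWeight (σ : Finset ι) (v : ι) : ℝ := if v ∈ σ then (σ.card : ℝ)⁻¹ else 0

/-- The combination with coefficients `z` of the barycentres of the simplices in `C`. -/
noncomputable def chainWeight (C : Finset (Finset ι)) (z : Finset ι → ℝ) (v : ι) : ℝ :=
  ∑ σ ∈ C, z σ * baryWeight σ v

variable {C : Finset (Finset ι)} {z : Finset ι → ℝ} {σ : Finset ι} {v : ι}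

theorem baryWeight_of_mem (h : v ∈ σ) : baryWeight σ v = (σ.card : ℝ)⁻¹ := if_pos h

theorem baryWeight_of_notMem (h : v ∉ σ) : baryWeight σ v = 0 := if_neg h

theorem baryWeight_nonneg (σ : Finset ι) (v : ι) : 0 ≤ baryWeight σ v := by
  rw [baryWeight]
  split_ifs <;> positivity

theorem baryWeight_pos (h : v ∈ σ) : 0 < baryWeight σ v := by
  rw [baryWeight_of_mem h]
  have := Finset.card_pos.2 ⟨v, h⟩
  positivity

theorem baryWeight_le_of_mem {u : ι} (h : v ∈ σ) : baryWeight σ u ≤ baryWeight σ v := by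
  by_cases hu : u ∈ σ
  · rw [baryWeight_of_mem h, baryWeight_of_mem hu]
  · rw [baryWeight_of_notMem hu]
    exact baryWeight_nonneg _ _

theorem sum_baryWeight (hσ : σ.Nonempty) {s : Finset ι} (hs : σ ⊆ s) :
    ∑ v ∈ s, baryWeight σ v = 1 := by
  rw [← Finset.sum_subset hs fun v _ hv => baryWeight_of_notMem hv,
    Finset.sum_congr rfl fun v hv => baryWeight_of_mem hv, Finset.sum_const, nsmul_eq_mul]
  have := Finset.card_pos.2 hσ
  field_simp

theorem sum_chainWeight (hC : ∀ σ ∈ C, σ.Nonempty) {s : Finset ι} (hs : ∀ σ ∈ C, σ ⊆ s) :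
    ∑ v ∈ s, chainWeight C z v = ∑ σ ∈ C, z σ := by
  simp only [chainWeight]
  rw [Finset.sum_comm]
  refine Finset.sum_congr rfl fun σ hσ => ?_
  rw [← Finset.mul_sum, sum_baryWeight (hC σ hσ) (hs σ hσ), mul_one]

theorem chainWeight_eq_zero (h : ∀ σ ∈ C, v ∉ σ) : chainWeight C z v = 0 :=
  Finset.sum_eq_zero fun σ hσ => by rw [baryWeight_of_notMem (h σ hσ), mul_zero]

theorem chainWeight_nonneg (hz : ∀ σ ∈ C, 0 ≤ z σ) (v : ι) : 0 ≤ chainWeight C z v :=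
  Finset.sum_nonneg fun σ hσ => mul_nonneg (hz σ hσ) (baryWeight_nonneg σ v)

theorem chainWeight_filter_pos (hz : ∀ σ ∈ C, 0 ≤ z σ) :
    chainWeight (C.filter fun σ => 0 < z σ) z = chainWeight C z := by
  ext v
  refine Finset.sum_subset (Finset.filter_subset _ _) fun σ hσ h => ?_
  rw [le_antisymm (not_lt.1 fun hpos => h (Finset.mem_filter.2 ⟨hσ, hpos⟩)) (hz σ hσ), zero_mul]

/-- The elements of a finite nonempty chain lie in one of them. -/
theorem IsChain.exists_forall_subset (hC : IsChain (· ⊆ ·) (C : Set (Finset ι))) (hne : C.Nonempty) :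
    ∃ σ ∈ C, ∀ τ ∈ C, τ ⊆ σ := by
  obtain ⟨σ, hσ, hmax⟩ := C.exists_max_image Finset.card hne
  refine ⟨σ, hσ, fun τ hτ => ?_⟩
  rcases hC.total hτ hσ with h | h
  · exact h
  · rw [Finset.eq_of_subset_of_card_le h (hmax τ hτ)]

theorem IsChain.exists_subset_forall (hC : IsChain (· ⊆ ·) (C : Set (Finset ι))) (hne : C.Nonempty) :
    ∃ σ ∈ C, ∀ τ ∈ C, σ ⊆ τ := by
  obtain ⟨σ, hσ, hmin⟩ := C.exists_min_image Finset.card hne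
  refine ⟨σ, hσ, fun τ hτ => ?_⟩
  rcases hC.total hτ hσ with h | h
  · rw [Finset.eq_of_subset_of_card_le h (hmin τ hτ)]
  · exact h

/-- The barycentres of a chain are linearly independent in barycentric coordinates. -/
theorem eq_zero_of_chainWeight_eq_zero (hC : IsChain (· ⊆ ·) (C : Set (Finset ι)))
    (hne : ∀ σ ∈ C, σ.Nonempty) (h : ∀ v, chainWeight C z v = 0) : ∀ σ ∈ C, z σ = 0 := by
  classical
  by_contra! hcon
  obtain ⟨σ₀, hσ₀, hz₀⟩ := hcon
  set B := C.filter fun σ => z σ ≠ 0 with hB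
  have hBC : B ⊆ C := Finset.filter_subset _ _
  have hBchain : IsChain (· ⊆ ·) (B : Set (Finset ι)) := hC.mono (by exact_mod_cast hBC)
  obtain ⟨σ, hσ, hmax⟩ := hBchain.exists_forall_subset ⟨σ₀, Finset.mem_filter.2 ⟨hσ₀, hz₀⟩⟩
  -- A point of the largest simplex with nonzero coefficient that lies in no smaller one: its
  -- coordinate sees this coefficient alone.
  obtain ⟨v, hv, hvn⟩ : ∃ v ∈ σ, ∀ τ ∈ B, τ ≠ σ → v ∉ τ := by
    rcases (B.erase σ).eq_empty_or_nonempty with he | he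
    · obtain ⟨v, hv⟩ := hne σ (hBC hσ)
      refine ⟨v, hv, fun τ hτ hτσ => ?_⟩
      have : τ ∈ B.erase σ := Finset.mem_erase.2 ⟨hτσ, hτ⟩
      simp [he] at this
    · obtain ⟨ρ, hρ, hρmax⟩ := (hBchain.mono (t := (B : Set _))
        (s := ((B.erase σ : Finset (Finset ι)) : Set (Finset ι)))
        (by exact_mod_cast Finset.erase_subset σ B)).exists_forall_subset he
      obtain ⟨hρσ, hρB⟩ := Finset.mem_erase.1 hρ
      obtain ⟨v, hv, hvρ⟩ := Finset.exists_of_ssubset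
        ((hmax ρ hρB).ssubset_of_ne hρσ)
      exact ⟨v, hv, fun τ hτ hτσ hvτ => hvρ (hρmax τ (Finset.mem_erase.2 ⟨hτσ, hτ⟩) hvτ)⟩
  have h1 := h v
  rw [chainWeight, Finset.sum_eq_single_of_mem σ (hBC hσ)] at h1
  · rcases mul_eq_zero.1 h1 with h2 | h2
    · exact (Finset.mem_filter.1 hσ).2 h2
    · exact (baryWeight_pos hv).ne' h2
  · intro τ hτ hτσ
    by_cases hz : z τ = 0
    · rw [hz, zero_mul]
    · rw [baryWeight_of_notMem (hvn τ (Finset.mem_filter.2 ⟨hτ, hz⟩) hτσ), mul_zero]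

/-- A chain with positive coefficients is determined by the combination of its barycentres: it
consists of the superlevel sets. -/
theorem mem_iff_of_chainWeight (hC : IsChain (· ⊆ ·) (C : Set (Finset ι)))
    (hne : ∀ σ ∈ C, σ.Nonempty) (hz : ∀ σ ∈ C, 0 < z σ) :
    σ ∈ C ↔ σ.Nonempty ∧ ∃ r : ℝ, 0 < r ∧ ∀ v, v ∈ σ ↔ r ≤ chainWeight C z v := by
  classical
  -- `σ` is a superlevel set at the height of any of its points not lying in smaller elements
  have key : ∀ σ ∈ C, ∀ u, u ∉ σ → ∀ v ∈ σ, (∀ τ ∈ C, v ∈ τ → σ ⊆ τ) →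
      chainWeight C z u < chainWeight C z v := by
    intro σ hσ u hu v hv hvmin
    refine Finset.sum_lt_sum (fun τ hτ => mul_le_mul_of_nonneg_left ?_ (hz τ hτ).le)
      ⟨σ, hσ, mul_lt_mul_of_pos_left ?_ (hz σ hσ)⟩
    · by_cases hvτ : v ∈ τ
      · exact baryWeight_le_of_mem hvτ
      · have huτ : u ∉ τ := fun huτ => by
          rcases hC.total hτ hσ with h | h
          · exact hu (h huτ)
          · exact hvτ (h hv)
        rw [baryWeight_of_notMem huτ]
        exact baryWeight_nonneg _ _
    · rw [baryWeight_of_notMem hu]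
      exact baryWeight_pos hv
  have mono : ∀ σ ∈ C, ∀ u ∈ σ, ∀ v ∈ σ, (∀ τ ∈ C, v ∈ τ → σ ⊆ τ) →
      chainWeight C z v ≤ chainWeight C z u := by
    intro σ hσ u hu v hv hvmin
    refine Finset.sum_le_sum fun τ hτ => mul_le_mul_of_nonneg_left ?_ (hz τ hτ).le
    by_cases hvτ : v ∈ τ
    · exact baryWeight_le_of_mem (hvmin τ hτ hvτ hu)
    · rw [baryWeight_of_notMem hvτ]
      exact baryWeight_nonneg _ _
  have pos : ∀ σ ∈ C, ∀ v ∈ σ, 0 < chainWeight C z v := fun σ hσ v hv =>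
    Finset.sum_pos' (fun τ hτ => mul_nonneg (hz τ hτ).le (baryWeight_nonneg τ v))
      ⟨σ, hσ, mul_pos (hz σ hσ) (baryWeight_pos hv)⟩
  have hmin : ∀ σ ∈ C, ∃ v ∈ σ, ∀ u ∈ σ, chainWeight C z v ≤ chainWeight C z u := fun σ hσ =>
    σ.exists_min_image _ (hne σ hσ)
  -- the smallest element of the chain containing a given point
  have hleast : ∀ v, 0 < chainWeight C z v → ∃ σ ∈ C, v ∈ σ ∧ ∀ τ ∈ C, v ∈ τ → σ ⊆ τ := by
    intro v hv
    have hne' : (C.filter fun τ => v ∈ τ).Nonempty := by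
      by_contra hcon
      rw [Finset.not_nonempty_iff_eq_empty, Finset.filter_eq_empty_iff] at hcon
      exact hv.ne' (chainWeight_eq_zero fun σ hσ => hcon hσ)
    obtain ⟨σ, hσ, hσmin⟩ := (hC.mono (s := ((C.filter fun τ => v ∈ τ : Finset (Finset ι)) :
      Set (Finset ι))) (by exact_mod_cast Finset.filter_subset _ _)).exists_subset_forall hne'
    obtain ⟨hσC, hvσ⟩ := Finset.mem_filter.1 hσ
    exact ⟨σ, hσC, hvσ, fun τ hτ hvτ => hσmin τ (Finset.mem_filter.2 ⟨hτ, hvτ⟩)⟩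
  have superlevel : ∀ σ ∈ C, ∀ v ∈ σ, (∀ τ ∈ C, v ∈ τ → σ ⊆ τ) →
      ∀ u, u ∈ σ ↔ chainWeight C z v ≤ chainWeight C z u := fun σ hσ v hv hvmin u =>
    ⟨fun hu => mono σ hσ u hu v hv hvmin, fun hle => by
      by_contra hu
      exact (key σ hσ u hu v hv hvmin).not_ge hle⟩
  constructor
  · intro hσ
    refine ⟨hne σ hσ, ?_⟩
    obtain ⟨v, hv, hvle⟩ := hmin σ hσ
    obtain ⟨ρ, hρ, hvρ, hρmin⟩ := hleast v (pos σ hσ v hv)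
    have hρσ : ρ = σ := by
      refine (hρmin σ hσ hv).antisymm fun u hu => ?_
      exact (superlevel ρ hρ v hvρ hρmin u).2 (hvle u hu)
    subst hρσ
    exact ⟨chainWeight C z v, pos ρ hρ v hv, superlevel ρ hρ v hv hρmin⟩
  · rintro ⟨hσ, r, hr, hσr⟩
    obtain ⟨v, hv, hvle⟩ := σ.exists_min_image (chainWeight C z) hσ
    have hvpos := hr.trans_le ((hσr v).1 hv)
    obtain ⟨ρ, hρ, hvρ, hρmin⟩ := hleast v hvpos
    have : σ = ρ := by
      ext u
      rw [superlevel ρ hρ v hvρ hρmin u]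
      exact ⟨fun hu => hvle u hu, fun hu => (hσr u).2 (((hσr v).1 hv).trans hu)⟩
    rwa [this]

/-- Every finitely supported nonnegative function is a combination with nonnegative coefficients of
the barycentres of a chain, all of whose elements contain the points where the function is
maximal. -/
theorem exists_chainWeight_eq (n : ℕ) : ∀ (T : Finset ι) (w : ι → ℝ), T.card = n → T.Nonempty →
    (∀ v, 0 ≤ w v) → (∀ v, v ∈ T ↔ 0 < w v) →
    ∃ (C : Finset (Finset ι)) (z : Finset ι → ℝ), C.Nonempty ∧
      IsChain (· ⊆ ·) (C : Set (Finset ι)) ∧ (∀ σ ∈ C, σ ⊆ T) ∧ (∀ σ ∈ C, 0 ≤ z σ) ∧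
      (∀ v, w v = chainWeight C z v) ∧ ∀ σ ∈ C, ∀ v, (∀ u, w u ≤ w v) → v ∈ σ := by
  classical
  induction n using Nat.strong_induction_on with
  | _ n ih =>
  intro T w hTn hT hw hTw
  obtain ⟨a, ha, hamin⟩ := T.exists_min_image w hT
  have hapos := (hTw a).1 ha
  have hcard : (T.card : ℝ) ≠ 0 := by
    have := Finset.card_pos.2 hT
    positivity
  have hcoef : 0 ≤ w a * T.card := mul_nonneg hapos.le (Nat.cast_nonneg _)
  have hmaxT : ∀ v, (∀ u, w u ≤ w v) → v ∈ T := fun v hv => (hTw v).2 (hapos.trans_le (hv a))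
  set w' : ι → ℝ := fun v => if v ∈ T then w v - w a else 0 with hw'
  have hw'T : ∀ v ∈ T, w' v = w v - w a := fun v hv => if_pos hv
  have hw'n : ∀ v ∉ T, w' v = 0 := fun v hv => if_neg hv
  have hwn : ∀ v ∉ T, w v = 0 := fun v hv =>
    le_antisymm (not_lt.1 fun h => hv ((hTw v).2 h)) (hw v)
  have hw'0 : ∀ v, 0 ≤ w' v := fun v => by
    by_cases hv : v ∈ T
    · rw [hw'T v hv]; exact sub_nonneg.2 (hamin v hv)
    · rw [hw'n v hv]
  set T' := T.filter fun v => 0 < w' v with hT'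
  have hT'T : T' ⊆ T := Finset.filter_subset _ _
  have haT' : a ∉ T' := fun h => by
    have := (Finset.mem_filter.1 h).2
    rw [hw'T a ha, sub_self] at this
    exact lt_irrefl _ this
  have hlt : T'.card < n := by
    rw [← hTn]
    exact Finset.card_lt_card (Finset.ssubset_iff_subset_ne.2 ⟨hT'T, fun h => haT' (h ▸ ha)⟩)
  have hstep : ∀ v, w v = w a * T.card * baryWeight T v + w' v := fun v => by
    by_cases hv : v ∈ T
    · rw [hw'T v hv, baryWeight_of_mem hv]
      field_simp
      ring
    · rw [hw'n v hv, hwn v hv, baryWeight_of_notMem hv]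
      ring
  rcases T'.eq_empty_or_nonempty with hempty | hne
  · refine ⟨{T}, fun _ => w a * T.card, Finset.singleton_nonempty T, ?_,
      fun σ hσ => (Finset.mem_singleton.1 hσ).subset, fun _ _ => hcoef, fun v => ?_, fun σ hσ v hv => ?_⟩
    · rw [Finset.coe_singleton]
      exact IsChain.singleton
    · have : w' v = 0 := by
        by_contra hne
        have hv : v ∈ T := by
          by_contra h
          exact hne (hw'n v h)
        have : v ∈ T' := Finset.mem_filter.2 ⟨hv, lt_of_le_of_ne (hw'0 v) (Ne.symm hne)⟩
        rw [hempty] at this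
        exact Finset.notMem_empty _ this
      rw [hstep v, this, chainWeight, Finset.sum_singleton, add_zero]
    · rw [Finset.mem_singleton.1 hσ]
      exact hmaxT v hv
  · obtain ⟨C, z, hC0, hCc, hCT, hz, hwC, hmax⟩ := ih _ hlt T' w' rfl hne hw'0 fun v =>
      ⟨fun h => (Finset.mem_filter.1 h).2, fun h => Finset.mem_filter.2 ⟨by
        by_contra hv
        exact h.ne' (hw'n v hv), h⟩⟩
    have hTC : T ∉ C := fun h => haT' (hCT T h ha)
    have hneT : ∀ σ ∈ C, σ ≠ T := fun σ hσ h => hTC (h ▸ hσ)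
    refine ⟨insert T C, fun σ => if σ = T then w a * T.card else z σ, Finset.insert_nonempty _ _,
      ?_, fun σ hσ => ?_, fun σ hσ => ?_, fun v => ?_, fun σ hσ v hv => ?_⟩
    · rw [Finset.coe_insert]
      exact hCc.insert fun σ hσ _ => Or.inr ((hCT σ hσ).trans hT'T)
    · rcases Finset.mem_insert.1 hσ with rfl | h
      exacts [subset_rfl, (hCT σ h).trans hT'T]
    · dsimp only
      split_ifs with h
      · exact hcoef
      · exact hz σ (Finset.mem_of_mem_insert_of_ne hσ h)
    · rw [chainWeight, Finset.sum_insert hTC, if_pos rfl, hstep v, hwC v, chainWeight]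
      congr 1
      exact Finset.sum_congr rfl fun σ hσ => by rw [if_neg (hneT σ hσ)]
    · rcases Finset.mem_insert.1 hσ with rfl | h
      · exact hmaxT v hv
      · refine hmax σ h v fun u => ?_
        by_cases hu : u ∈ T
        · rw [hw'T u hu, hw'T v (hmaxT v hv)]
          linarith [hv u]
        · rw [hw'n u hu]
          exact hw'0 v

end Chain

/-! ### The dual complex as a geometric simplicial complex -/

namespace Geometry.SimplicialComplex

open PreAbstractSimplicialComplex

variable {E : Type*} [AddCommGroup E] [Module ℝ E]

/-- A nonempty chain of faces with at least `q` vertices each. -/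
structure IsFaceChain (K : SimplicialComplex ℝ E) (q : ℕ) (C : Finset (Finset E)) : Prop where
  nonempty : C.Nonempty
  mem_faces : ∀ σ ∈ C, σ ∈ K.faces
  isChain : IsChain (· ⊆ ·) (C : Set (Finset E))
  le_card : ∀ σ ∈ C, q ≤ σ.card

variable {K : SimplicialComplex ℝ E} {vs σ τ : Finset E} {C C' : Finset (Finset E)}
  {z : Finset E → ℝ} {q : ℕ}

theorem IsFaceChain.subset (h : K.IsFaceChain q C) (hC : C' ⊆ C) (hne : C'.Nonempty) :
    K.IsFaceChain q C' :=
  ⟨hne, fun σ hσ => h.mem_faces σ (hC hσ), h.isChain.mono (by exact_mod_cast hC),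
    fun σ hσ => h.le_card σ (hC hσ)⟩

theorem IsFaceChain.nonempty_of_mem (h : K.IsFaceChain q C) (hσ : σ ∈ C) : σ.Nonempty :=
  nonempty_of_mem_faces (h.mem_faces σ hσ)

theorem IsFaceChain.exists_top (h : K.IsFaceChain q C) : ∃ σ ∈ C, ∀ τ ∈ C, τ ⊆ σ :=
  h.isChain.exists_forall_subset h.nonempty

open scoped Classical in
-- A simplex of the subdivision lies in the dual cell of the smallest face of its chain, so a bound
-- on the cell is a lower bound on the number of vertices of all faces in the chain.
theorem mem_dualSkeleton_iff (hK : K.faces.Finite) {d p : ℕ} (hq : ∀ c : ℕ, d + 1 ≤ p + c ↔ q ≤ c)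
    {u : Finset E} : u ∈ K.dualSkeleton d p ↔
      ∃ C, K.IsFaceChain q C ∧ u = C.image fun t : Finset E => t.centroid ℝ id := by
  simp only [dualSkeleton, dualCell, mem_iUnion, mem_ofPred_eq, exists_prop]
  constructor
  · rintro ⟨s, ⟨hs, hsq⟩, c, hc0, hcK, hc, hcs, hu⟩
    have hfin := hK.subset hcK
    refine ⟨hfin.toFinset, ⟨by simpa using hc0, fun σ hσ => hcK (hfin.mem_toFinset.1 hσ), by simpa,
      fun σ hσ => ((hq _).1 hsq).trans (Finset.card_le_card (hcs σ (hfin.mem_toFinset.1 hσ)))⟩, ?_⟩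
    rw [← Finset.coe_inj, hu]
    simp
  · rintro ⟨C, hC, hu⟩
    obtain ⟨s, hs, hsC⟩ := hC.isChain.exists_subset_forall hC.nonempty
    exact ⟨s, ⟨hC.mem_faces s hs, (hq _).2 (hC.le_card s hs)⟩, C, hC.nonempty,
      fun σ hσ => hC.mem_faces σ hσ, hC.isChain, hsC, by rw [hu, Finset.coe_image]⟩

theorem centroid_eq_toPoint (hσ : σ.Nonempty) (hvs : σ ⊆ vs) :
    σ.centroid ℝ id = toPoint vs (baryWeight σ) := by
  rw [toPoint_eq_sum hvs fun v hv => baryWeight_of_notMem hv, Finset.centroid_def,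
    Finset.affineCombination_eq_linear_combination _ _ _
      (σ.sum_centroidWeights_eq_one_of_nonempty ℝ hσ)]
  exact Finset.sum_congr rfl fun v hv => by
    rw [Finset.centroidWeights_apply, baryWeight_of_mem hv, id]

theorem toPoint_chainWeight (hC : ∀ σ ∈ C, σ.Nonempty) (hvs : ∀ σ ∈ C, σ ⊆ vs) :
    toPoint vs (chainWeight C z) = ∑ σ ∈ C, z σ • σ.centroid ℝ id := by
  simp only [toPoint, chainWeight, Finset.sum_smul]
  rw [Finset.sum_comm]
  refine Finset.sum_congr rfl fun σ hσ => ?_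
  rw [centroid_eq_toPoint (hC σ hσ) (hvs σ hσ), toPoint, Finset.smul_sum]
  simp only [mul_smul]

theorem baryWeight_mem_realization (hσ : σ ∈ K.faces) : baryWeight σ ∈ K.realization :=
  ⟨baryWeight_nonneg σ, σ, hσ, fun _ => baryWeight_of_notMem,
    sum_baryWeight (nonempty_of_mem_faces hσ) subset_rfl⟩

theorem injOn_centroid (hvs : ∀ s ∈ K.faces, s ⊆ vs) :
    InjOn (fun t : Finset E => t.centroid ℝ id) K.faces := by
  intro σ hσ τ hτ h
  dsimp only at h
  rw [centroid_eq_toPoint (nonempty_of_mem_faces hσ) (hvs σ hσ),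
    centroid_eq_toPoint (nonempty_of_mem_faces hτ) (hvs τ hτ)] at h
  have h' := injOn_toPoint hvs (baryWeight_mem_realization hσ) (baryWeight_mem_realization hτ) h
  ext v
  have hiff : ∀ s : Finset E, v ∈ s ↔ 0 < baryWeight s v := fun s =>
    ⟨baryWeight_pos, fun hpos => by
      by_contra hv
      exact hpos.ne' (baryWeight_of_notMem hv)⟩
  rw [hiff, hiff, h']

theorem IsFaceChain.chainWeight_mem_realization (hC : K.IsFaceChain q C) (hz : ∀ σ ∈ C, 0 ≤ z σ)
    (hz1 : ∑ σ ∈ C, z σ = 1) : chainWeight C z ∈ K.realization := by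
  obtain ⟨T, hT, hCT⟩ := hC.exists_top
  refine ⟨chainWeight_nonneg hz, T, hC.mem_faces T hT,
    fun v hv => chainWeight_eq_zero fun σ hσ h => hv (hCT σ hσ h), ?_⟩
  rw [sum_chainWeight (fun σ => hC.nonempty_of_mem) hCT, hz1]

open scoped Classical in
theorem IsFaceChain.mem_convexHull_iff (hvs : ∀ s ∈ K.faces, s ⊆ vs) (hC : K.IsFaceChain q C)
    {x : E} : x ∈ convexHull ℝ ((C.image fun t : Finset E => t.centroid ℝ id : Finset E) : Set E) ↔
      ∃ z : Finset E → ℝ, (∀ σ ∈ C, 0 ≤ z σ) ∧ ∑ σ ∈ C, z σ = 1 ∧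
        toPoint vs (chainWeight C z) = x := by
  have hinj : InjOn (fun t : Finset E => t.centroid ℝ id) C :=
    (injOn_centroid hvs).mono fun σ hσ => hC.mem_faces σ hσ
  have htp : ∀ z, toPoint vs (chainWeight C z) = ∑ σ ∈ C, z σ • σ.centroid ℝ id := fun z =>
    toPoint_chainWeight (fun σ => hC.nonempty_of_mem) fun σ hσ => hvs σ (hC.mem_faces σ hσ)
  rw [Finset.mem_convexHull']
  constructor
  · rintro ⟨y, hy0, hy1, hyx⟩
    rw [Finset.sum_image hinj] at hy1 hyx
    exact ⟨fun σ => y (σ.centroid ℝ id), fun σ hσ => hy0 _ (Finset.mem_image_of_mem _ hσ), hy1,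
      (htp _).trans hyx⟩
  · rintro ⟨z, hz0, hz1, hzx⟩
    have hinv : ∀ σ ∈ C, z (Function.invFunOn (fun t : Finset E => t.centroid ℝ id) C
        (σ.centroid ℝ id)) = z σ := fun σ hσ =>
      congrArg z (hinj.leftInvOn_invFunOn hσ)
    refine ⟨fun e => z (Function.invFunOn (fun t : Finset E => t.centroid ℝ id) C e),
      fun e he => ?_, ?_, ?_⟩
    · obtain ⟨σ, hσ, rfl⟩ := Finset.mem_image.1 he
      dsimp only
      rw [hinv σ hσ]
      exact hz0 σ hσ
    · rw [Finset.sum_image hinj, ← hz1]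
      exact Finset.sum_congr rfl hinv
    · rw [Finset.sum_image hinj, ← hzx, htp]
      exact Finset.sum_congr rfl fun σ hσ => congrArg (· • σ.centroid ℝ id) (hinv σ hσ)

open scoped Classical in
-- All barycentres lie in the largest face `T` of the chain. A relation between them is one between
-- the vertices of `T`, hence trivial in coordinates, and barycentres of a chain are linearly
-- independent there.
theorem IsFaceChain.affineIndependent (hvs : ∀ s ∈ K.faces, s ⊆ vs) (hC : K.IsFaceChain q C) :
    AffineIndependent ℝ
      ((↑) : (C.image fun t : Finset E => t.centroid ℝ id : Finset E) → E) := by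
  have hfam : AffineIndependent ℝ fun σ : C => (σ : Finset E).centroid ℝ id := by
    rw [affineIndependent_iff]
    intro s w hw0 hw σ hσ
    have hsub : s.map (Function.Embedding.subtype _) ⊆ C := fun τ hτ => by
      obtain ⟨ρ, -, rfl⟩ := Finset.mem_map.1 hτ
      exact ρ.2
    have hC' := hC.subset hsub ((Finset.map_nonempty).2 ⟨σ, hσ⟩)
    obtain ⟨T, hT, hCT⟩ := hC'.exists_top
    set y : Finset E → ℝ := Function.extend Subtype.val w 0 with hy
    have hyw : ∀ τ : C, y τ = w τ := fun τ => Subtype.val_injective.extend_apply w 0 τ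
    have h0 : ∀ v ∉ T, chainWeight (s.map (Function.Embedding.subtype _)) y v = 0 := fun v hv =>
      chainWeight_eq_zero fun τ hτ h => hv (hCT τ hτ h)
    have h1 := (K.indep (hC'.mem_faces T hT)).eq_zero_of_sum_smul_eq_zero
      (w := chainWeight (s.map (Function.Embedding.subtype _)) y) (by
        rw [sum_chainWeight (fun σ => hC'.nonempty_of_mem) hCT, Finset.sum_map, ← hw0]
        exact Finset.sum_congr rfl fun τ _ => hyw τ) (by
        rw [← toPoint_eq_sum (hvs T (hC'.mem_faces T hT)) h0,
          toPoint_chainWeight (fun σ => hC'.nonempty_of_mem)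
            fun σ hσ => hvs σ (hC'.mem_faces σ hσ), Finset.sum_map, ← hw]
        exact Finset.sum_congr rfl fun τ _ => congrArg (· • _) (hyw τ))
    have h2 := eq_zero_of_chainWeight_eq_zero hC'.isChain (fun σ => hC'.nonempty_of_mem)
      (z := y) fun v => by
        by_cases hv : v ∈ T
        exacts [h1 v hv, h0 v hv]
    rw [← hyw]
    exact h2 σ (Finset.mem_map_of_mem _ hσ)
  have hrange : (range fun σ : C => (σ : Finset E).centroid ℝ id) =
      ((C.image fun t : Finset E => t.centroid ℝ id : Finset E) : Set E) := by
    ext x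
    simp
  have := hfam.range
  rwa [hrange] at this

theorem IsFaceChain.filter_pos (hC : K.IsFaceChain q C) (hz : ∀ σ ∈ C, 0 ≤ z σ)
    (hz1 : ∑ σ ∈ C, z σ = 1) : K.IsFaceChain q (C.filter fun σ => 0 < z σ) := by
  refine hC.subset (Finset.filter_subset _ _) ?_
  by_contra hne
  rw [Finset.not_nonempty_iff_eq_empty, Finset.filter_eq_empty_iff] at hne
  rw [Finset.sum_eq_zero fun σ hσ => le_antisymm (not_lt.1 (hne hσ)) (hz σ hσ)] at hz1
  exact zero_ne_one hz1

open scoped Classical in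
-- The faces with positive coefficient are the superlevel sets of the barycentric coordinates of the
-- point. Two representations of one point therefore use the same subchain, which lies in both
-- chains.
theorem IsFaceChain.inter_subset_convexHull (hvs : ∀ s ∈ K.faces, s ⊆ vs)
    (hC : K.IsFaceChain q C) (hC' : K.IsFaceChain q C') :
    convexHull ℝ ((C.image fun t : Finset E => t.centroid ℝ id : Finset E) : Set E) ∩
      convexHull ℝ ((C'.image fun t : Finset E => t.centroid ℝ id : Finset E) : Set E) ⊆
    convexHull ℝ (((C.image fun t : Finset E => t.centroid ℝ id : Finset E) : Set E) ∩
      ((C'.image fun t : Finset E => t.centroid ℝ id : Finset E) : Set E)) := by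
  rintro x ⟨hx, hx'⟩
  obtain ⟨z, hz, hz1, rfl⟩ := (hC.mem_convexHull_iff hvs).1 hx
  obtain ⟨z', hz', hz1', heq⟩ := (hC'.mem_convexHull_iff hvs).1 hx'
  have hw : chainWeight C' z' = chainWeight C z := injOn_toPoint hvs
    (hC'.chainWeight_mem_realization hz' hz1') (hC.chainWeight_mem_realization hz hz1) heq
  have hB := hC.filter_pos hz hz1
  have hB' := hC'.filter_pos hz' hz1'
  have hBB' : (C.filter fun σ => 0 < z σ) = C'.filter fun σ => 0 < z' σ := by
    ext σ
    rw [mem_iff_of_chainWeight (z := z) hB.isChain (fun σ => hB.nonempty_of_mem)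
        fun σ hσ => (Finset.mem_filter.1 hσ).2,
      mem_iff_of_chainWeight (z := z') hB'.isChain (fun σ => hB'.nonempty_of_mem)
        fun σ hσ => (Finset.mem_filter.1 hσ).2, chainWeight_filter_pos hz,
      chainWeight_filter_pos hz', hw]
  refine convexHull_mono (s := (((C.filter fun σ => 0 < z σ).image
    fun t : Finset E => t.centroid ℝ id : Finset E) : Set E)) ?_ ?_
  · refine subset_inter ?_ ?_
    · exact_mod_cast Finset.image_subset_image (Finset.filter_subset _ _)
    · rw [hBB']
      exact_mod_cast Finset.image_subset_image (Finset.filter_subset _ _)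
  · refine (hB.mem_convexHull_iff hvs).2 ⟨z, fun σ hσ => hz σ (Finset.mem_filter.1 hσ).1, ?_,
      by rw [chainWeight_filter_pos hz]⟩
    rw [← hz1]
    refine Finset.sum_subset (Finset.filter_subset _ _) fun σ hσ h => ?_
    exact le_antisymm (not_lt.1 fun hpos => h (Finset.mem_filter.2 ⟨hσ, hpos⟩)) (hz σ hσ)

open scoped Classical in
/-- The subcomplex of the barycentric subdivision that is spanned by the barycentres of the faces
with at least `q` vertices. -/
noncomputable def dualComplex (hvs : ∀ s ∈ K.faces, s ⊆ vs) (q : ℕ) : SimplicialComplex ℝ E where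
  faces := {u | ∃ C, K.IsFaceChain q C ∧ u = C.image fun t : Finset E => t.centroid ℝ id}
  isRelLowerSet_faces := by
    rintro _ ⟨C, hC, rfl⟩
    refine ⟨hC.nonempty.image _, fun u hu hne => ?_⟩
    obtain ⟨B, hB, rfl⟩ := Finset.subset_image_iff.1 hu
    exact ⟨B, hC.subset hB (Finset.image_nonempty.1 hne), rfl⟩
  indep := by
    rintro _ ⟨C, hC, rfl⟩
    exact hC.affineIndependent hvs
  inter_subset_convexHull := by
    rintro _ _ ⟨C, hC, rfl⟩ ⟨C', hC', rfl⟩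
    exact hC.inter_subset_convexHull hvs hC'

/-- On the smallest face of a chain all coordinates of a combination are maximal. Conversely, in the
decomposition of `exists_chainWeight_eq` every face contains the points where `w` is maximal, hence
at least `k + 2` vertices. -/
theorem space_dualComplex (hvs : ∀ s ∈ K.faces, s ⊆ vs) (k : ℕ) :
    (dualComplex hvs (k + 2)).space = toPoint vs '' K.dualRealization k := by
  classical
  ext x
  rw [mem_space_iff]
  constructor
  · rintro ⟨_, ⟨C, hC, rfl⟩, hx⟩
    obtain ⟨z, hz, hz1, rfl⟩ := (hC.mem_convexHull_iff hvs).1 hx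
    refine ⟨_, ⟨hC.chainWeight_mem_realization hz hz1, ?_⟩, rfl⟩
    obtain ⟨s, hs, hsC⟩ := hC.isChain.exists_subset_forall hC.nonempty
    obtain ⟨t, hts, htc⟩ := Finset.exists_subset_card_eq (hC.le_card s hs)
    exact ⟨t, htc, fun v hv u => Finset.sum_le_sum fun σ hσ =>
      mul_le_mul_of_nonneg_left (baryWeight_le_of_mem (hsC σ hσ (hts hv))) (hz σ hσ)⟩
  · rintro ⟨w, ⟨hw, t, htc, ht⟩, rfl⟩
    obtain ⟨h0, s, hs, hs0, hs1⟩ := id hw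
    have hTw : ∀ v, v ∈ s.filter (fun v => 0 < w v) ↔ 0 < w v := fun v => by
      rw [Finset.mem_filter, and_iff_right_iff_imp]
      intro hpos
      by_contra hv
      exact hpos.ne' (hs0 v hv)
    have hne : (s.filter fun v => 0 < w v).Nonempty := by
      by_contra hne
      rw [Finset.not_nonempty_iff_eq_empty, Finset.filter_eq_empty_iff] at hne
      rw [Finset.sum_eq_zero fun v hv => le_antisymm (not_lt.1 (hne hv)) (h0 v)] at hs1
      exact zero_ne_one hs1
    obtain ⟨C, z, hC0, hCc, hCT, hz, hwC, hmax⟩ := exists_chainWeight_eq _ _ w rfl hne h0 hTw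
    have htC : ∀ σ ∈ C, t ⊆ σ := fun σ hσ v hv => hmax σ hσ v (ht v hv)
    have htne : t.Nonempty := Finset.card_pos.1 (by omega)
    have hCs : ∀ σ ∈ C, σ ⊆ s := fun σ hσ => (hCT σ hσ).trans (Finset.filter_subset _ _)
    have hC : K.IsFaceChain (k + 2) C := ⟨hC0, fun σ hσ => K.down_closed hs (hCs σ hσ)
      (htne.mono (htC σ hσ)), hCc, fun σ hσ => htc ▸ Finset.card_le_card (htC σ hσ)⟩
    have hwC' : w = chainWeight C z := funext hwC
    refine ⟨_, ⟨C, hC, rfl⟩, (hC.mem_convexHull_iff hvs).2 ⟨z, hz, ?_, by rw [hwC']⟩⟩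
    rw [← sum_chainWeight (fun σ => hC.nonempty_of_mem) hCs, ← hwC', hs1]

end Geometry.SimplicialComplex

/-! ### Dimension of the triangulation -/

namespace SmoothTriangulation

variable {d N : ℕ} {M : Type*} [TopologicalSpace M] [ChartedSpace (EuclideanSpace ℝ (Fin d)) M]
  {s : Finset (EuclideanSpace ℝ (Fin N))}

theorem finrank_vectorSpan_add_one (K : SmoothTriangulation d N M) (hs : s ∈ K.complex.faces) :
    Module.finrank ℝ (vectorSpan ℝ (s : Set (EuclideanSpace ℝ (Fin N)))) + 1 = s.card := by
  have hne : Nonempty s := (K.complex.nonempty_of_mem_faces hs).to_subtype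
  have h := (K.complex.indep hs).finrank_vectorSpan_add_one
  have hrange : range (fun x : s => (x : EuclideanSpace ℝ (Fin N))) = s := Subtype.range_coe
  rw [← Fintype.card_coe s, ← h]
  exact congrArg (fun S => Module.finrank ℝ (vectorSpan ℝ S) + 1) hrange.symm

/-- The differential at a vertex embeds the direction space of the simplex in a tangent space of
dimension `d`. -/
theorem card_le (K : SmoothTriangulation d N M) (hs : s ∈ K.complex.faces) : s.card ≤ d + 1 := by
  obtain ⟨x, hx⟩ := K.complex.nonempty_of_mem_faces hs
  have hxs : x ∈ convexHull ℝ (s : Set (EuclideanSpace ℝ (Fin N))) := subset_convexHull ℝ _ hx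
  let D : EuclideanSpace ℝ (Fin N) →ₗ[ℝ] EuclideanSpace ℝ (Fin d) :=
    (mfderivWithin 𝓘(ℝ, EuclideanSpace ℝ (Fin N)) (𝓡 d) K.toFun
      (convexHull ℝ (s : Set (EuclideanSpace ℝ (Fin N)))) x).toLinearMap
  have hinj : Function.Injective
      (D.comp (vectorSpan ℝ (s : Set (EuclideanSpace ℝ (Fin N)))).subtype) := by
    refine (injective_iff_map_eq_zero _).2 fun v hv => Subtype.ext ?_
    exact K.injective_mfderiv s hs x hxs v v.2 hv
  have h := LinearMap.finrank_le_finrank_of_injective hinj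
  rw [finrank_euclideanSpace_fin] at h
  have := K.finrank_vectorSpan_add_one hs
  omega

/-- A `C^1` map on a convex set is locally Lipschitz and so does not raise the Hausdorff dimension,
which for a simplex is the rank of its direction space. -/
theorem dimH_chart_image_simplex_le [IsManifold (𝓡 d) ∞ M] (K : SmoothTriangulation d N M)
    (hs : s ∈ K.complex.faces) (p : M) :
    dimH (extChartAt (𝓡 d) p '' ((extChartAt (𝓡 d) p).source ∩ K.simplex s)) ≤
      (s.card - 1 : ℕ) := by
  set S := convexHull ℝ (s : Set (EuclideanSpace ℝ (Fin N))) with hS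
  have himage : extChartAt (𝓡 d) p '' ((extChartAt (𝓡 d) p).source ∩ K.simplex s) =
      (extChartAt (𝓡 d) p ∘ K.toFun) '' (S ∩ K.toFun ⁻¹' (extChartAt (𝓡 d) p).source) := by
    rw [image_comp, simplex, inter_comm, ← image_inter_preimage]
  rw [himage]
  refine (dimH_image_le_of_locally_lipschitzOn fun x hx => ?_).trans
    ((dimH_mono inter_subset_left).trans ?_)
  · have h1 : ContMDiffAt (𝓡 d) 𝓘(ℝ, EuclideanSpace ℝ (Fin d)) ∞ (extChartAt (𝓡 d) p)
        (K.toFun x) := contMDiffAt_extChartAt' (by simpa [extChartAt_source] using hx.2)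
    have h2 := (h1.comp_contMDiffWithinAt x (K.contMDiffOn s hs x hx.1)).contDiffWithinAt
    obtain ⟨C, t, ht, hC⟩ := (h2.of_le (m := 1) (by simp)).exists_lipschitzOnWith
      (convex_convexHull ℝ _)
    exact ⟨C, t, nhdsWithin_mono x inter_subset_left ht, hC⟩
  · rw [Real.Convex.dimH_eq_finrank_vectorSpan (convex_convexHull ℝ _)
      ((K.complex.nonempty_of_mem_faces hs).to_set.convexHull)]
    have h3 : vectorSpan ℝ S = vectorSpan ℝ (s : Set (EuclideanSpace ℝ (Fin N))) := by
      rw [← direction_affineSpan, hS, affineSpan_convexHull, direction_affineSpan]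
    rw [← K.finrank_vectorSpan_add_one hs, Nat.add_sub_cancel]
    exact_mod_cast (congrArg
      (fun V : Submodule ℝ (EuclideanSpace ℝ (Fin N)) => Module.finrank ℝ V) h3).le

/-- Otherwise finitely many sets of Hausdorff dimension at most `d - 1` would cover a chart target,
which has dimension `d`. -/
theorem exists_card_eq [IsManifold (𝓡 d) ∞ M] [Nonempty M] (K : SmoothTriangulation d N M) :
    ∃ s ∈ K.complex.faces, s.card = d + 1 := by
  by_contra! hcon
  obtain ⟨p⟩ := ‹Nonempty M›
  have hle : ∀ s ∈ K.complex.faces, s.card - 1 + 1 ≤ d := fun s hs => by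
    have h1 := hcon s hs
    have h2 := K.card_le hs
    have h3 := Finset.card_pos.2 (K.complex.nonempty_of_mem_faces hs)
    omega
  have hcover : (extChartAt (𝓡 d) p).target =
      ⋃ s ∈ K.complex.faces,
        extChartAt (𝓡 d) p '' ((extChartAt (𝓡 d) p).source ∩ K.simplex s) := by
    rw [← (extChartAt (𝓡 d) p).image_source_eq_target, ← image_iUnion₂, ← inter_iUnion₂]
    congr 1
    refine (inter_eq_left.2 fun q _ => ?_).symm
    obtain ⟨⟨x, hx⟩, rfl⟩ := K.isHomeomorph.surjective q
    obtain ⟨s, hs, hxs⟩ := K.complex.mem_space_iff.1 hx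
    exact mem_iUnion₂.2 ⟨s, hs, x, hxs, rfl⟩
  have h1 : dimH (extChartAt (𝓡 d) p).target = d := by
    rw [Real.dimH_of_mem_nhds (extChartAt_target_mem_nhds p), finrank_euclideanSpace_fin]
  rw [hcover, dimH_bUnion K.finite_faces.countable] at h1
  obtain ⟨x, hx⟩ : K.complex.faces.Nonempty := by
    obtain ⟨⟨x, hx⟩, -⟩ := K.isHomeomorph.surjective p
    obtain ⟨s, hs, -⟩ := K.complex.mem_space_iff.1 hx
    exact ⟨s, hs⟩
  have hd := hle x hx
  have h2 : (d : ENNReal) ≤ ((d - 1 : ℕ) : ENNReal) := by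
    rw [← h1]
    refine iSup₂_le fun s hs => (K.dimH_chart_image_simplex_le hs p).trans ?_
    have := hle s hs
    exact_mod_cast (by omega : s.card - 1 ≤ d - 1)
  have h3 : d ≤ d - 1 := by exact_mod_cast h2
  omega

end SmoothTriangulation

/-! ### Dimension of the dual complex -/

namespace Geometry.SimplicialComplex

variable {E : Type*} [AddCommGroup E] [Module ℝ E] {K : SimplicialComplex ℝ E} {vs : Finset E}

/-- Cardinality is injective on a chain, with values between `q` and `r`. -/
theorem IsFaceChain.card_le {q r : ℕ} {C : Finset (Finset E)} (hC : K.IsFaceChain q C)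
    (hr : ∀ s ∈ K.faces, s.card ≤ r) : C.card ≤ r + 1 - q := by
  rw [← Nat.card_Icc]
  refine Finset.card_le_card_of_injOn Finset.card (fun σ hσ => ?_) fun σ hσ τ hτ h => ?_
  · exact Finset.mem_coe.2 (Finset.mem_Icc.2 ⟨hC.le_card σ hσ, hr σ (hC.mem_faces σ hσ)⟩)
  · rcases hC.isChain.total hσ hτ with h1 | h1
    · exact Finset.eq_of_subset_of_card_le h1 h.ge
    · exact (Finset.eq_of_subset_of_card_le h1 h.le).symm

theorem exists_isFaceChain_card_eq {T : Finset E} (hT : T ∈ K.faces) {q : ℕ} (hq : 0 < q)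
    (hqT : q ≤ T.card) : ∃ C, K.IsFaceChain q C ∧ C.card = T.card + 1 - q := by
  classical
  -- A full flag of faces of `T`: the first `i` vertices in some enumeration.
  set f : ℕ → Finset E := fun i => (T.toList.take i).toFinset with hf
  have hcard : ∀ i ≤ T.card, (f i).card = i := fun i hi => by
    rw [hf, List.toFinset_card_of_nodup ((List.take_sublist i _).nodup T.nodup_toList),
      List.length_take, Finset.length_toList, min_eq_left hi]
  have hmono : ∀ i j, i ≤ j → f i ⊆ f j := fun i j hij x hx =>
    List.mem_toFinset.2 ((List.take_subset_take_left _ hij) (List.mem_toFinset.1 hx))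
  have hsub : ∀ i, f i ⊆ T := fun i x hx =>
    Finset.mem_toList.1 (List.mem_of_mem_take (List.mem_toFinset.1 hx))
  refine ⟨(Finset.Icc q T.card).image f, ⟨?_, ?_, ?_, ?_⟩, ?_⟩
  · exact (Finset.nonempty_Icc.2 hqT).image _
  · intro σ hσ
    obtain ⟨i, hi, rfl⟩ := Finset.mem_image.1 hσ
    obtain ⟨h1, h2⟩ := Finset.mem_Icc.1 hi
    exact K.down_closed hT (hsub i) (Finset.card_pos.1 (by rw [hcard i h2]; omega))
  · intro σ hσ τ hτ _
    obtain ⟨i, -, rfl⟩ := Finset.mem_image.1 hσ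
    obtain ⟨j, -, rfl⟩ := Finset.mem_image.1 hτ
    exact (le_total i j).imp (hmono i j) (hmono j i)
  · intro σ hσ
    obtain ⟨i, hi, rfl⟩ := Finset.mem_image.1 hσ
    obtain ⟨h1, h2⟩ := Finset.mem_Icc.1 hi
    rwa [hcard i h2]
  · rw [Finset.card_image_of_injOn, Nat.card_Icc]
    intro i hi j hj h
    rw [← hcard i (Finset.mem_Icc.1 hi).2, ← hcard j (Finset.mem_Icc.1 hj).2]
    exact congrArg Finset.card h

theorem hasDimension_dualComplex (hvs : ∀ s ∈ K.faces, s ⊆ vs) {d k : ℕ} (hk : k < d)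
    (hd : K.HasDimension d) : (dualComplex hvs (k + 2)).HasDimension (d - k - 1) := by
  classical
  have hcard : ∀ C, K.IsFaceChain (k + 2) C →
      (C.image fun t : Finset E => t.centroid ℝ id).card = C.card := fun C hC =>
    Finset.card_image_of_injOn ((injOn_centroid hvs).mono fun σ hσ => hC.mem_faces σ hσ)
  constructor
  · rintro _ ⟨C, hC, rfl⟩
    have := hC.card_le hd.1
    have := hcard C hC
    omega
  · obtain ⟨T, hT, hTd⟩ := hd.2
    obtain ⟨C, hC, hCcard⟩ := exists_isFaceChain_card_eq hT (q := k + 2) (by omega) (by omega)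
    refine ⟨_, ⟨C, hC, rfl⟩, ?_⟩
    have := hcard C hC
    omega

end Geometry.SimplicialComplex

/-! ### The push as the inverse of a homothety -/

namespace PreAbstractSimplicialComplex

variable {ι : Type*} {K : PreAbstractSimplicialComplex ι} {w : ι → ℝ} {σ ρ : Finset ι} {v : ι}

theorem le_offMass (hw : w ∈ K.realization) (hv : v ∉ ρ) : w v ≤ offMass ρ w := by
  classical
  have h := sum_le_one_of_mem_realization hw (insert v ρ)
  rw [Finset.sum_insert hv] at h
  rw [offMass]
  linarith

/-- Near a simplex and far from its proper faces, the coordinates in the simplex are large. -/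
theorem le_offMass_add (hσ : σ ∈ K.faces) {c : ℝ} (hc1 : c ≤ 1)
    (h : ∀ ρ ∈ K.faces, ρ ⊂ σ → c ≤ offMass ρ w) (hv : v ∈ σ) : c ≤ offMass σ w + w v := by
  classical
  have h1 : offMass (σ.erase v) w = offMass σ w + w v := by
    rw [offMass, offMass, ← Finset.add_sum_erase σ w hv]
    ring
  rw [← h1]
  rcases (σ.erase v).eq_empty_or_nonempty with he | he
  · rw [he, offMass, Finset.sum_empty, sub_zero]
    exact hc1
  · exact h _ ((K.isRelLowerSet_faces hσ).2 (Finset.erase_subset v σ) he) (Finset.erase_ssubset hv)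

open scoped Classical in
/-- The projection of `w` to the simplex `σ`, from the opposite simplex. -/
noncomputable def proj (σ : Finset ι) (w : ι → ℝ) (v : ι) : ℝ :=
  if v ∈ σ then w v / (1 - offMass σ w) else 0

theorem proj_of_mem (hv : v ∈ σ) : proj σ w v = w v / (1 - offMass σ w) := if_pos hv

theorem proj_of_notMem (hv : v ∉ σ) : proj σ w v = 0 := if_neg hv

theorem proj_mem_realization (hσ : σ ∈ K.faces) (hw : w ∈ K.realization) (h1 : offMass σ w < 1) :
    proj σ w ∈ K.realization := by
  have h2 : 0 < 1 - offMass σ w := sub_pos.2 h1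
  refine ⟨fun v => ?_, σ, hσ, fun v => proj_of_notMem, ?_⟩
  · by_cases hv : v ∈ σ
    · rw [proj_of_mem hv]
      exact div_nonneg (hw.1 v) h2.le
    · rw [proj_of_notMem hv]
  · rw [Finset.sum_congr rfl fun v hv => proj_of_mem hv, ← Finset.sum_div,
      div_eq_one_iff_eq h2.ne', offMass]
    ring

theorem offMass_proj (hσ : σ ∈ K.faces) (hw : w ∈ K.realization) (h1 : offMass σ w < 1) :
    offMass σ (proj σ w) = 0 := by
  rw [offMass, sum_eq_one_of_mem_realization (proj_mem_realization hσ hw h1)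
    fun v => proj_of_notMem, sub_self]

theorem le_proj (hw : w ∈ K.realization) (h1 : offMass σ w < 1) (hv : v ∈ σ) :
    w v ≤ proj σ w v := by
  rw [proj_of_mem hv, le_div_iff₀ (sub_pos.2 h1)]
  nlinarith [hw.1 v, offMass_nonneg hw σ]

/-- The point `w` is a convex combination of its projection and of the pushed point. -/
theorem exists_eq_proj_add_push {θ t : ℝ} (ht : t ∈ Icc (0 : ℝ) 1) (h0 : 0 < offMass σ w)
    (h : offMass σ w < θ) (hθ : θ < 1) : ∃ μ ∈ Icc (0 : ℝ) 1, ∀ v,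
      w v = proj σ w v + μ * (push σ θ t w v - proj σ w v) := by
  have h1 : 0 < 1 - offMass σ w := by linarith
  set s := offMass σ w with hs
  have h3 : s ≤ s + t * (θ - s) := le_add_of_nonneg_right (mul_nonneg ht.1 (by linarith))
  have h2 : 0 < s + t * (θ - s) := h0.trans_le h3
  -- The ratio of the weights outside `σ` before and after the push.
  refine ⟨s / (s + t * (θ - s)), ⟨by positivity, (div_le_one h2).2 h3⟩, fun v => ?_⟩
  by_cases hv : v ∈ σ
  · rw [proj_of_mem hv, push_of_mem hv h, ← hs]
    field_simp
    ring
  · rw [proj_of_notMem hv, push_of_notMem hv h, ← hs]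
    field_simp
    ring

theorem abs_push_sub_proj_le {θ t : ℝ} (hσ : σ ∈ K.faces) (hw : w ∈ K.realization)
    (ht : t ∈ Icc (0 : ℝ) 1) (h0 : 0 < offMass σ w) (h : offMass σ w < θ) (hθ : θ < 1) (v : ι) :
    |push σ θ t w v - proj σ w v| ≤ θ := by
  have h1 : 0 < 1 - offMass σ w := by linarith
  have hp := proj_mem_realization hσ hw (h.trans hθ)
  have hle : offMass σ w + t * (θ - offMass σ w) ≤ θ := by nlinarith [ht.2]
  have hge : 0 ≤ offMass σ w + t * (θ - offMass σ w) := by nlinarith [ht.1]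
  by_cases hv : v ∈ σ
  · have h2 : push σ θ t w v - proj σ w v =
        -((offMass σ w + t * (θ - offMass σ w)) * proj σ w v) := by
      rw [push_of_mem hv h, proj_of_mem hv]
      field_simp
      ring
    have h3 := sum_le_one_of_mem_realization hp {v}
    rw [Finset.sum_singleton] at h3
    rw [h2, abs_neg, abs_of_nonneg (mul_nonneg hge (hp.1 v))]
    exact (mul_le_of_le_one_right hge h3).trans hle
  · have h2 : push σ θ t w v =
        (offMass σ w + t * (θ - offMass σ w)) * (w v / offMass σ w) := by
      rw [push_of_notMem hv h]
      field_simp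
    have h3 : w v / offMass σ w ≤ 1 := (div_le_one h0).2 (le_offMass hw hv)
    rw [proj_of_notMem hv, sub_zero, h2,
      abs_of_nonneg (mul_nonneg hge (div_nonneg (hw.1 v) h0.le))]
    exact (mul_le_of_le_one_right hge h3).trans hle

end PreAbstractSimplicialComplex

/-! ### The push and the Riemannian distance to simplices -/

namespace SmoothTriangulation

open PreAbstractSimplicialComplex Geometry.SimplicialComplex

variable {d N : ℕ} {M : Type*} [MetricSpace M] [ChartedSpace (EuclideanSpace ℝ (Fin d)) M]

/-- The distance to the simplex `ρ`, in barycentric coordinates. -/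
noncomputable def distSimplex (K : SmoothTriangulation d N M)
    (vs ρ : Finset (EuclideanSpace ℝ (Fin N))) (w : EuclideanSpace ℝ (Fin N) → ℝ) : ENNReal :=
  Metric.infEDist (K.toFun (toPoint vs w)) (K.simplex ρ)

variable (K : SmoothTriangulation d N M) {vs : Finset (EuclideanSpace ℝ (Fin N))}
  (hvs : ∀ s ∈ K.complex.faces, s ⊆ vs)
include hvs

theorem continuousOn_toFun_toPoint :
    ContinuousOn (fun w => K.toFun (toPoint vs w)) K.complex.realization :=
  K.continuousOn_toFun.comp (continuous_toPoint vs).continuousOn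
    fun _ => toPoint_mem_space hvs

theorem distSimplex_eq_zero_iff {ρ : Finset (EuclideanSpace ℝ (Fin N))}
    (hρ : ρ ∈ K.complex.faces) {w : EuclideanSpace ℝ (Fin N) → ℝ}
    (hw : w ∈ K.complex.realization) : K.distSimplex vs ρ w = 0 ↔ offMass ρ w = 0 := by
  have hclosed : IsClosed (K.simplex ρ) :=
    ((ρ.finite_toSet.isCompact_convexHull (𝕜 := ℝ)).image_of_continuousOn
      (K.continuousOn_toFun.mono (K.complex.convexHull_subset_space hρ))).isClosed
  rw [distSimplex, ← Metric.mem_closure_iff_infEDist_zero, hclosed.closure_eq,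
    ← toPoint_mem_convexHull_iff_offMass hvs hρ hw]
  constructor
  · rintro ⟨x, hx, hxw⟩
    have h1 := K.inv_toFun (K.complex.convexHull_subset_space hρ hx)
    rw [hxw, K.inv_toFun (toPoint_mem_space hvs hw)] at h1
    rwa [h1]
  · exact fun h => ⟨_, h, rfl⟩

/-- The distance to `ρ` is continuous and vanishes only on `ρ`, so it has a positive minimum on the
compact set where the weight outside `ρ` is at least `c`. -/
theorem exists_le_distSimplex {c : ℝ} (hc : 0 < c) : ∃ r : ℝ, 0 < r ∧ ∀ ρ ∈ K.complex.faces,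
    ∀ w ∈ K.complex.realization, c ≤ offMass ρ w → ENNReal.ofReal r ≤ K.distSimplex vs ρ w := by
  have h : ∀ᶠ r : ℝ in 𝓝[>] 0, ∀ ρ ∈ K.complex.faces, ∀ w ∈ K.complex.realization,
      c ≤ offMass ρ w → ENNReal.ofReal r ≤ K.distSimplex vs ρ w := by
    refine (Filter.eventually_all_finite K.finite_faces).2 fun ρ hρ => ?_
    rcases (K.complex.realization ∩ {w | c ≤ offMass ρ w}).eq_empty_or_nonempty with he | hne
    · exact Filter.Eventually.of_forall fun r w hw hcw => by
        have h1 : w ∈ K.complex.realization ∩ {w | c ≤ offMass ρ w} := ⟨hw, hcw⟩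
        rw [he] at h1
        exact absurd h1 (notMem_empty w)
    · obtain ⟨w₀, ⟨hw₀, hcw₀⟩, hmin⟩ := ((isCompact_realization K.finite_faces).inter_right
        (isClosed_le continuous_const (continuous_offMass ρ))).exists_isMinOn hne
        (f := K.distSimplex vs ρ) (Metric.continuous_infEDist.comp_continuousOn
          ((K.continuousOn_toFun_toPoint hvs).mono inter_subset_left))
      have hpos : 0 < K.distSimplex vs ρ w₀ := pos_iff_ne_zero.2 fun h0 => by
        rw [K.distSimplex_eq_zero_iff hvs hρ hw₀] at h0
        exact (hc.trans_le hcw₀).ne' h0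
      have htend : Filter.Tendsto ENNReal.ofReal (𝓝[>] 0) (𝓝 0) := by
        rw [← ENNReal.ofReal_zero]
        exact (ENNReal.continuous_ofReal.tendsto 0).mono_left nhdsWithin_le_nhds
      filter_upwards [htend.eventually_lt_const hpos] with r hr w hw hcw
      exact hr.le.trans (hmin ⟨hw, hcw⟩)
  obtain ⟨r, hr, hr0⟩ := (h.and self_mem_nhdsWithin).exists
  exact ⟨r, hr0, hr⟩

/-- If `ρ` contains `σ`, the original point is a homothetic image of the pushed one, hence no
farther from `ρ`. If not, the pushed point keeps a definite weight outside `ρ`, and thresholds `r ≤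
r₀` are harmless. -/
theorem exists_le_distSimplex_push [RiemannianBundle (fun x : M => TangentSpace (𝓡 d) x)]
    [IsManifold (𝓡 d) ∞ M]
    [IsContMDiffRiemannianBundle (𝓡 d) ∞ (EuclideanSpace ℝ (Fin d))
      (fun x : M => TangentSpace (𝓡 d) x)]
    [IsRiemannianManifold (𝓡 d) M] [CompactSpace M]
    {σ : Finset (EuclideanSpace ℝ (Fin N))} (hσ : σ ∈ K.complex.faces) {c : ℝ} (hc : 0 < c) :
    ∃ θ, 0 < θ ∧ θ ≤ c ∧ ∃ r₀ > 0, ∀ w ∈ K.complex.realization,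
      (∀ ρ ∈ K.complex.faces, ρ ⊂ σ → c ≤ offMass ρ w) → 0 < offMass σ w → offMass σ w < θ →
      ∀ t ∈ Icc (0 : ℝ) 1, ∀ ρ ∈ K.complex.faces, ∀ r ≤ r₀, r ≤ K.distSimplex vs ρ w →
        r ≤ K.distSimplex vs ρ (push σ θ t w) := by
  set c' := min c 1 with hc'
  have hc'0 : 0 < c' := lt_min hc one_pos
  have hc'1 : c' ≤ 1 := min_le_right _ _
  have hc'c : c' ≤ c := min_le_left _ _
  -- A compact part of the relative interior of `σ` that contains all the projections used as
  -- centres; the bound `c' / 2` keeps it away from the faces that do not contain `σ`.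
  set B : Set (EuclideanSpace ℝ (Fin N) → ℝ) :=
    K.complex.realization ∩ ({w | offMass σ w = 0} ∩ ⋂ v ∈ σ, {w | c' / 2 ≤ w v}) with hB
  have hBc : IsCompact B := (isCompact_realization K.finite_faces).inter_right
    ((isClosed_eq (continuous_offMass σ) continuous_const).inter
      (isClosed_biInter fun v _ => isClosed_le continuous_const (continuous_apply v)))
  obtain ⟨R, hR, hRmain⟩ := K.exists_infEDist_homothety_le (σ := σ) (A := toPoint vs '' B)
    (hBc.image (continuous_toPoint vs)) (by
      rintro _ ⟨w, ⟨hw, hw0, -⟩, rfl⟩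
      exact (toPoint_mem_convexHull_iff_offMass hvs hσ hw).2 hw0) hσ (by
      rintro _ ⟨w, ⟨hw, -, hwσ⟩, rfl⟩ τ hτ h v hv
      by_contra hvτ
      have h1 := (toPoint_mem_convexHull_iff hvs hτ hw).1 h v hvτ
      have h2 : c' / 2 ≤ w v := mem_iInter₂.1 hwσ v hv
      linarith)
  obtain ⟨r₁, hr₁, hr₁main⟩ := K.exists_le_distSimplex hvs (c := c' / 8) (by linarith)
  have hS : 0 ≤ ∑ v ∈ vs, ‖v‖ := Finset.sum_nonneg fun v _ => norm_nonneg v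
  -- The first bound keeps the coordinates in `σ` large. The second keeps the pushed point within
  -- `R` of the centre, since each coordinate differs by at most `θ`.
  set θ := min (c' / 8) (R / (1 + ∑ v ∈ vs, ‖v‖)) with hθ
  have hθ0 : 0 < θ := lt_min (by linarith) (by positivity)
  have hθc : θ ≤ c' / 8 := min_le_left _ _
  have hθ1 : θ < 1 := by linarith
  have hθR : θ * ∑ v ∈ vs, ‖v‖ < R := by
    have h1 : θ ≤ R / (1 + ∑ v ∈ vs, ‖v‖) := min_le_right _ _
    rw [le_div_iff₀ (by linarith)] at h1
    linarith
  refine ⟨θ, hθ0, by linarith, ENNReal.ofReal r₁, ENNReal.ofReal_pos.2 hr₁,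
    fun w hw hfar h0 hlt t ht ρ hρ r hr hrw => ?_⟩
  have hcoord : ∀ v ∈ σ, c' ≤ offMass σ w + w v := fun v hv =>
    le_offMass_add hσ hc'1 (fun ρ hρ hρσ => hc'c.trans (hfar ρ hρ hρσ)) hv
  have hpush := push_mem_realization hw hθ1 ht h0
  by_cases hσρ : σ ⊆ ρ
  · have hp := proj_mem_realization hσ hw (hlt.trans hθ1)
    obtain ⟨μ, hμ, hwμ⟩ := exists_eq_proj_add_push ht h0 hlt hθ1
    have hsub : toPoint vs (push σ θ t w) - toPoint vs (proj σ w) =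
        ∑ v ∈ vs, (push σ θ t w v - proj σ w v) • v := by
      simp only [toPoint, sub_smul, Finset.sum_sub_distrib]
    have hpt : toPoint vs (proj σ w) +
        μ • (toPoint vs (push σ θ t w) - toPoint vs (proj σ w)) = toPoint vs w := by
      rw [hsub, toPoint, toPoint, Finset.smul_sum, ← Finset.sum_add_distrib]
      exact Finset.sum_congr rfl fun v _ => by rw [smul_smul, ← add_smul, ← hwμ v]
    have hmain := hRmain (toPoint vs (proj σ w)) ⟨_, ⟨hp, offMass_proj hσ hw (hlt.trans hθ1),
      mem_iInter₂.2 fun v hv => ?_⟩, rfl⟩ _ (toPoint_mem_space hvs hpush) ?_ μ hμ ρ hρ hσρ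
    · rw [hpt] at hmain
      exact hrw.trans hmain
    · have h1 := hcoord v hv
      have h2 := le_proj hw (hlt.trans hθ1) hv
      change c' / 2 ≤ proj σ w v
      linarith
    · rw [hsub]
      refine (norm_sum_le _ _).trans_lt (lt_of_le_of_lt ?_ hθR)
      rw [Finset.mul_sum]
      refine Finset.sum_le_sum fun v _ => ?_
      rw [norm_smul, Real.norm_eq_abs]
      exact mul_le_mul_of_nonneg_right (abs_push_sub_proj_le hσ hw ht h0 hlt hθ1 v)
        (norm_nonneg v)
  -- A vertex of `σ` outside `ρ` has weight at least `c' - θ ≥ c' / 2`, of which the push leaves at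
  -- least `c' / 8` outside `ρ`.
  · obtain ⟨v, hv, hvρ⟩ := Finset.not_subset.1 hσρ
    have h1 := hcoord v hv
    have h2 := le_offMass hw hvρ
    refine hr.trans (hr₁main ρ hρ _ hpush ?_)
    have h3 := le_offMass_push (c := c' / 2) (ρ := ρ) hw hθ1 ht h0 (by linarith) (by linarith)
      (by linarith)
    linarith

end SmoothTriangulation

/-! ### Homotopy type of the complement of the neighbourhood -/

namespace SmoothTriangulation

open PreAbstractSimplicialComplex Geometry.SimplicialComplex

variable {d N : ℕ} {M : Type*} [MetricSpace M] [ChartedSpace (EuclideanSpace ℝ (Fin d)) M]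
  (K : SmoothTriangulation d N M) {vs : Finset (EuclideanSpace ℝ (Fin N))}
  (hvs : ∀ s ∈ K.complex.faces, s ⊆ vs)

theorem notMem_V_iff {C₀ δ : ℝ} {k : ℕ} {w : EuclideanSpace ℝ (Fin N) → ℝ} :
    K.toFun (toPoint vs w) ∉ K.V C₀ k δ ↔ ∀ ρ ∈ K.complex.faces, ρ.card ≤ k + 1 →
      ENNReal.ofReal ((C₀ ^ (ρ.card - 1))⁻¹ * δ) ≤ K.distSimplex vs ρ w := by
  simp only [V, mem_iUnion, mem_ofPred_eq, exists_prop, not_exists, not_and,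
    Metric.mem_thickening_iff_infEDist_lt, not_lt, distSimplex, and_imp]
  constructor
  · intro h ρ hρ hk
    have h1 := Finset.card_pos.2 (K.complex.nonempty_of_mem_faces hρ)
    exact h (ρ.card - 1) (by omega) ρ hρ (by omega)
  · intro h i hi ρ hρ hρi
    have h1 := h ρ hρ (by omega)
    rwa [hρi, Nat.add_sub_cancel] at h1

include hvs

/-- The complement of the neighbourhood `V` in barycentric coordinates. -/
theorem nonempty_homeomorph_compl_V (C₀ δ : ℝ) (k : ℕ) :
    Nonempty ({w ∈ K.complex.realization | K.toFun (toPoint vs w) ∉ K.V C₀ k δ} ≃ₜ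
      ((K.V C₀ k δ)ᶜ : Set M)) :=
  ⟨(((realizationHomeomorph K.finite_faces hvs).trans K.homeo).trans
    (Homeomorph.Set.univ M).symm).restrictSubsets (fun _ h => h.1) (subset_univ _)
    fun w => ⟨fun h => h.2, fun h => ⟨w.2, h⟩⟩⟩

theorem nonempty_homeomorph_dualComplex (k : ℕ) :
    Nonempty (K.complex.dualRealization k ≃ₜ (dualComplex hvs (k + 2)).space) := by
  have hsub : toPoint vs '' K.complex.dualRealization k ⊆ K.complex.space := by
    rintro _ ⟨w, hw, rfl⟩
    exact toPoint_mem_space hvs hw.1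
  rw [space_dualComplex]
  refine ⟨(realizationHomeomorph K.finite_faces hvs).restrictSubsets (fun _ h => h.1) hsub
    fun w => ?_⟩
  rw [realizationHomeomorph_apply]
  refine ⟨fun h => ⟨w, h, rfl⟩, ?_⟩
  rintro ⟨w', hw', h⟩
  rwa [← injOn_toPoint hvs hw'.1 w.2 h]

/-- The bound `δ₀` does not depend on `C₀`: for `C₀ ≥ 1` all radii are at most `δ`, and the pushing
homotopy preserves the far points for every small radius and every simplex separately. -/
theorem exists_nonempty_homotopyEquiv_compl_V
    [RiemannianBundle (fun x : M => TangentSpace (𝓡 d) x)] [IsManifold (𝓡 d) ∞ M]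
    [IsContMDiffRiemannianBundle (𝓡 d) ∞ (EuclideanSpace ℝ (Fin d))
      (fun x : M => TangentSpace (𝓡 d) x)]
    [IsRiemannianManifold (𝓡 d) M] [CompactSpace M] (k : ℕ) :
    ∃ δ₀ > 0, ∀ C₀ ≥ (1 : ℝ), ∀ δ : ℝ, 0 < δ → δ < δ₀ →
      Nonempty (ContinuousMap.HomotopyEquiv ((K.V C₀ k δ)ᶜ : Set M)
        (dualComplex hvs (k + 2)).space) := by
  obtain ⟨c, hc, r₀, hr₀, f, ⟨F⟩, hf⟩ := exists_homotopyWith_preservesFar (k := k) K.finite_faces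
    (K.distSimplex vs) fun σ hσ _ c hc => K.exists_le_distSimplex_push hvs hσ hc
  obtain ⟨r₁, hr₁, hr₁le⟩ := K.exists_le_distSimplex hvs hc
  have hfin : min r₀ 1 ≠ ⊤ := ((min_le_right _ _).trans_lt ENNReal.one_lt_top).ne
  refine ⟨min r₁ (min r₀ 1).toReal,
    lt_min hr₁ (ENNReal.toReal_pos (lt_min hr₀ one_pos).ne' hfin), fun C₀ hC₀ δ hδ hδlt => ?_⟩
  have hle : ∀ i : ℕ, (C₀ ^ i)⁻¹ * δ ≤ δ := fun i =>
    mul_le_of_le_one_left hδ.le (inv_le_one_of_one_le₀ (one_le_pow₀ hC₀))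
  have hle₁ : ∀ i : ℕ, ENNReal.ofReal ((C₀ ^ i)⁻¹ * δ) ≤ ENNReal.ofReal r₁ := fun i =>
    ENNReal.ofReal_le_ofReal ((hle i).trans (hδlt.le.trans (min_le_left _ _)))
  have hle₀ : ∀ i : ℕ, ENNReal.ofReal ((C₀ ^ i)⁻¹ * δ) ≤ r₀ := fun i =>
    (ENNReal.ofReal_le_of_le_toReal ((hle i).trans (hδlt.le.trans (min_le_right _ _)))).trans
      (min_le_left _ _)
  obtain ⟨e⟩ := K.nonempty_homeomorph_compl_V hvs C₀ δ k
  obtain ⟨e'⟩ := K.nonempty_homeomorph_dualComplex hvs k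
  -- The end of the homotopy lies off `V` because its weights outside the simplices are at least
  -- `c`, which forces distances of at least `r₁`; at all times the homotopy preserves the
  -- complement of `V`.
  obtain ⟨h₁⟩ := nonempty_homotopyEquiv_of_homotopy
    (A := {w ∈ K.complex.realization | K.toFun (toPoint vs w) ∉ K.V C₀ k δ})
    (B := K.complex.skeletonCompl k) (f := f) (fun w hw => by
      refine ⟨hw.1, fun ρ hρ hρk => lt_of_le_of_ne (offMass_nonneg hw.1 ρ) fun h0 => ?_⟩
      have h1 := K.notMem_V_iff.1 hw.2 ρ hρ hρk
      rw [(K.distSimplex_eq_zero_iff hvs hρ hw.1).2 h0.symm] at h1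
      have hpos : 0 < (C₀ ^ (ρ.card - 1))⁻¹ * δ := by positivity
      exact (ENNReal.ofReal_pos.2 hpos).not_ge h1) F.toHomotopy
    (fun w => ⟨(f w).2.1, K.notMem_V_iff.2 fun ρ hρ hρk =>
      (hle₁ _).trans (hr₁le ρ hρ _ (f w).2.1 (hf w ρ hρ hρk))⟩)
    fun t w hw => ⟨(F (t, w)).2.1, K.notMem_V_iff.2 fun ρ hρ hρk =>
      F.prop t w ρ hρ _ (hle₀ _) (K.notMem_V_iff.1 hw.2 ρ hρ hρk)⟩
  obtain ⟨h₂⟩ := (isDeformationRetract_dualRealization (K :=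
    K.complex.toPreAbstractSimplicialComplex) K.finite_faces k).nonempty_homotopyEquiv
  exact ⟨e.symm.toHomotopyEquiv.trans (h₁.trans (h₂.symm.trans e'.toHomotopyEquiv))⟩

end SmoothTriangulation

theorem lemma5p1 (m n : ℕ) (hm : 0 < m) (hn : 0 < n)
    {M : Type*} [MetricSpace M] [ChartedSpace (EuclideanSpace ℝ (Fin (m + n))) M]
    [IsManifold (𝓡 (m + n)) ∞ M]
    [RiemannianBundle (fun x : M => TangentSpace (𝓡 (m + n)) x)]
    [IsContMDiffRiemannianBundle (𝓡 (m + n)) ∞ (EuclideanSpace ℝ (Fin (m + n)))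
      (fun x : M => TangentSpace (𝓡 (m + n)) x)]
    [IsRiemannianManifold (𝓡 (m + n)) M]
    [CompactSpace M] [ConnectedSpace M]
    {N : ℕ} (K : SmoothTriangulation (m + n) N M) (k : ℕ) (hk : k < m + n) :
    ∃ L : Geometry.SimplicialComplex ℝ (EuclideanSpace ℝ (Fin N)),
      L.faces = K.complex.dualSkeleton (m + n) (m + n - k - 1) ∧
      L.HasDimension (m + n - k - 1) ∧
      ∃ C₁ : ℝ, ∀ C₀ ≥ C₁, ∃ δbar > 0, ∀ δ' δ : ℝ, 0 < δ' → δ' < δ → δ < δbar →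
        ∀ U : Set M, IsSmoothedNeighborhood K C₀ k δ' δ U →
          Nonempty (ContinuousMap.HomotopyEquiv (Uᶜ : Set M) L.space) := by
  classical
  have hvs : ∀ s ∈ K.complex.faces, s ⊆ K.finite_faces.toFinset.sup id := fun s hs =>
    Finset.le_sup (f := id) (K.finite_faces.mem_toFinset.2 hs)
  -- Faces of dimension at least `k + 1` have at least `k + 2` vertices. The constant `C₁` is `1`.
  refine ⟨Geometry.SimplicialComplex.dualComplex hvs (k + 2), ?_,
    Geometry.SimplicialComplex.hasDimension_dualComplex hvs hk
      ⟨fun s hs => K.card_le hs, K.exists_card_eq⟩, 1, fun C₀ hC₀ => ?_⟩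
  · ext u
    -- The truncated subtraction `m + n - k - 1` is exact because `k < m + n`.
    rw [Geometry.SimplicialComplex.mem_dualSkeleton_iff K.finite_faces (q := k + 2)
      fun c => by omega]
    rfl
  · obtain ⟨δ₀, hδ₀, h⟩ := K.exists_nonempty_homotopyEquiv_compl_V hvs k
    refine ⟨δ₀, hδ₀, fun δ' δ hδ' hlt hδ U hU => ?_⟩
    obtain ⟨h₁⟩ := hU.deformationRetract.nonempty_homotopyEquiv
    obtain ⟨h₂⟩ := h C₀ hC₀ δ' hδ' (hlt.trans hδ)
    exact ⟨h₁.trans h₂⟩
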